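/- Let $\mathcal H_{tw}$ be the twisted Heisenberg category: the strict $\mathbb C$-linear $\mathbb Z/2$-graded monoidal category (with the super interchange law) whose objects are finite sequences of $P$ (upward strand) and $Q$ (downward strand), and whose morphisms are linear combinations of oriented planar string diagrams, up to boundary-fixing isotopy, generated by the crossing of two upward strands, the four oriented cups and caps (all even) and a hollow dot on an upward or downward strand (odd). In $x\otimes y$ the diagram $y$ is to the right of $x$ and its hollow dots are lower; exchanging the heights of two hollow dots on different strands gives a sign. The relations are: two upward strands that cross twice can be pulled apart, and the braid relation holds for three upward strands; a double crossing $PQ\to QP\to PQ$ is the identity; the double crossing $QP\to PQ\to QP$ equals $\mathrm{id}_{QP}-\mathrm{cup}\circ\mathrm{cap}-\mathrm{cup}^{\circ}\circ\mathrm{cap}^{\circ}$, where cup and cap are $1\to QP$ and $QP\to 1$, in $\mathrm{cup}^\circ$ there is a hollow dot on the $Q$-leg and in $\mathrm{cap}^\circ$ a hollow dot on the $P$-leg; a counterclockwise bubble is $1$, a counterclockwise bubble with one hollow dot is $0$, a left curl on an upward strand is $0$; hollow dots slide through upward crossings; a hollow dot slides along the cup $1\to QP$ and the cap $PQ\to 1$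 without sign, and along the cup $1\to PQ$ and the cap $QP\to 1$ with a sign $-1$; two hollow dots on an upward strand equal the plain strand, two hollow dots on a downward strand equal minus the plain strand. The even trace is the algebra $$\mathrm{Tr}(\mathcal H_{tw})_{\overline 0}=\Big(\bigoplus_{x}\mathrm{End}_{\overline 0}(x)\Big)\Big/\big\langle fg-gf\big\rangle ,$$ where $x$ runs over the objects, $\mathrm{End}_{\overline 0}$ denotes even endomorphisms, the product is the tensor product, and $f:x\to y$, $g:y\to x$ run over homogeneous morphisms of equal parity (so that $fg$ and $gf$ are even). For $n\ge1$ let $h_n$ (respectively $h_{-n}$) be the class of the $n$-cycle on $n$ upward (respectively downward) strands, in which one strand joins the rightmost bottom point to the leftmost top point and every other strand moves one step to the right. Let $\mathfrak h_{tw}$ be the twisted Heisenberg algebra: the unital associative $\mathbb C$-algebra generated by $h_r$, $r\in\mathbb Z+\tfrac12$, with the relations $[h_r,h_s]=r\,\delta_{r,-s}$. Let $\widehat{\mathcal D}$ be the Lie algebra spanned by $C$ and the $t^rf(D)$ ($r\in\mathbb Z$, $f\in\mathbb C[w]$), with $C$ central and $$[t^rf(D),t^sg(D)]=t^{r+s}\big(f(D+s)g(D)-f(D)g(D+r)\big)+\psi(t^rf(D),t^sg(D))\,C,$$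 where $\psi$ is the antisymmetric form with $\psi(t^rf(D),t^sg(D))=\sum_{-r\le j\le -1}f(j)g(j+r)$ if $r=-s\ge0$ and $0$ if $r+s\ne0$. Let $\widehat{\mathcal D}^-\subset\widehat{\mathcal D}$ be the Lie subalgebra of the elements $a+zC$ with $\sigma(a)=-a$, where $\sigma(t^kf(D))=f(-D)(-t)^k$. Let $W^-$ be the universal enveloping algebra of $\widehat{\mathcal D}^-$, and put $w_{2n+1,0}=t^{2n+1}\in W^-$. Then: 1. For all integers $n,m\ge0$, in $\mathrm{Tr}(\mathcal H_{tw})_{\overline 0}$, $$[h_{2n+1},h_{-(2m+1)}]=\delta_{n,m}\,\bigl(-2(2n+1)\bigr).$$ 2. For all $n,m\in\mathbb Z$, in $W^-$, $[w_{2n+1,0},w_{2m+1,0}]=(2n+1)\,\delta_{2n+1,-(2m+1)}\,C$. 3. Let $A\subset\mathrm{Tr}(\mathcal H_{tw})_{\overline 0}$ be the subalgebra generated by all $h_{2n+1}$, $n\in\mathbb Z$, and let $B\subset W^- /\langle C-1\rangle$ be the subalgebra generated by all $w_{2n+1,0}$, $n\in\mathbb Z$. There are algebra isomorphisms $$\phi:\mathfrak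 h_{tw}\to A,\quad h_{\frac{2n+1}2}\mapsto\tfrac12h_{-(2n+1)},\qquad \psi:\mathfrak h_{tw}\to B,\quad h_{\frac{2n+1}2}\mapsto\tfrac1{\sqrt2}\,w_{2n+1,0}\qquad(n\in\mathbb Z),$$ so that $\psi\circ\phi^{-1}:A\to B$ is an algebra isomorphism with $h_{-(2n+1)}\mapsto\sqrt2\,w_{2n+1,0}$ for all $n\in\mathbb Z$. -/

import Mathlib

namespace TwistedHeis

noncomputable section

/-! ## Formal string diagrams -/

/-- The two generating objects: upward strands `P` and downward strands `Q`. -/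
inductive Letter : Type
  | P
  | Q

/-- Objects are finite sequences of `P`s and `Q`s; the tensor product of objects is concatenation,
written additively, and the monoidal unit is the empty sequence `0`. -/
abbrev Word : Type := FreeAddMonoid Letter

instance : DecidableEq Word := Classical.decEq _

/-- The object `P`, an upward strand. -/
abbrev P : Word := FreeAddMonoid.of Letter.P

/-- The object `Q`, a downward strand. -/
abbrev Q : Word := FreeAddMonoid.of Letter.Q

/-- The generating morphisms, read from bottom to top. -/
inductive Gen : Word → Word → Type
  /-- hollow dot on an upward strand -/
  | dotUp : Gen P P
  /-- hollow dot on a downward strand -/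
  | dotDown : Gen Q Q
  /-- crossing of two upward strands -/
  | cross : Gen (P + P) (P + P)
  /-- cup oriented from left to right -/
  | cupR : Gen 0 (Q + P)
  /-- cup oriented from right to left -/
  | cupL : Gen 0 (P + Q)
  /-- cap oriented from left to right -/
  | capR : Gen (P + Q) 0
  /-- cap oriented from right to left -/
  | capL : Gen (Q + P) 0

/-- The hollow dots are odd, all other generators are even. -/
def Gen.parity : ∀ {X Y : Word}, Gen X Y → ZMod 2
  | _, _, .dotUp => 1
  | _, _, .dotDown => 1
  | _, _, .cross => 0
  | _, _, .cupR => 0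
  | _, _, .cupL => 0
  | _, _, .capR => 0
  | _, _, .capL => 0

/-- Formal `ℂ`-linear combinations of string diagrams with bottom boundary `X` and top
boundary `Y`. In `comp f g` the diagram `g` is stacked on top of `f`. In `tensor f g` the diagram
`g` stands to the right of `f`, and the hollow dots of `g` are lower than those of `f`. -/
inductive Diag : Word → Word → Type
  | id (X : Word) : Diag X X
  | gen {X Y : Word} (g : Gen X Y) : Diag X Y
  | comp {X Y Z : Word} (f : Diag X Y) (g : Diag Y Z) : Diag X Z
  | tensor {X Y X' Y' : Word} (f : Diag X Y) (g : Diag X' Y') : Diag (X + X') (Y + Y')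
  | zero (X Y : Word) : Diag X Y
  | add {X Y : Word} (f g : Diag X Y) : Diag X Y
  | smul {X Y : Word} (r : ℂ) (f : Diag X Y) : Diag X Y

infixr:75 " ⟫ " => Diag.comp
infixl:85 " ⊠ " => Diag.tensor

namespace Diag

/-- Transport of a diagram along equalities of words. -/
def cast {X Y X' Y' : Word} (hX : X = X') (hY : Y = Y') (f : Diag X Y) : Diag X' Y' :=
  hX ▸ hY ▸ f

/-- `HasParity p f`: every diagram in `f` has a number of hollow dots congruent to `p` mod 2. -/
inductive HasParity : ∀ {X Y : Word}, ZMod 2 → Diag X Y → Prop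
  | id (X : Word) : HasParity 0 (Diag.id X)
  | gen {X Y : Word} (g : Gen X Y) : HasParity g.parity (Diag.gen g)
  | comp {X Y Z : Word} {p q : ZMod 2} {f : Diag X Y} {g : Diag Y Z} :
      HasParity p f → HasParity q g → HasParity (p + q) (f ⟫ g)
  | tensor {X Y X' Y' : Word} {p q : ZMod 2} {f : Diag X Y} {g : Diag X' Y'} :
      HasParity p f → HasParity q g → HasParity (p + q) (f ⊠ g)
  | zero (X Y : Word) (p : ZMod 2) : HasParity p (Diag.zero X Y)
  | add {X Y : Word} {p : ZMod 2} {f g : Diag X Y} :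
      HasParity p f → HasParity p g → HasParity p (Diag.add f g)
  | smul {X Y : Word} {p : ZMod 2} (r : ℂ) {f : Diag X Y} :
      HasParity p f → HasParity p (Diag.smul r f)

/-- identity of an upward strand -/
abbrev up : Diag P P := .id P
/-- identity of a downward strand -/
abbrev down : Diag Q Q := .id Q
/-- hollow dot on an upward strand -/
abbrev dotUp : Diag P P := .gen .dotUp
/-- hollow dot on a downward strand -/
abbrev dotDown : Diag Q Q := .gen .dotDown
/-- crossing of two upward strands -/
abbrev cross : Diag (P + P) (P + P) := .gen .cross
/-- cup oriented from left to right -/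
abbrev cupR : Diag 0 (Q + P) := .gen .cupR
/-- cup oriented from right to left -/
abbrev cupL : Diag 0 (P + Q) := .gen .cupL
/-- cap oriented from left to right -/
abbrev capR : Diag (P + Q) 0 := .gen .capR
/-- cap oriented from right to left -/
abbrev capL : Diag (Q + P) 0 := .gen .capL

/-- The crossing with both strands oriented to the right: the upward crossing rotated clockwise
by a quarter turn. -/
def crossRight : Diag (P + Q) (Q + P) :=
  (cupR ⊠ up ⊠ down :) ⟫
  (down ⊠ cross ⊠ down :) ⟫
  (down ⊠ up ⊠ capR :)

/-- The crossing with both strands oriented to the left: the upward crossing rotated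
counterclockwise by a quarter turn. -/
def crossLeft : Diag (Q + P) (P + Q) :=
  (down ⊠ up ⊠ cupL :) ⟫
  (down ⊠ cross ⊠ down :) ⟫
  (capL ⊠ up ⊠ down :)

/-- The downward crossing: `crossRight` rotated clockwise by a quarter turn. -/
def crossDown : Diag (Q + Q) (Q + Q) :=
  (cupR ⊠ down ⊠ down :) ⟫
  (down ⊠ crossRight ⊠ down :) ⟫
  (down ⊠ down ⊠ capR :)

/-- `crossLeft` rotated counterclockwise by a quarter turn. It is isotopic to `crossDown`. -/
def crossDown₂ : Diag (Q + Q) (Q + Q) :=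
  (down ⊠ down ⊠ cupL :) ⟫
  (down ⊠ crossLeft ⊠ down :) ⟫
  (capL ⊠ down ⊠ down :)

/-- The generating relations among string diagrams. -/
inductive LocalRel : ∀ {X Y : Word}, Diag X Y → Diag X Y → Prop
  -- planar isotopies: zigzags can be straightened, crossings can be rotated
  | zigzag_up_right : LocalRel
      ((up ⊠ cupR :) ⟫ (capR ⊠ up :)) up
  | zigzag_down_right : LocalRel
      ((cupR ⊠ down :) ⟫
        (down ⊠ capR :)) down
  | zigzag_up_left : LocalRel
      ((cupL ⊠ up :) ⟫ (up ⊠ capL :)) up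
  | zigzag_down_left : LocalRel
      ((down ⊠ cupL :) ⟫
        (capL ⊠ down :)) down
  | rotate_cross : LocalRel crossDown crossDown₂
  -- double and triple crossings
  | cross_cross : LocalRel (cross ⟫ cross) (.id (P + P))
  | braid : LocalRel
      ((cross ⊠ up :) ⟫
        (up ⊠ cross :) ⟫
        (cross ⊠ up :))
      ((up ⊠ cross :) ⟫
        (cross ⊠ up :) ⟫
        (up ⊠ cross :))
  | right_left : LocalRel (crossRight ⟫ crossLeft) (.id (P + Q))
  | left_right : LocalRel (crossLeft ⟫ crossRight)
      (.add (.id (Q + P)) (.add (.smul (-1) (capL ⟫ cupR))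
        (.smul (-1) (((down ⊠ dotUp) ⟫ capL) ⟫ (cupR ⟫ (dotDown ⊠ up))))))
  -- the counterclockwise bubble and the left curl
  | bubble : LocalRel (cupR ⟫ capL) (.id 0)
  | left_curl : LocalRel
      ((cupR ⊠ up :) ⟫
        (down ⊠ cross :) ⟫
        (capL ⊠ up :)) (.zero P P)
  -- hollow dots slide through crossings
  | dot_cross_left : LocalRel ((dotUp ⊠ up) ⟫ cross) (cross ⟫ (up ⊠ dotUp))
  | dot_cross_right : LocalRel ((up ⊠ dotUp) ⟫ cross) (cross ⟫ (dotUp ⊠ up))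
  -- hollow dots slide along caps and cups
  | dot_capL : LocalRel ((dotDown ⊠ up) ⟫ capL) (.smul (-1) ((down ⊠ dotUp) ⟫ capL))
  | dot_capR : LocalRel ((dotUp ⊠ down) ⟫ capR) ((up ⊠ dotDown) ⟫ capR)
  | dot_cupR : LocalRel (cupR ⟫ (dotDown ⊠ up)) (cupR ⟫ (down ⊠ dotUp))
  | dot_cupL : LocalRel (cupL ⟫ (dotUp ⊠ down)) (.smul (-1) (cupL ⟫ (up ⊠ dotDown)))
  -- two hollow dots on a strand, one hollow dot on a counterclockwise bubble
  | dotUp_dotUp : LocalRel (dotUp ⟫ dotUp) up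
  | dotDown_dotDown : LocalRel (dotDown ⟫ dotDown) (.smul (-1) down)
  | dot_bubble : LocalRel (cupR ⟫ (down ⊠ dotUp) ⟫ capL) (.zero 0 0)

/-- Equality of morphisms: the smallest congruence that contains `LocalRel` and the axioms of a
strict `ℂ`-linear monoidal supercategory (`ℤ/2`-graded monoidal category). -/
inductive Rel : ∀ {X Y : Word}, Diag X Y → Diag X Y → Prop
  | of_local {X Y : Word} {f g : Diag X Y} : LocalRel f g → Rel f g
  -- equivalence relation and congruence
  | refl {X Y : Word} (f : Diag X Y) : Rel f f
  | symm {X Y : Word} {f g : Diag X Y} : Rel f g → Rel g f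
  | trans {X Y : Word} {f g h : Diag X Y} : Rel f g → Rel g h → Rel f h
  | comp_congr {X Y Z : Word} {f f' : Diag X Y} {g g' : Diag Y Z} :
      Rel f f' → Rel g g' → Rel (f ⟫ g) (f' ⟫ g')
  | tensor_congr {X Y X' Y' : Word} {f f' : Diag X Y} {g g' : Diag X' Y'} :
      Rel f f' → Rel g g' → Rel (f ⊠ g) (f' ⊠ g')
  | add_congr {X Y : Word} {f f' g g' : Diag X Y} :
      Rel f f' → Rel g g' → Rel (add f g) (add f' g')
  | smul_congr {X Y : Word} (r : ℂ) {f f' : Diag X Y} :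
      Rel f f' → Rel (smul r f) (smul r f')
  -- vector space axioms
  | add_assoc {X Y : Word} (f g h : Diag X Y) : Rel (add (add f g) h) (add f (add g h))
  | add_comm {X Y : Word} (f g : Diag X Y) : Rel (add f g) (add g f)
  | zero_add {X Y : Word} (f : Diag X Y) : Rel (add (zero X Y) f) f
  | neg_add {X Y : Word} (f : Diag X Y) : Rel (add (smul (-1) f) f) (zero X Y)
  | one_smul {X Y : Word} (f : Diag X Y) : Rel (smul 1 f) f
  | mul_smul {X Y : Word} (r s : ℂ) (f : Diag X Y) : Rel (smul (r * s) f) (smul r (smul s f))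
  | smul_add {X Y : Word} (r : ℂ) (f g : Diag X Y) :
      Rel (smul r (add f g)) (add (smul r f) (smul r g))
  | add_smul {X Y : Word} (r s : ℂ) (f : Diag X Y) :
      Rel (smul (r + s) f) (add (smul r f) (smul s f))
  -- category axioms
  | id_comp {X Y : Word} (f : Diag X Y) : Rel (.id X ⟫ f) f
  | comp_id {X Y : Word} (f : Diag X Y) : Rel (f ⟫ .id Y) f
  | comp_assoc {X Y Z W : Word} (f : Diag X Y) (g : Diag Y Z) (h : Diag Z W) :
      Rel ((f ⟫ g) ⟫ h) (f ⟫ (g ⟫ h))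
  -- bilinearity of composition and of the tensor product
  | add_comp {X Y Z : Word} (f f' : Diag X Y) (g : Diag Y Z) :
      Rel (add f f' ⟫ g) (add (f ⟫ g) (f' ⟫ g))
  | comp_add {X Y Z : Word} (f : Diag X Y) (g g' : Diag Y Z) :
      Rel (f ⟫ add g g') (add (f ⟫ g) (f ⟫ g'))
  | smul_comp {X Y Z : Word} (r : ℂ) (f : Diag X Y) (g : Diag Y Z) :
      Rel (smul r f ⟫ g) (smul r (f ⟫ g))
  | comp_smul {X Y Z : Word} (r : ℂ) (f : Diag X Y) (g : Diag Y Z) :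
      Rel (f ⟫ smul r g) (smul r (f ⟫ g))
  | add_tensor {X Y X' Y' : Word} (f f' : Diag X Y) (g : Diag X' Y') :
      Rel (add f f' ⊠ g) (add (f ⊠ g) (f' ⊠ g))
  | tensor_add {X Y X' Y' : Word} (f : Diag X Y) (g g' : Diag X' Y') :
      Rel (f ⊠ add g g') (add (f ⊠ g) (f ⊠ g'))
  | smul_tensor {X Y X' Y' : Word} (r : ℂ) (f : Diag X Y) (g : Diag X' Y') :
      Rel (smul r f ⊠ g) (smul r (f ⊠ g))
  | tensor_smul {X Y X' Y' : Word} (r : ℂ) (f : Diag X Y) (g : Diag X' Y') :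
      Rel (f ⊠ smul r g) (smul r (f ⊠ g))
  -- strict monoidal structure
  | id_tensor_id (X Y : Word) : Rel (.id X ⊠ .id Y) (.id (X + Y))
  | unit_tensor {X Y : Word} (f : Diag X Y) :
      Rel (cast (_root_.zero_add X) (_root_.zero_add Y) (.id 0 ⊠ f)) f
  | tensor_unit {X Y : Word} (f : Diag X Y) :
      Rel (cast (_root_.add_zero X) (_root_.add_zero Y) (f ⊠ .id 0)) f
  | tensor_assoc {X Y X' Y' X'' Y'' : Word} (f : Diag X Y) (g : Diag X' Y') (h : Diag X'' Y'') :
      Rel (cast (_root_.add_assoc X X' X'') (_root_.add_assoc Y Y' Y'') ((f ⊠ g) ⊠ h))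
        (f ⊠ (g ⊠ h))
  -- the super interchange law: exchanging the heights of two odd diagrams costs a sign
  | interchange {X Y Z X' Y' Z' : Word} {p q : ZMod 2} (f : Diag X Y) (g : Diag Y Z)
      (f' : Diag X' Y') (g' : Diag Y' Z') (hf : HasParity p f) (hg : HasParity q g') :
      Rel ((f ⊠ f') ⟫ (g ⊠ g'))
        (smul ((-1) ^ ((p * q).val)) ((f ⟫ g) ⊠ (f' ⟫ g')))

end Diag

/-! ## Morphism spaces of the twisted Heisenberg category -/

/-- Morphisms of the twisted Heisenberg category. -/
def Hom (X Y : Word) : Type :=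
  Quot (Diag.Rel (X := X) (Y := Y))

namespace Hom

/-- The morphism given by a formal combination of diagrams. -/
def mk {X Y : Word} (f : Diag X Y) : Hom X Y := Quot.mk _ f

theorem sound {X Y : Word} {f g : Diag X Y} (h : Diag.Rel f g) : mk f = mk g := Quot.sound h

/-- Composition; `comp f g` is `g` stacked on top of `f`. -/
def comp {X Y Z : Word} : Hom X Y → Hom Y Z → Hom X Z :=
  Quot.map₂ Diag.comp (fun _ _ _ h => .comp_congr (.refl _) h)
    (fun _ _ _ h => .comp_congr h (.refl _))

/-- Tensor product of morphisms. -/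
def tensor {X Y X' Y' : Word} : Hom X Y → Hom X' Y' → Hom (X + X') (Y + Y') :=
  Quot.map₂ Diag.tensor (fun _ _ _ h => .tensor_congr (.refl _) h)
    (fun _ _ _ h => .tensor_congr h (.refl _))

/-- Identity morphisms. -/
def id (X : Word) : Hom X X := mk (.id X)

/-- Transport of a morphism along equalities of words. -/
def cast {X Y X' Y' : Word} (hX : X = X') (hY : Y = Y') (f : Hom X Y) : Hom X' Y' :=
  hX ▸ hY ▸ f

theorem cast_mk {X Y X' Y' : Word} (hX : X = X') (hY : Y = Y') (f : Diag X Y) :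
    cast hX hY (mk f) = mk (Diag.cast hX hY f) := by
  subst hX hY; rfl

instance (X Y : Word) : Zero (Hom X Y) := ⟨mk (.zero X Y)⟩

instance (X Y : Word) : Add (Hom X Y) :=
  ⟨Quot.map₂ Diag.add (fun _ _ _ h => .add_congr (.refl _) h)
    (fun _ _ _ h => .add_congr h (.refl _))⟩

instance (X Y : Word) : SMul ℂ (Hom X Y) :=
  ⟨fun r => Quot.map (Diag.smul r) (fun _ _ h => .smul_congr r h)⟩

instance (X Y : Word) : Neg (Hom X Y) := ⟨fun f => (-1 : ℂ) • f⟩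

instance (X Y : Word) : AddCommGroup (Hom X Y) where
  add_assoc := by rintro ⟨f⟩ ⟨g⟩ ⟨h⟩; exact sound (.add_assoc f g h)
  zero_add := by rintro ⟨f⟩; exact sound (.zero_add f)
  add_zero := by
    rintro ⟨f⟩; exact sound (.trans (.add_comm _ _) (.zero_add f))
  add_comm := by rintro ⟨f⟩ ⟨g⟩; exact sound (.add_comm f g)
  neg_add_cancel := by rintro ⟨f⟩; exact sound (.neg_add f)
  nsmul := nsmulRec
  zsmul := zsmulRec

instance (X Y : Word) : Module ℂ (Hom X Y) :=
  Module.ofMinimalAxioms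
    (by rintro r ⟨f⟩ ⟨g⟩; exact sound (.smul_add r f g))
    (by rintro r s ⟨f⟩; exact sound (.add_smul r s f))
    (by rintro r s ⟨f⟩; exact sound (.mul_smul r s f))
    (by rintro ⟨f⟩; exact sound (.one_smul f))

theorem id_tensor_heq {X : Word} (f : Hom X X) : cast (zero_add X) (zero_add X)
    (tensor (id 0) f) = f := by
  obtain ⟨f⟩ := f
  exact (cast_mk _ _ _).trans (sound (.unit_tensor f))

theorem tensor_id_heq {X : Word} (f : Hom X X) : cast (add_zero X) (add_zero X)
    (tensor f (id 0)) = f := by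
  obtain ⟨f⟩ := f
  exact (cast_mk _ _ _).trans (sound (.tensor_unit f))

theorem tensor_assoc_heq {X Y Z : Word} (f : Hom X X) (g : Hom Y Y) (h : Hom Z Z) :
    cast (add_assoc X Y Z) (add_assoc X Y Z) (tensor (tensor f g) h) =
      tensor f (tensor g h) := by
  obtain ⟨f⟩ := f
  obtain ⟨g⟩ := g
  obtain ⟨h⟩ := h
  exact (cast_mk _ _ _).trans (sound (.tensor_assoc f g h))

theorem add_tensor {X Y X' Y' : Word} (f f' : Hom X Y) (g : Hom X' Y') :
    tensor (f + f') g = tensor f g + tensor f' g := by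
  obtain ⟨f⟩ := f
  obtain ⟨f'⟩ := f'
  obtain ⟨g⟩ := g
  exact sound (.add_tensor f f' g)

theorem tensor_add {X Y X' Y' : Word} (f : Hom X Y) (g g' : Hom X' Y') :
    tensor f (g + g') = tensor f g + tensor f g' := by
  obtain ⟨f⟩ := f
  obtain ⟨g⟩ := g
  obtain ⟨g'⟩ := g'
  exact sound (.tensor_add f g g')

theorem smul_tensor {X Y X' Y' : Word} (r : ℂ) (f : Hom X Y) (g : Hom X' Y') :
    tensor (r • f) g = r • tensor f g := by
  obtain ⟨f⟩ := f
  obtain ⟨g⟩ := g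
  exact sound (.smul_tensor r f g)

theorem tensor_smul {X Y X' Y' : Word} (r : ℂ) (f : Hom X Y) (g : Hom X' Y') :
    tensor f (r • g) = r • tensor f g := by
  obtain ⟨f⟩ := f
  obtain ⟨g⟩ := g
  exact sound (.tensor_smul r f g)

end Hom

/-- The morphisms `X ⟶ Y` of parity `p`. -/
def homPiece (p : ZMod 2) (X Y : Word) : Submodule ℂ (Hom X Y) where
  carrier := {a | ∃ f : Diag X Y, f.HasParity p ∧ Hom.mk f = a}
  add_mem' := by
    rintro _ _ ⟨f, hf, rfl⟩ ⟨g, hg, rfl⟩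
    exact ⟨.add f g, .add hf hg, rfl⟩
  zero_mem' := ⟨.zero X Y, .zero X Y p, rfl⟩
  smul_mem' := by
    rintro r _ ⟨f, hf, rfl⟩
    exact ⟨.smul r f, .smul r hf, rfl⟩

theorem id_mem (X : Word) : Hom.id X ∈ homPiece 0 X X := ⟨.id X, .id X, rfl⟩

theorem comp_mem {p : ZMod 2} {X Y Z : Word} {f : Hom X Y} {g : Hom Y Z}
    (hf : f ∈ homPiece p X Y) (hg : g ∈ homPiece p Y Z) : f.comp g ∈ homPiece 0 X Z := by
  obtain ⟨f, hf, rfl⟩ := hf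
  obtain ⟨g, hg, rfl⟩ := hg
  refine ⟨f ⟫ g, ?_, rfl⟩
  simpa [CharTwo.add_self_eq_zero] using Diag.HasParity.comp hf hg

theorem tensor_mem {X Y X' Y' : Word} {f : Hom X Y} {g : Hom X' Y'}
    (hf : f ∈ homPiece 0 X Y) (hg : g ∈ homPiece 0 X' Y') :
    f.tensor g ∈ homPiece 0 (X + X') (Y + Y') := by
  obtain ⟨f, hf, rfl⟩ := hf
  obtain ⟨g, hg, rfl⟩ := hg
  refine ⟨f ⊠ g, ?_, rfl⟩
  simpa using Diag.HasParity.tensor hf hg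

/-! ## The even trace -/

/-- The even endomorphisms of `X`. -/
abbrev EvenEnd (X : Word) : Type := homPiece 0 X X

/-- The class of an even diagram among the even endomorphisms. -/
def EvenEnd.mk {X : Word} (f : Diag X X) (hf : f.HasParity 0) : EvenEnd X := ⟨Hom.mk f, f, hf, rfl⟩

theorem EvenEnd.sigma_ext {X Y : Word} (h : X = Y) (f : EvenEnd X) (g : EvenEnd Y)
    (hfg : Hom.cast h h f.1 = g.1) :
    (GradedMonoid.mk X f : GradedMonoid EvenEnd) = GradedMonoid.mk Y g := by
  subst h
  congr 1
  exact Subtype.ext hfg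

instance : GradedMonoid.GMul EvenEnd where
  mul f g := ⟨f.1.tensor g.1, tensor_mem f.2 g.2⟩

instance : GradedMonoid.GOne EvenEnd where
  one := ⟨Hom.id 0, id_mem 0⟩

instance : GradedMonoid.GMonoid EvenEnd where
  one_mul := by
    rintro ⟨X, f⟩
    exact EvenEnd.sigma_ext (zero_add X) _ _ (Hom.id_tensor_heq f.1)
  mul_one := by
    rintro ⟨X, f⟩
    exact EvenEnd.sigma_ext (add_zero X) _ _ (Hom.tensor_id_heq f.1)
  mul_assoc := by
    rintro ⟨X, f⟩ ⟨Y, g⟩ ⟨Z, h⟩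
    exact EvenEnd.sigma_ext (add_assoc X Y Z) _ _ (Hom.tensor_assoc_heq f.1 g.1 h.1)

/-- The tensor product makes the direct sum of the spaces of even endomorphisms of all objects
into a ring. -/
instance : DirectSum.GRing EvenEnd where
  mul_zero {i j} f := Subtype.ext (by
    have h := Hom.tensor_smul (0 : ℂ) f.1 (0 : Hom j j)
    rwa [zero_smul, zero_smul] at h)
  zero_mul {i j} f := Subtype.ext (by
    have h := Hom.smul_tensor (0 : ℂ) (0 : Hom i i) f.1
    rwa [zero_smul, zero_smul] at h)
  mul_add f g h := Subtype.ext (Hom.tensor_add f.1 g.1 h.1)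
  add_mul f g h := Subtype.ext (Hom.add_tensor f.1 g.1 h.1)
  natCast n := n • GradedMonoid.GOne.one
  natCast_zero := zero_smul _ _
  natCast_succ n := succ_nsmul _ n
  intCast n := n • GradedMonoid.GOne.one
  intCast_ofNat n := natCast_zsmul _ n
  intCast_negSucc_ofNat n := negSucc_zsmul _ n

instance : DirectSum.GAlgebra ℂ EvenEnd where
  toFun := (LinearMap.toSpanSingleton ℂ (EvenEnd 0) GradedMonoid.GOne.one).toAddMonoidHom
  map_one := one_smul ℂ (GradedMonoid.GOne.one : EvenEnd 0)
  map_mul r s := by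
    refine (EvenEnd.sigma_ext (zero_add 0) _ _ ?_).symm
    change Hom.cast _ _ (Hom.tensor (r • Hom.id 0) (s • Hom.id 0)) = (r * s) • Hom.id 0
    rw [Hom.tensor_smul, Hom.smul_tensor, smul_smul, mul_comm s r]
    exact (congrArg ((r * s) • ·) (Hom.id_tensor_heq (Hom.id 0)))
  commutes := by
    rintro r ⟨X, f⟩
    trans (GradedMonoid.mk X (r • f) : GradedMonoid EvenEnd)
    · refine EvenEnd.sigma_ext (zero_add X) _ _ ?_
      change Hom.cast _ _ (Hom.tensor (r • Hom.id 0) f.1) = r • f.1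
      rw [← Hom.id_tensor_heq (r • f.1), Hom.tensor_smul, Hom.smul_tensor]
    · refine (EvenEnd.sigma_ext (add_zero X) _ _ ?_).symm
      change Hom.cast _ _ (Hom.tensor f.1 (r • Hom.id 0)) = r • f.1
      rw [← Hom.tensor_id_heq (r • f.1), Hom.tensor_smul, Hom.smul_tensor]
  smul_def := by
    rintro r ⟨X, f⟩
    refine (EvenEnd.sigma_ext (zero_add X) _ _ ?_).symm
    change Hom.cast _ _ (Hom.tensor (r • Hom.id 0) f.1) = r • f.1
    rw [← Hom.id_tensor_heq (r • f.1), Hom.tensor_smul, Hom.smul_tensor]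

/-- The trace relation: `fg` and `gf` are identified for all homogeneous `f : X ⟶ Y` and
`g : Y ⟶ X` of the same parity, so that both composites are even. -/
inductive TraceRel : (DirectSum Word EvenEnd) → (DirectSum Word EvenEnd) → Prop
  | comm {p : ZMod 2} {X Y : Word} (f : Hom X Y) (g : Hom Y X)
      (hf : f ∈ homPiece p X Y) (hg : g ∈ homPiece p Y X) :
      TraceRel (DirectSum.of EvenEnd X ⟨f.comp g, comp_mem hf hg⟩)
        (DirectSum.of EvenEnd Y ⟨g.comp f, comp_mem hg hf⟩)

/-- The even trace of the twisted Heisenberg category: the quotient of the algebra of even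
endomorphisms by the ideal generated by all `fg - gf`. -/
abbrev EvenTrace : Type := RingQuot TraceRel

/-- The class in the even trace of an even endomorphism. -/
def trClass {X : Word} (f : EvenEnd X) : EvenTrace :=
  RingQuot.mkAlgHom ℂ TraceRel (DirectSum.of EvenEnd X f)

/-! ## The cycles -/

/-- `n` parallel strands. -/
def strands (l : Letter) : ℕ → Word
  | 0 => 0
  | n + 1 => FreeAddMonoid.of l + strands l n

/-- The `n`-cycle built from a crossing `s`: the strand that starts at the rightmost bottom
point ends at the leftmost top point, every other strand moves one step to the right. -/
def cycle {l : Letter}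
    (s : Diag (FreeAddMonoid.of l + FreeAddMonoid.of l) (FreeAddMonoid.of l + FreeAddMonoid.of l)) :
    ∀ n : ℕ, Diag (strands l n) (strands l n)
  | 0 => .id 0
  | 1 => .id (strands l 1)
  | n + 2 => (.id (FreeAddMonoid.of l) ⊠ cycle s (n + 1) :) ⟫ (s ⊠ .id (strands l n) :)

theorem cycle_even {l : Letter}
    {s : Diag (FreeAddMonoid.of l + FreeAddMonoid.of l) (FreeAddMonoid.of l + FreeAddMonoid.of l)}
    (hs : s.HasParity 0) : ∀ n : ℕ, (cycle s n).HasParity 0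
  | 0 => .id 0
  | 1 => .id (strands l 1)
  | n + 2 => .comp (p := 0) (q := 0) (.tensor (p := 0) (q := 0) (.id _) (cycle_even hs (n + 1)))
      (.tensor (p := 0) (q := 0) hs (.id _))

theorem crossRight_even : Diag.crossRight.HasParity 0 :=
  .comp (p := 0) (q := 0)
    (.tensor (p := 0) (q := 0) (.tensor (p := 0) (q := 0) (.gen .cupR) (.id _)) (.id _))
    (.comp (p := 0) (q := 0)
      (.tensor (p := 0) (q := 0) (.tensor (p := 0) (q := 0) (.id _) (.gen .cross)) (.id _))
      (.tensor (p := 0) (q := 0) (.tensor (p := 0) (q := 0) (.id _) (.id _)) (.gen .capR)))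

theorem crossDown_even : Diag.crossDown.HasParity 0 :=
  .comp (p := 0) (q := 0)
    (.tensor (p := 0) (q := 0) (.tensor (p := 0) (q := 0) (.gen .cupR) (.id _)) (.id _))
    (.comp (p := 0) (q := 0)
      (.tensor (p := 0) (q := 0) (.tensor (p := 0) (q := 0) (.id _) crossRight_even) (.id _))
      (.tensor (p := 0) (q := 0) (.tensor (p := 0) (q := 0) (.id _) (.id _)) (.gen .capR)))

/-- The class `h_k` in the even trace: for `k > 0` the cycle on `k` upward strands, for `k < 0`
the cycle on `-k` downward strands (and `h_0 = 1`, the empty diagram). -/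
def h : ℤ → EvenTrace
  | Int.ofNat n => trClass (EvenEnd.mk (cycle Diag.cross n) (cycle_even (.gen .cross) n))
  | Int.negSucc n =>
      trClass (EvenEnd.mk (cycle Diag.crossDown (n + 1)) (cycle_even crossDown_even (n + 1)))

/-! ## The twisted Heisenberg algebra -/

/-- The relations `[h_{k + 1/2}, h_{l + 1/2}] = (k + 1/2) δ_{k + 1/2, -(l + 1/2)}`; the generator
`h_{k + 1/2}` is the variable with index `k : ℤ`. -/
inductive HeisRel : FreeAlgebra ℂ ℤ → FreeAlgebra ℂ ℤ → Prop
  | comm (k l : ℤ) : HeisRel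
      (FreeAlgebra.ι ℂ k * FreeAlgebra.ι ℂ l - FreeAlgebra.ι ℂ l * FreeAlgebra.ι ℂ k)
      (algebraMap ℂ (FreeAlgebra ℂ ℤ) (if k + l + 1 = 0 then (k : ℂ) + 1 / 2 else 0))

/-- The twisted Heisenberg algebra. -/
abbrev HeisTw : Type := RingQuot HeisRel

/-- The generator `h_{k + 1/2} = h_{(2k + 1)/2}`. -/
def heisGen (k : ℤ) : HeisTw := RingQuot.mkAlgHom ℂ HeisRel (FreeAlgebra.ι ℂ k)

/-! ## The algebra `W⁻` -/

open Polynomial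

/-- Differential operators on the circle: the finitely supported family `f` stands for
`∑ r, t ^ r * f r (D)`, where `D = t d/dt`. -/
abbrev DiffOp : Type := ℤ →₀ ℂ[X]

/-- The operator `t ^ r * f(D)`. -/
abbrev DiffOp.mon (r : ℤ) (f : ℂ[X]) : DiffOp := Finsupp.single r f

namespace DiffOp

/-- The polynomial `f(D + s)`, as a linear function of `f`. -/
def shift (s : ℤ) : ℂ[X] →ₗ[ℂ] ℂ[X] := (Polynomial.aeval (X + C (s : ℂ))).toLinearMap

/-- Composition of operators:
`(t ^ r * f(D)) * (t ^ s * g(D)) = t ^ (r + s) * f(D + s) * g(D)`. -/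
def mul : DiffOp →ₗ[ℂ] DiffOp →ₗ[ℂ] DiffOp :=
  Finsupp.lsum ℂ fun r => LinearMap.flip <| Finsupp.lsum ℂ fun s =>
    LinearMap.flip <| (LinearMap.mul ℂ ℂ[X] ∘ₗ shift s).compr₂ (Finsupp.lsingle (r + s))

theorem mul_mon (r s : ℤ) (f g : ℂ[X]) :
    mul (mon r f) (mon s g) = mon (r + s) (shift s f * g) := by
  simp [mul]

/-- For `r ≥ 0` this is `∑ j ∈ [-r, -1], F(j)`. For `r < 0` it is `-∑ j ∈ [0, -r - 1], F(j)`. -/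
def cutSum (r : ℤ) : ℂ[X] →ₗ[ℂ] ℂ :=
  ∑ j ∈ Finset.Ico (-r) 0, Polynomial.leval (j : ℂ) -
    ∑ j ∈ Finset.Ico 0 (-r), Polynomial.leval (j : ℂ)

/-- The antisymmetric 2-cocycle: `ψ(t ^ r f(D), t ^ s g(D))` is `0` for `r + s ≠ 0`, and it is
`∑ j ∈ [-r, -1], f(j) g(j + r)` for `r = -s ≥ 0`. -/
def psi : DiffOp →ₗ[ℂ] DiffOp →ₗ[ℂ] ℂ :=
  Finsupp.lsum ℂ fun r => LinearMap.flip <| Finsupp.lsum ℂ fun s => LinearMap.flip <|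
    if r + s = 0 then ((LinearMap.mul ℂ ℂ[X]).compl₂ (shift r)).compr₂ (cutSum r) else 0

theorem psi_mon (r s : ℤ) (f g : ℂ[X]) :
    psi (mon r f) (mon s g) = if r + s = 0 then cutSum r (f * shift r g) else 0 := by
  by_cases hrs : r + s = 0 <;> simp [psi, hrs]

theorem shift_mul (s : ℤ) (f g : ℂ[X]) : shift s (f * g) = shift s f * shift s g := by
  simp [shift]

theorem shift_shift (r s : ℤ) (f : ℂ[X]) : shift r (shift s f) = shift (r + s) f := by
  simp only [shift, AlgHom.toLinearMap_apply]
  rw [← AlgHom.comp_apply]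
  congr 1
  ext
  simp [add_assoc]

theorem shift_zero (f : ℂ[X]) : shift 0 f = f := by
  simp [shift]

theorem eval_shift (s : ℤ) (f : ℂ[X]) (x : ℂ) : (shift s f).eval x = f.eval (x + s) := by
  simp [shift, ← Polynomial.comp_eq_aeval, Polynomial.eval_comp]

theorem cutSum_apply (r : ℤ) (f : ℂ[X]) :
    cutSum r f = ∑ j ∈ Finset.Ico (-r) 0, f.eval (j : ℂ) -
      ∑ j ∈ Finset.Ico 0 (-r), f.eval (j : ℂ) := by
  simp [cutSum, LinearMap.sum_apply]

theorem cutSum_zero (f : ℂ[X]) : cutSum 0 f = 0 := by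
  simp [cutSum]

theorem cutSum_add_one (r : ℤ) (f : ℂ[X]) :
    cutSum (r + 1) f = cutSum r f + f.eval ((-r - 1 : ℤ) : ℂ) := by
  rw [cutSum_apply, cutSum_apply]
  rcases le_or_gt 0 r with hr | hr
  · rw [Finset.Ico_eq_empty_of_le (a := 0) (b := -(r + 1)) (by omega),
      Finset.Ico_eq_empty_of_le (a := 0) (b := -r) (by omega)]
    have : Finset.Ico (-(r + 1)) 0 = insert (-r - 1) (Finset.Ico (-r) 0) := by
      ext j; simp only [Finset.mem_insert, Finset.mem_Ico]; omega
    rw [this, Finset.sum_insert (by simp)]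
    simp [add_comm]
  · rw [Finset.Ico_eq_empty_of_le (a := -(r + 1)) (b := 0) (by omega),
      Finset.Ico_eq_empty_of_le (a := -r) (b := 0) (by omega)]
    have : Finset.Ico 0 (-r) = insert (-r - 1) (Finset.Ico 0 (-(r + 1))) := by
      ext j; simp only [Finset.mem_insert, Finset.mem_Ico]; omega
    rw [this, Finset.sum_insert (by simp; omega)]
    ring

theorem cutSum_add (r s : ℤ) (f : ℂ[X]) :
    cutSum (r + s) f = cutSum r f + cutSum s (shift (-r) f) := by
  induction s using Int.induction_on with
  | zero => simp [cutSum_zero]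
  | succ n ih =>
    rw [← add_assoc, cutSum_add_one, ih, cutSum_add_one, eval_shift, add_assoc]
    congr 3
    push_cast; ring
  | pred n ih =>
    have h1 := cutSum_add_one (r + (-(n : ℤ) - 1)) f
    have h2 := cutSum_add_one (-(n : ℤ) - 1) (shift (-r) f)
    rw [eval_shift] at h2
    rw [show r + (-(n : ℤ) - 1) + 1 = r + -(n : ℤ) by ring, ih] at h1
    rw [show (-(n : ℤ) - 1) + 1 = -(n : ℤ) by ring] at h2
    have h3 : (((-(r + (-(n : ℤ) - 1)) - 1 : ℤ)) : ℂ)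
        = ((-(-(n : ℤ) - 1) - 1 : ℤ) : ℂ) + ((-r : ℤ) : ℂ) := by push_cast; ring
    rw [h3] at h1
    linear_combination h2 - h1

theorem mul_assoc' (a b c : DiffOp) : mul (mul a b) c = mul a (mul b c) := by
  induction a using Finsupp.induction_linear with
  | zero => simp
  | add a a' h h' => simp only [map_add, LinearMap.add_apply, h, h']
  | single r f =>
  induction b using Finsupp.induction_linear with
  | zero => simp
  | add a a' h h' => simp only [map_add, LinearMap.add_apply, h, h']
  | single s g =>
  induction c using Finsupp.induction_linear with
  | zero => simp
  | add a a' h h' => simp only [map_add, h, h']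
  | single u k =>
    rw [mul_mon, mul_mon, mul_mon, mul_mon, shift_mul, shift_shift, add_assoc, mul_assoc,
      add_comm u s]

theorem psi_antisymm (a b : DiffOp) : psi a b = -psi b a := by
  induction a using Finsupp.induction_linear with
  | zero => simp
  | add a a' h h' => simp only [map_add, LinearMap.add_apply, h, h', neg_add]
  | single r f =>
  induction b using Finsupp.induction_linear with
  | zero => simp
  | add a a' h h' => simp only [map_add, LinearMap.add_apply, h, h', neg_add]
  | single s g =>
    rw [psi_mon, psi_mon, add_comm s r]
    split_ifs with hrs
    · obtain rfl : s = -r := by omega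
      have h := cutSum_add r (-r) (f * shift r g)
      rw [add_neg_cancel, cutSum_zero, shift_mul, shift_shift, neg_add_cancel, shift_zero,
        mul_comm _ g] at h
      linear_combination -h
    · simp

theorem psi_cyclic (a b c : DiffOp) :
    psi (mul a b) c + psi (mul b c) a + psi (mul c a) b = 0 := by
  induction a using Finsupp.induction_linear with
  | zero => simp
  | add a a' h h' =>
    simp only [map_add, LinearMap.add_apply]; linear_combination h + h'
  | single r f =>
  induction b using Finsupp.induction_linear with
  | zero => simp
  | add a a' h h' =>
    simp only [map_add, LinearMap.add_apply]; linear_combination h + h'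
  | single s g =>
  induction c using Finsupp.induction_linear with
  | zero => simp
  | add a a' h h' =>
    simp only [map_add, LinearMap.add_apply]; linear_combination h + h'
  | single u k =>
    rw [mul_mon, mul_mon, mul_mon, psi_mon, psi_mon, psi_mon]
    by_cases h : r + s + u = 0
    · rw [if_pos h, if_pos (by omega), if_pos (by omega)]
      obtain rfl : r = -s - u := by omega
      have h1 := cutSum_add (-s - u + s) (s + u) (shift s f * g * shift (-s - u + s) k)
      have h2 := cutSum_add s (-s) (shift s f * g * shift (-s - u + s) k)
      simp only [shift_mul, shift_shift, add_neg_cancel, cutSum_zero] at h1 h2 ⊢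
      ring_nf at h1 h2 ⊢
      simp only [shift_zero] at h1 h2 ⊢
      ring_nf at h1 h2 ⊢
      linear_combination -h1 - h2
    · rw [if_neg h, if_neg (by omega), if_neg (by omega)]; simp

/-- The anti-involution `σ` with `σ(t) = -t` and `σ(D) = -D`, that is,
`σ(t ^ k * f(D)) = f(-D) * (-t) ^ k = (-1) ^ k * t ^ k * f(-D - k)`. -/
def sigma : DiffOp →ₗ[ℂ] DiffOp :=
  Finsupp.lsum ℂ fun k => Finsupp.lsingle k ∘ₗ
    ((-1 : ℂ) ^ k • (Polynomial.aeval (-X - C (k : ℂ))).toLinearMap)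

theorem sigma_mon (k : ℤ) (f : ℂ[X]) :
    sigma (mon k f) = mon k ((-1 : ℂ) ^ k • f.comp (-X - C (k : ℂ))) := by
  simp [sigma, Polynomial.comp, Polynomial.aeval_def]

theorem sigma_mul (a b : DiffOp) : sigma (mul a b) = mul (sigma b) (sigma a) := by
  induction a using Finsupp.induction_linear with
  | zero => simp
  | add a a' h h' => simp only [map_add, LinearMap.add_apply, h, h']
  | single r f =>
  induction b using Finsupp.induction_linear with
  | zero => simp
  | add a a' h h' => simp only [map_add, LinearMap.add_apply, h, h']
  | single s g =>
    rw [mul_mon, sigma_mon, sigma_mon, sigma_mon, mul_mon, add_comm s r]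
    congr 1
    have hf : (shift s f).comp (-X - C ((r + s : ℤ) : ℂ)) = f.comp (-X - C (r : ℂ)) := by
      simp only [shift, AlgHom.toLinearMap_apply, ← Polynomial.comp_eq_aeval,
        Polynomial.comp_assoc]
      congr 1
      simp
      ring
    have hg : shift r (g.comp (-X - C (s : ℂ))) = g.comp (-X - C ((r + s : ℤ) : ℂ)) := by
      simp only [shift, AlgHom.toLinearMap_apply, ← Polynomial.comp_eq_aeval,
        Polynomial.comp_assoc]
      congr 1
      simp
      ring
    rw [map_smul, hg, Polynomial.mul_comp, hf, zpow_add₀ (by norm_num), smul_mul_smul_comm,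
      mul_comm ((-1 : ℂ) ^ s), mul_comm (f.comp _)]

end DiffOp

/-- The central extension of the Lie algebra of differential operators by the cocycle `ψ`: the
pair `(a, z)` stands for `a + z C`. -/
def HatD : Type := DiffOp × ℂ

instance : AddCommGroup HatD := inferInstanceAs (AddCommGroup (DiffOp × ℂ))
instance : Module ℂ HatD := inferInstanceAs (Module ℂ (DiffOp × ℂ))

/-- `[a + z C, b + w C] = ab - ba + ψ(a, b) C`. -/
instance : Bracket HatD HatD :=
  ⟨fun x y => (DiffOp.mul x.1 y.1 - DiffOp.mul y.1 x.1, DiffOp.psi x.1 y.1)⟩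

theorem HatD.fst_lie (x y : HatD) :
    ⁅x, y⁆.1 = DiffOp.mul x.1 y.1 - DiffOp.mul y.1 x.1 := rfl

theorem HatD.snd_lie (x y : HatD) : ⁅x, y⁆.2 = DiffOp.psi x.1 y.1 := rfl

theorem HatD.ext {x y : HatD} (h : x.1 = y.1) (h' : x.2 = y.2) : x = y := Prod.ext h h'

theorem HatD.fst_add (x y : HatD) : (x + y).1 = x.1 + y.1 := rfl
theorem HatD.snd_add (x y : HatD) : (x + y).2 = x.2 + y.2 := rfl
theorem HatD.fst_smul (r : ℂ) (x : HatD) : (r • x).1 = r • x.1 := rfl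
theorem HatD.snd_smul (r : ℂ) (x : HatD) : (r • x).2 = r • x.2 := rfl

instance : LieRing HatD where
  add_lie x y z := by
    apply HatD.ext
    · simp only [HatD.fst_lie, HatD.fst_add, map_add, LinearMap.add_apply]; abel
    · simp only [HatD.snd_lie, HatD.fst_add, HatD.snd_add, map_add, LinearMap.add_apply]
  lie_add x y z := by
    apply HatD.ext
    · simp only [HatD.fst_lie, HatD.fst_add, map_add, LinearMap.add_apply]; abel
    · simp only [HatD.snd_lie, HatD.fst_add, HatD.snd_add, map_add]
  lie_self x := by
    apply HatD.ext
    · exact sub_self _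
    · have h := DiffOp.psi_antisymm x.1 x.1
      change DiffOp.psi x.1 x.1 = 0
      linear_combination h / 2
  leibniz_lie x y z := by
    apply HatD.ext
    · simp only [HatD.fst_lie, HatD.fst_add, map_sub, LinearMap.sub_apply, DiffOp.mul_assoc']
      abel
    · simp only [HatD.fst_lie, HatD.snd_lie, HatD.snd_add, map_sub, LinearMap.sub_apply]
      have h1 := DiffOp.psi_cyclic x.1 y.1 z.1
      have h2 := DiffOp.psi_cyclic y.1 x.1 z.1
      have h3 := DiffOp.psi_antisymm x.1 (DiffOp.mul y.1 z.1)
      have h4 := DiffOp.psi_antisymm x.1 (DiffOp.mul z.1 y.1)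
      have h5 := DiffOp.psi_antisymm y.1 (DiffOp.mul x.1 z.1)
      have h6 := DiffOp.psi_antisymm y.1 (DiffOp.mul z.1 x.1)
      linear_combination h3 - h4 - h5 + h6 - h1 + h2

instance : LieAlgebra ℂ HatD where
  lie_smul r x y := by
    apply HatD.ext
    · simp only [HatD.fst_lie, HatD.fst_smul, map_smul, LinearMap.smul_apply, smul_sub]
    · simp only [HatD.snd_lie, HatD.fst_smul, HatD.snd_smul, map_smul]

/-- The Lie subalgebra of all `a + z C` with `σ(a) = -a`. It is spanned by `C`, by the
`t ^ k g(D + k / 2)` with `k` odd and `g` an even polynomial, and by the `t ^ k g(D + k / 2)` with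
`k` even and `g` an odd polynomial. -/
def HatDMinus : LieSubalgebra ℂ HatD where
  carrier := {x | DiffOp.sigma x.1 = -x.1}
  add_mem' := by
    intro x y hx hy
    simp only [Set.mem_ofPred_eq] at hx hy ⊢
    rw [HatD.fst_add, map_add, hx, hy, neg_add]
  zero_mem' := by
    change DiffOp.sigma 0 = -0
    simp
  smul_mem' := by
    intro r x hx
    simp only [Set.mem_ofPred_eq] at hx ⊢
    rw [HatD.fst_smul, map_smul, hx, smul_neg]
  lie_mem' := by
    intro x y hx hy
    change DiffOp.sigma x.1 = -x.1 at hx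
    change DiffOp.sigma y.1 = -y.1 at hy
    change DiffOp.sigma (DiffOp.mul x.1 y.1 - DiffOp.mul y.1 x.1)
      = -(DiffOp.mul x.1 y.1 - DiffOp.mul y.1 x.1)
    rw [map_sub, DiffOp.sigma_mul, DiffOp.sigma_mul, hx, hy]
    simp only [map_neg, LinearMap.neg_apply, neg_neg]
    abel

/-- The algebra `W⁻`, the universal enveloping algebra of `HatDMinus`. -/
abbrev WMinus : Type := UniversalEnvelopingAlgebra ℂ HatDMinus

/-- The central element `C` of `W⁻`. -/
def wC : WMinus :=
  UniversalEnvelopingAlgebra.ι ℂ (⟨((0, 1) : DiffOp × ℂ), by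
    change DiffOp.sigma 0 = -0
    simp⟩ : HatDMinus)

/-- The element `w_{2n+1, 0} = t ^ (2n + 1)` of `W⁻`. -/
def wOdd (n : ℤ) : WMinus :=
  UniversalEnvelopingAlgebra.ι ℂ (⟨((DiffOp.mon (2 * n + 1) 1, 0) : DiffOp × ℂ), by
    change DiffOp.sigma (DiffOp.mon (2 * n + 1) 1) = -DiffOp.mon (2 * n + 1) 1
    rw [DiffOp.sigma_mon, Odd.neg_one_zpow (odd_two_mul_add_one n), ← Finsupp.single_neg]
    simp⟩ : HatDMinus)

/-- The relation `C = 1`. -/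
inductive LevelOneRel : WMinus → WMinus → Prop
  | level : LevelOneRel wC 1

/-- The quotient `W⁻ / ⟨C - 1⟩`. -/
abbrev WMinusOne : Type := RingQuot LevelOneRel

/-- The class of `w_{2n+1, 0}` in `W⁻ / ⟨C - 1⟩`. -/
def wOddBar (n : ℤ) : WMinusOne := RingQuot.mkAlgHom ℂ LevelOneRel (wOdd n)

/-! ## The two subalgebras -/

/-- The subalgebra of the even trace generated by the odd cycles. -/
def oddCycles : Subalgebra ℂ EvenTrace := Algebra.adjoin ℂ (Set.range fun n : ℤ => h (2 * n + 1))

/-- The subalgebra of `W⁻ / ⟨C - 1⟩` generated by the `w_{2n+1, 0}`. -/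
def oddModes : Subalgebra ℂ WMinusOne := Algebra.adjoin ℂ (Set.range wOddBar)

end

end TwistedHeis

open TwistedHeis

namespace TwistedHeis

noncomputable section

open CategoryTheory

/-! ## The category of words -/

namespace Hom

/-! The isomorphisms rest on the simplicity of the twisted Heisenberg algebra: every algebra map
from it to a nonzero algebra is injective (`HeisTw.injective_of_nontrivial`). Hence it suffices to
compute the commutators of the odd cycles and of the odd modes, to rescale them so that the
Heisenberg relations hold, and to show that the even trace and `WMinusOne` are not zero. The image
of such a map is the subalgebra generated by the images of the generators.

Commutators of cycles. Cups, caps and crossings are natural transformations between composites of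
the two endofunctors "add a strand on the left", and the relations for rotated crossings are mates,
under an adjunction, of those for upward crossings. Inside the trace the strands of one cycle can be
dragged through the other cycle one at a time (`Crossing.tr_partial`). For strands of equal
direction nothing is lost. For a downward and an upward cycle the only error is the failure of the
double crossing of a downward strand with the upward bundle to be the identity
(`Crossing.tr_pcyc_cyc`); it is a sum over the upward strands of a plain and a dotted cap followed
by a cup (`one_sub_bL_bR`). In the trace all positions contribute equally
(`IsDot.tr_toFront_fromFront`). Each contribution is a pair of clasped cycles; contracting the clasp
shortens both by one strand and costs a factor 1 in the plain case and -1 in the dotted case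
(`IsDot.clasped_succ_succ`). Only equal lengths survive, and length `k + 1` gives `(k + 1) * (1 +
(-1) ^ k)`, which is twice the length when the length is odd (`h_neg_mul_h_succ`).

Commutators of modes. Powers of `t` commute as operators, so only the cocycle remains (`wOdd_comm`).

Simplicity. A commutator with a generator lowers the degree, while an Euler operator built from such
commutators multiplies the leading part by its degree (`HeisTw.exists_euler`); so the lowest degree
of a nonzero element of a kernel cannot be positive, and it is not zero either.

Nonvanishing. Normally ordered bilinear expressions in oscillators represent the centrally extended
Lie algebra on a polynomial ring with central element 1 (`Osc.rep`), so `C - 1` generates a proper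
ideal. For the even trace the category is made to act on super analogues of species: an upward
strand multiplies by a singleton species with two parities, a downward strand differentiates. The
Leibniz rule `(X F)' = X F' + F`, with one copy of `F` for each parity, is the relation
`left_right`. Starting from the species concentrated on the empty set, every object yields a finite
dimensional space, and the ordinary matrix trace is a functional that respects the trace relation,
also after tensoring with even endomorphisms, and takes the value 1 at the unit
(`Model.totalTrace_mul_mul`, `Model.trace_id_zero`). -/

theorem id_comp {X Y : Word} (f : Hom X Y) : comp (id X) f = f := by
  obtain ⟨f⟩ := f; exact sound (.id_comp f)

theorem comp_id {X Y : Word} (f : Hom X Y) : comp f (id Y) = f := by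
  obtain ⟨f⟩ := f; exact sound (.comp_id f)

theorem comp_assoc {X Y Z W : Word} (f : Hom X Y) (g : Hom Y Z) (h : Hom Z W) :
    comp (comp f g) h = comp f (comp g h) := by
  obtain ⟨f⟩ := f; obtain ⟨g⟩ := g; obtain ⟨h⟩ := h; exact sound (.comp_assoc f g h)

theorem add_comp {X Y Z : Word} (f f' : Hom X Y) (g : Hom Y Z) :
    comp (f + f') g = comp f g + comp f' g := by
  obtain ⟨f⟩ := f; obtain ⟨f'⟩ := f'; obtain ⟨g⟩ := g; exact sound (.add_comp f f' g)

theorem comp_add {X Y Z : Word} (f : Hom X Y) (g g' : Hom Y Z) :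
    comp f (g + g') = comp f g + comp f g' := by
  obtain ⟨f⟩ := f; obtain ⟨g⟩ := g; obtain ⟨g'⟩ := g'; exact sound (.comp_add f g g')

theorem smul_comp {X Y Z : Word} (r : ℂ) (f : Hom X Y) (g : Hom Y Z) :
    comp (r • f) g = r • comp f g := by
  obtain ⟨f⟩ := f; obtain ⟨g⟩ := g; exact sound (.smul_comp r f g)

theorem comp_smul {X Y Z : Word} (r : ℂ) (f : Hom X Y) (g : Hom Y Z) :
    comp f (r • g) = r • comp f g := by
  obtain ⟨f⟩ := f; obtain ⟨g⟩ := g; exact sound (.comp_smul r f g)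

theorem id_tensor_id (X Y : Word) : tensor (id X) (id Y) = id (X + Y) :=
  sound (.id_tensor_id X Y)

theorem cast_heq {X Y X' Y' : Word} (hX : X = X') (hY : Y = Y') (f : Hom X Y) :
    HEq (cast hX hY f) f := by
  subst hX hY; rfl

theorem unit_tensor_heq {X Y : Word} (f : Hom X Y) : HEq (tensor (id 0) f) f := by
  obtain ⟨f⟩ := f
  exact (cast_heq (zero_add X) (zero_add Y) _).symm.trans
    (heq_of_eq ((cast_mk _ _ _).trans (sound (.unit_tensor f))))

theorem tensor_unit_heq {X Y : Word} (f : Hom X Y) : HEq (tensor f (id 0)) f := by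
  obtain ⟨f⟩ := f
  exact (cast_heq (add_zero X) (add_zero Y) _).symm.trans
    (heq_of_eq ((cast_mk _ _ _).trans (sound (.tensor_unit f))))

theorem tensor_tensor_heq {X Y X' Y' X'' Y'' : Word} (f : Hom X Y) (g : Hom X' Y')
    (h : Hom X'' Y'') : HEq (tensor (tensor f g) h) (tensor f (tensor g h)) := by
  obtain ⟨f⟩ := f; obtain ⟨g⟩ := g; obtain ⟨h⟩ := h
  exact (cast_heq (add_assoc X X' X'') (add_assoc Y Y' Y'') _).symm.trans
    (heq_of_eq ((cast_mk _ _ _).trans (sound (.tensor_assoc f g h))))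

theorem tensor_comp_tensor {X Y Z X' Y' Z' : Word} {p q : ZMod 2} {f : Hom X Y} (g : Hom Y Z)
    (f' : Hom X' Y') {g' : Hom Y' Z'} (hf : f ∈ homPiece p X Y) (hg : g' ∈ homPiece q Y' Z') :
    comp (tensor f f') (tensor g g') =
      ((-1 : ℂ) ^ (p * q).val) • tensor (comp f g) (comp f' g') := by
  obtain ⟨f, hf, rfl⟩ := hf; obtain ⟨g', hg, rfl⟩ := hg
  obtain ⟨g⟩ := g; obtain ⟨f'⟩ := f'
  exact sound (.interchange f g f' g' hf hg)

/-- Every morphism is the sum of an even and an odd morphism. -/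
theorem exists_even_add_odd {X Y : Word} (f : Hom X Y) :
    ∃ f₀ ∈ homPiece 0 X Y, ∃ f₁ ∈ homPiece 1 X Y, f = f₀ + f₁ := by
  induction f using Quot.ind with | mk f => ?_
  change ∃ f₀ ∈ homPiece 0 X Y, ∃ f₁ ∈ homPiece 1 X Y, mk f = f₀ + f₁
  have hcomp : ∀ {X Y Z : Word} {p q : ZMod 2} {f : Hom X Y} {g : Hom Y Z},
      f ∈ homPiece p X Y → g ∈ homPiece q Y Z → comp f g ∈ homPiece (p + q) X Z := by
    rintro X Y Z p q _ _ ⟨f, hf, rfl⟩ ⟨g, hg, rfl⟩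
    exact ⟨_, .comp hf hg, rfl⟩
  have htensor : ∀ {X Y X' Y' : Word} {p q : ZMod 2} {f : Hom X Y} {g : Hom X' Y'},
      f ∈ homPiece p X Y → g ∈ homPiece q X' Y' →
        tensor f g ∈ homPiece (p + q) (X + X') (Y + Y') := by
    rintro X Y Z W p q _ _ ⟨f, hf, rfl⟩ ⟨g, hg, rfl⟩
    exact ⟨_, .tensor hf hg, rfl⟩
  induction f with
  | id X => exact ⟨_, id_mem X, 0, zero_mem _, (add_zero _).symm⟩
  | gen g =>
    have h : g.parity = 0 ∨ g.parity = 1 := by cases g <;> simp [Gen.parity]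
    rcases h with h | h
    · exact ⟨mk (.gen g), ⟨_, h ▸ Diag.HasParity.gen g, rfl⟩, 0, zero_mem _, (add_zero _).symm⟩
    · exact ⟨0, zero_mem _, mk (.gen g), ⟨_, h ▸ Diag.HasParity.gen g, rfl⟩, (zero_add _).symm⟩
  | comp f g hf hg =>
    obtain ⟨f₀, hf₀, f₁, hf₁, hf⟩ := hf
    obtain ⟨g₀, hg₀, g₁, hg₁, hg⟩ := hg
    refine ⟨comp f₀ g₀ + comp f₁ g₁, add_mem (hcomp (p := 0) (q := 0) hf₀ hg₀)
      (hcomp (p := 1) (q := 1) hf₁ hg₁), comp f₀ g₁ + comp f₁ g₀,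
      add_mem (hcomp (p := 0) (q := 1) hf₀ hg₁) (hcomp (p := 1) (q := 0) hf₁ hg₀), ?_⟩
    change comp (mk f) (mk g) = _
    rw [hf, hg, add_comp, comp_add, comp_add]
    abel
  | tensor f g hf hg =>
    obtain ⟨f₀, hf₀, f₁, hf₁, hf⟩ := hf
    obtain ⟨g₀, hg₀, g₁, hg₁, hg⟩ := hg
    refine ⟨tensor f₀ g₀ + tensor f₁ g₁, add_mem (htensor (p := 0) (q := 0) hf₀ hg₀)
      (htensor (p := 1) (q := 1) hf₁ hg₁), tensor f₀ g₁ + tensor f₁ g₀,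
      add_mem (htensor (p := 0) (q := 1) hf₀ hg₁) (htensor (p := 1) (q := 0) hf₁ hg₀), ?_⟩
    change tensor (mk f) (mk g) = _
    rw [hf, hg, add_tensor, tensor_add, tensor_add]
    abel
  | zero X Y => exact ⟨0, zero_mem _, 0, zero_mem _, (add_zero _).symm⟩
  | add f g hf hg =>
    obtain ⟨f₀, hf₀, f₁, hf₁, hf⟩ := hf
    obtain ⟨g₀, hg₀, g₁, hg₁, hg⟩ := hg
    refine ⟨_, add_mem hf₀ hg₀, _, add_mem hf₁ hg₁, ?_⟩
    change mk f + mk g = _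
    rw [hf, hg]
    abel
  | smul r f hf =>
    obtain ⟨f₀, hf₀, f₁, hf₁, hf⟩ := hf
    refine ⟨_, Submodule.smul_mem _ r hf₀, _, Submodule.smul_mem _ r hf₁, ?_⟩
    change r • mk f = _
    rw [hf, smul_add]

/-- The sign of the interchange law depends on the product of the parities of `f` and `g'`, so one
even factor makes it trivial; splitting the other factor into its even and odd parts removes the
homogeneity assumption. -/
theorem interchange_left {X Y Z X' Y' Z' : Word} {f : Hom X Y} (hf : f ∈ homPiece 0 X Y)
    (g : Hom Y Z) (f' : Hom X' Y') (g' : Hom Y' Z') :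
    comp (tensor f f') (tensor g g') = tensor (comp f g) (comp f' g') := by
  obtain ⟨g₀, h₀, g₁, h₁, rfl⟩ := exists_even_add_odd g'
  simp only [tensor_add, comp_add, tensor_comp_tensor _ _ hf h₀, tensor_comp_tensor _ _ hf h₁]
  simp

theorem interchange_right {X Y Z X' Y' Z' : Word} (f : Hom X Y)
    (g : Hom Y Z) (f' : Hom X' Y') {g' : Hom Y' Z'} (hg : g' ∈ homPiece 0 Y' Z') :
    comp (tensor f f') (tensor g g') = tensor (comp f g) (comp f' g') := by
  obtain ⟨g₀, h₀, g₁, h₁, rfl⟩ := exists_even_add_odd f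
  simp only [add_tensor, add_comp, tensor_comp_tensor _ _ h₀ hg, tensor_comp_tensor _ _ h₁ hg]
  simp

end Hom

instance : Category Word where
  Hom := Hom
  id := Hom.id
  comp := Hom.comp
  id_comp := Hom.id_comp
  comp_id := Hom.comp_id
  assoc := Hom.comp_assoc

instance : Preadditive Word where
  homGroup X Y := inferInstanceAs (AddCommGroup (Hom X Y))
  add_comp _ _ _ f f' g := Hom.add_comp f f' g
  comp_add _ _ _ f g g' := Hom.comp_add f g g'

instance : Linear ℂ Word where
  homModule X Y := inferInstanceAs (Module ℂ (Hom X Y))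
  smul_comp _ _ _ r f g := Hom.smul_comp r f g
  comp_smul _ _ _ f r g := Hom.comp_smul r f g

/-- Even morphisms. -/
class IsEven {X Y : Word} (f : X ⟶ Y) : Prop where
  mem : f ∈ homPiece 0 X Y

instance (X : Word) : IsEven (𝟙 X) := ⟨id_mem X⟩

instance {X Y Z : Word} (f : X ⟶ Y) (g : Y ⟶ Z) [hf : IsEven f] [hg : IsEven g] :
    IsEven (f ≫ g) := ⟨comp_mem hf.mem hg.mem⟩

instance {X Y : Word} (f g : X ⟶ Y) [hf : IsEven f] [hg : IsEven g] : IsEven (f + g) :=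
  ⟨add_mem hf.mem hg.mem⟩

instance {X Y : Word} (f g : X ⟶ Y) [hf : IsEven f] [hg : IsEven g] : IsEven (f - g) :=
  ⟨sub_mem hf.mem hg.mem⟩

instance {X Y : Word} : IsEven (0 : X ⟶ Y) := ⟨zero_mem _⟩

/-- Adding a strand on the left. -/
def lw (l : Letter) {X Y : Word} (f : X ⟶ Y) :
    FreeAddMonoid.of l + X ⟶ FreeAddMonoid.of l + Y :=
  Hom.tensor (Hom.id (FreeAddMonoid.of l)) f

notation "𝐏" => lw Letter.P
notation "𝐐" => lw Letter.Q

/-- Adding identity strands on the right. -/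
def onTail {X Y : Word} (f : Hom X Y) (W : Word) : X + W ⟶ Y + W :=
  Hom.tensor f (Hom.id W)

section lw

variable (l : Letter) {X Y Z : Word}

@[simp] theorem lw_id (X : Word) : lw l (𝟙 X) = 𝟙 (FreeAddMonoid.of l + X) :=
  Hom.id_tensor_id _ _

@[simp] theorem lw_comp (f : X ⟶ Y) (g : Y ⟶ Z) : lw l (f ≫ g) = lw l f ≫ lw l g := by
  refine ((Hom.interchange_left (id_mem _) _ f g).trans ?_).symm
  exact congrArg₂ Hom.tensor (Hom.comp_id _) rfl

@[simp] theorem lw_add (f g : X ⟶ Y) : lw l (f + g) = lw l f + lw l g :=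
  Hom.tensor_add _ f g

@[simp] theorem lw_smul (r : ℂ) (f : X ⟶ Y) : lw l (r • f) = r • lw l f :=
  Hom.tensor_smul r _ f

@[simp] theorem lw_zero : lw l (0 : X ⟶ Y) = 0 := by
  have := lw_smul l (0 : ℂ) (0 : X ⟶ Y)
  rwa [zero_smul, zero_smul] at this

@[simp] theorem lw_neg (f : X ⟶ Y) : lw l (-f) = -lw l f := by
  rw [← neg_one_smul ℂ f, lw_smul, neg_one_smul]

@[simp] theorem lw_sub (f g : X ⟶ Y) : lw l (f - g) = lw l f - lw l g := by
  rw [sub_eq_add_neg, lw_add, lw_neg, sub_eq_add_neg]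

instance (f : X ⟶ Y) [hf : IsEven f] : IsEven (lw l f) := ⟨tensor_mem (id_mem _) hf.mem⟩

end lw

theorem onTail_comp {X Y Z : Word} (f : Hom X Y) (g : Hom Y Z) (W : Word) :
    onTail (Hom.comp f g) W = onTail f W ≫ onTail g W :=
  ((Hom.interchange_right f g (Hom.id W) (id_mem W)).trans
    (congrArg (Hom.tensor (Hom.comp f g)) (Hom.comp_id _))).symm

theorem onTail_id (X W : Word) : onTail (Hom.id X) W = 𝟙 (X + W) := Hom.id_tensor_id X W

/-- Both sides equal `Hom.tensor a f`, up to a sign that is trivial as soon as one factor is even.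
Hence cups, caps and crossings are natural for all morphisms, whereas hollow dots are natural for
even morphisms only. -/
theorem onTail_natural_of_even_left {X Y W W' : Word} {a : Hom X Y} (ha : a ∈ homPiece 0 X Y)
    (f : W ⟶ W') :
    onTail a W ≫ Hom.tensor (Hom.id Y) f = Hom.tensor (Hom.id X) f ≫ onTail a W' := by
  refine (Hom.interchange_left ha _ _ _).trans
    (Eq.trans ?_ (Hom.interchange_left (id_mem X) _ _ _).symm)
  rw [Hom.comp_id, Hom.id_comp, Hom.comp_id, Hom.id_comp]

theorem onTail_natural_of_even_right {X Y W W' : Word} (a : Hom X Y) (f : W ⟶ W') [hf : IsEven f] :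
    onTail a W ≫ Hom.tensor (Hom.id Y) f = Hom.tensor (Hom.id X) f ≫ onTail a W' := by
  refine (Hom.interchange_right _ _ _ hf.mem).trans
    (Eq.trans ?_ (Hom.interchange_left (id_mem X) _ _ _).symm)
  rw [Hom.comp_id, Hom.id_comp, Hom.comp_id, Hom.id_comp]

/-! ## The generating morphisms with strands on the right -/

section generators

variable (W : Word)

/-- cup oriented from left to right -/
def cupR : W ⟶ Q + (P + W) := onTail (Hom.mk Diag.cupR) W
/-- cup oriented from right to left -/
def cupL : W ⟶ P + (Q + W) := onTail (Hom.mk Diag.cupL) W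
/-- cap oriented from left to right -/
def capR : P + (Q + W) ⟶ W := onTail (Hom.mk Diag.capR) W
/-- cap oriented from right to left -/
def capL : Q + (P + W) ⟶ W := onTail (Hom.mk Diag.capL) W
/-- crossing of two upward strands -/
def xUp : P + (P + W) ⟶ P + (P + W) := onTail (Hom.mk Diag.cross) W
/-- hollow dot on an upward strand -/
def dotU : P + W ⟶ P + W := onTail (Hom.mk Diag.dotUp) W
/-- hollow dot on a downward strand -/
def dotD : Q + W ⟶ Q + W := onTail (Hom.mk Diag.dotDown) W

theorem gen_mem {X Y : Word} (g : Gen X Y) : Hom.mk (.gen g) ∈ homPiece g.parity X Y :=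
  ⟨_, .gen g, rfl⟩

instance : IsEven (cupR W) := ⟨tensor_mem (gen_mem .cupR) (id_mem W)⟩
instance : IsEven (cupL W) := ⟨tensor_mem (gen_mem .cupL) (id_mem W)⟩
instance : IsEven (capR W) := ⟨tensor_mem (gen_mem .capR) (id_mem W)⟩
instance : IsEven (capL W) := ⟨tensor_mem (gen_mem .capL) (id_mem W)⟩
instance : IsEven (xUp W) := ⟨tensor_mem (gen_mem .cross) (id_mem W)⟩

theorem id_add_tensor (l l' : Letter) {W W' : Word} (f : W ⟶ W') :
    Hom.tensor (Hom.id (FreeAddMonoid.of l + FreeAddMonoid.of l')) f = lw l (lw l' f) := by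
  rw [← Hom.id_tensor_id]
  exact eq_of_heq (Hom.tensor_tensor_heq (Hom.id (FreeAddMonoid.of l)) (Hom.id _) f)

theorem id_zero_tensor {W W' : Word} (f : W ⟶ W') : Hom.tensor (Hom.id 0) f = f :=
  eq_of_heq (Hom.unit_tensor_heq f)

variable {W} {W' : Word} (f : W ⟶ W')

theorem cupR_natural : cupR W ≫ 𝐐 (𝐏 f) = f ≫ cupR W' := by
  have := onTail_natural_of_even_left (gen_mem .cupR) f
  rw [id_add_tensor, id_zero_tensor] at this
  exact this

theorem cupL_natural : cupL W ≫ 𝐏 (𝐐 f) = f ≫ cupL W' := by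
  have := onTail_natural_of_even_left (gen_mem .cupL) f
  rw [id_add_tensor, id_zero_tensor] at this
  exact this

theorem capR_natural : 𝐏 (𝐐 f) ≫ capR W' = capR W ≫ f := by
  have := onTail_natural_of_even_left (gen_mem .capR) f
  rw [id_add_tensor, id_zero_tensor] at this
  exact this.symm

theorem capL_natural : 𝐐 (𝐏 f) ≫ capL W' = capL W ≫ f := by
  have := onTail_natural_of_even_left (gen_mem .capL) f
  rw [id_add_tensor, id_zero_tensor] at this
  exact this.symm

theorem xUp_natural : 𝐏 (𝐏 f) ≫ xUp W' = xUp W ≫ 𝐏 (𝐏 f) := by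
  have := onTail_natural_of_even_left (gen_mem .cross) f
  rw [id_add_tensor] at this
  exact this.symm

theorem dotU_natural [IsEven f] : 𝐏 f ≫ dotU W' = dotU W ≫ 𝐏 f :=
  (onTail_natural_of_even_right (Hom.mk Diag.dotUp) f).symm

variable (W)

/-- The two sides are the same pair of dots at exchanged heights. This is the only source of the
factor -1 that separates dotted from plain clasps below. -/
theorem dotU_dotU_anticomm :
    dotU (P + W) ≫ 𝐏 (dotU W) = -(𝐏 (dotU W) ≫ dotU (P + W)) := by
  have hd : dotU W ∈ homPiece 1 (P + W) (P + W) := by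
    refine ⟨Diag.dotUp ⊠ .id W, ?_, rfl⟩
    exact Diag.HasParity.tensor (p := 1) (q := 0) (.gen .dotUp) (.id W)
  have h₁ := Hom.tensor_comp_tensor (Hom.id P) (Hom.id (P + W)) (gen_mem .dotUp) hd
  have h₂ := Hom.interchange_left (id_mem P) (Hom.mk Diag.dotUp) (dotU W) (Hom.id (P + W))
  rw [Hom.id_comp, Hom.comp_id] at h₂
  rw [Hom.id_comp, Hom.comp_id] at h₁
  refine h₁.trans (Eq.trans ?_ (congrArg Neg.neg h₂.symm))
  have : ((Gen.dotUp.parity * 1 : ZMod 2)).val = 1 := rfl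
  rw [this, pow_one]
  rfl

/-! ### The local relations -/

theorem onTail_sound {X Y : Word} {f g : Diag X Y} (hfg : Diag.LocalRel f g) :
    onTail (Hom.mk f) W = onTail (Hom.mk g) W :=
  congrArg (fun a => onTail a W) (Hom.sound (.of_local hfg))

/-- The tensor product is associative only up to a cast between words, whence the heterogeneous
equality. For the explicit words of the generators the two boundary types agree by definition, and
`eq_of_heq` returns to honest equations. -/
theorem onTail_tensor_left (l : Letter) {X Y : Word} (f : Hom X Y) :
    HEq (onTail (Hom.tensor (Hom.id (FreeAddMonoid.of l)) f) W) (lw l (onTail f W)) :=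
  Hom.tensor_tensor_heq _ _ _

theorem onTail_tensor_right (Z : Word) {X Y : Word} (f : Hom X Y) :
    HEq (onTail (Hom.tensor f (Hom.id Z)) W) (onTail f (Z + W)) := by
  refine (Hom.tensor_tensor_heq _ _ _).trans ?_
  rw [Hom.id_tensor_id]
  rfl

theorem onTail_tensor_left₂ (l l' : Letter) {X Y : Word} (f : Hom X Y) :
    HEq (onTail (Hom.tensor (Hom.tensor (Hom.id (FreeAddMonoid.of l))
      (Hom.id (FreeAddMonoid.of l'))) f) W) (lw l (lw l' (onTail f W))) := by
  rw [Hom.id_tensor_id, ← id_add_tensor]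
  exact Hom.tensor_tensor_heq _ _ _

theorem onTail_tensor_right₂ (Z Z' : Word) {X Y : Word} (f : Hom X Y) :
    HEq (onTail (Hom.tensor (Hom.tensor f (Hom.id Z)) (Hom.id Z')) W) (onTail f (Z + (Z' + W))) :=
  (onTail_tensor_right W Z' _).trans (onTail_tensor_right (Z' + W) Z f)

theorem onTail_tensor_middle (l : Letter) (Z : Word) {X Y : Word} (f : Hom X Y) :
    HEq (onTail (Hom.tensor (Hom.tensor (Hom.id (FreeAddMonoid.of l)) f) (Hom.id Z)) W)
      (lw l (onTail f (Z + W))) :=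
  (onTail_tensor_right W Z _).trans (onTail_tensor_left (Z + W) l f)

theorem comp_congr_of_heq {A B C A' B' C' : Word} {f : A ⟶ B} {g : B ⟶ C} {f' : A' ⟶ B'}
    {g' : B' ⟶ C'} (hA : A = A') (hB : B = B') (hC : C = C') (hf : HEq f f') (hg : HEq g g') :
    HEq (f ≫ g) (f' ≫ g') := by
  subst hA hB hC; rw [eq_of_heq hf, eq_of_heq hg]

theorem onTail_mk_comp {X Y Z A B C : Word} (f : Diag X Y) (g : Diag Y Z) {f' : A ⟶ B}
    {g' : B ⟶ C} (hA : X + W = A) (hB : Y + W = B) (hC : Z + W = C)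
    (hf : HEq (onTail (Hom.mk f) W) f') (hg : HEq (onTail (Hom.mk g) W) g') :
    HEq (onTail (Hom.mk (f ⟫ g)) W) (f' ≫ g') :=
  (heq_of_eq (onTail_comp (Hom.mk f) (Hom.mk g) W)).trans (comp_congr_of_heq hA hB hC hf hg)

theorem onTail_add {X Y : Word} (f g : Hom X Y) :
    onTail (f + g) W = onTail f W + onTail g W := Hom.add_tensor f g _

theorem onTail_smul {X Y : Word} (r : ℂ) (f : Hom X Y) :
    onTail (r • f) W = r • onTail f W := Hom.smul_tensor r f _

theorem onTail_mk_add {X Y : Word} (f g : Diag X Y) :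
    onTail (Hom.mk (.add f g)) W = onTail (Hom.mk f) W + onTail (Hom.mk g) W :=
  onTail_add W (Hom.mk f) (Hom.mk g)

theorem onTail_mk_smul {X Y : Word} (r : ℂ) (f : Diag X Y) :
    onTail (Hom.mk (.smul r f)) W = r • onTail (Hom.mk f) W :=
  onTail_smul W r (Hom.mk f)

theorem onTail_zero (X Y : Word) : onTail (0 : Hom X Y) W = 0 := by
  have := onTail_smul W (0 : ℂ) (0 : Hom X Y)
  rwa [zero_smul, zero_smul] at this

theorem xUp_xUp : xUp W ≫ xUp W = 𝟙 _ := by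
  have := onTail_sound W .cross_cross
  exact (onTail_comp _ _ W).symm.trans (this.trans (onTail_id _ W))

theorem dotU_dotU : dotU W ≫ dotU W = 𝟙 _ := by
  have := onTail_sound W .dotUp_dotUp
  exact (onTail_comp _ _ W).symm.trans (this.trans (onTail_id _ W))

theorem cupR_capL : cupR W ≫ capL W = 𝟙 _ := by
  have := onTail_sound W .bubble
  exact (onTail_comp _ _ W).symm.trans (this.trans (onTail_id _ W))

theorem zigzag_up_right : 𝐏 (cupR W) ≫ capR (P + W) = 𝟙 _ := by
  refine eq_of_heq ((onTail_mk_comp W _ _ rfl rfl rfl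
    (onTail_tensor_left W .P (Hom.mk .cupR)) (onTail_tensor_right W P (Hom.mk .capR))).symm.trans
    (heq_of_eq ((onTail_sound W .zigzag_up_right).trans (onTail_id P W))))

theorem zigzag_down_right : cupR (Q + W) ≫ 𝐐 (capR W) = 𝟙 _ := by
  refine eq_of_heq ((onTail_mk_comp W _ _ rfl rfl rfl
    (onTail_tensor_right W Q (Hom.mk .cupR)) (onTail_tensor_left W .Q (Hom.mk .capR))).symm.trans
    (heq_of_eq ((onTail_sound W .zigzag_down_right).trans (onTail_id Q W))))

theorem zigzag_up_left : cupL (P + W) ≫ 𝐏 (capL W) = 𝟙 _ := by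
  refine eq_of_heq ((onTail_mk_comp W _ _ rfl rfl rfl
    (onTail_tensor_right W P (Hom.mk .cupL)) (onTail_tensor_left W .P (Hom.mk .capL))).symm.trans
    (heq_of_eq ((onTail_sound W .zigzag_up_left).trans (onTail_id P W))))

theorem xUp_braid : xUp (P + W) ≫ 𝐏 (xUp W) ≫ xUp (P + W) =
    𝐏 (xUp W) ≫ xUp (P + W) ≫ 𝐏 (xUp W) := by
  have hl := onTail_tensor_left W .P (Hom.mk .cross)
  have hr := onTail_tensor_right W P (Hom.mk .cross)
  refine eq_of_heq (HEq.trans (HEq.symm ?_) ((heq_of_eq (onTail_sound W .braid)).trans ?_))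
  · exact onTail_mk_comp W _ _ rfl rfl rfl hr (onTail_mk_comp W _ _ rfl rfl rfl hl hr)
  · exact onTail_mk_comp W _ _ rfl rfl rfl hl (onTail_mk_comp W _ _ rfl rfl rfl hr hl)

/-- The crossing with both strands oriented to the right. -/
def xRight : P + (Q + W) ⟶ Q + (P + W) :=
  cupR (P + (Q + W)) ≫ 𝐐 (xUp (Q + W)) ≫ 𝐐 (𝐏 (capR W))

/-- The crossing with both strands oriented to the left. -/
def xLeft : Q + (P + W) ⟶ P + (Q + W) :=
  𝐐 (𝐏 (cupL W)) ≫ 𝐐 (xUp (Q + W)) ≫ capL (P + (Q + W))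

/-- The crossing of two downward strands. -/
def xDown : Q + (Q + W) ⟶ Q + (Q + W) :=
  cupR (Q + (Q + W)) ≫ 𝐐 (xRight (Q + W)) ≫ 𝐐 (𝐐 (capR W))

instance : IsEven (xRight W) := by unfold xRight; infer_instance
instance : IsEven (xLeft W) := by unfold xLeft; infer_instance
instance : IsEven (xDown W) := by unfold xDown; infer_instance

theorem onTail_crossRight : onTail (Hom.mk .crossRight) W = xRight W :=
  eq_of_heq (onTail_mk_comp W _ _ rfl rfl rfl (onTail_tensor_right₂ W P Q (Hom.mk .cupR))
    (onTail_mk_comp W _ _ rfl rfl rfl (onTail_tensor_middle W .Q Q (Hom.mk .cross))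
      (onTail_tensor_left₂ W .Q .P (Hom.mk .capR))))

theorem onTail_crossLeft : onTail (Hom.mk .crossLeft) W = xLeft W :=
  eq_of_heq (onTail_mk_comp W _ _ rfl rfl rfl (onTail_tensor_left₂ W .Q .P (Hom.mk .cupL))
    (onTail_mk_comp W _ _ rfl rfl rfl (onTail_tensor_middle W .Q Q (Hom.mk .cross))
      (onTail_tensor_right₂ W P Q (Hom.mk .capL))))

theorem onTail_crossDown : onTail (Hom.mk .crossDown) W = xDown W :=
  eq_of_heq (onTail_mk_comp W _ _ rfl rfl rfl (onTail_tensor_right₂ W Q Q (Hom.mk .cupR))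
    (onTail_mk_comp W _ _ rfl rfl rfl ((onTail_tensor_middle W .Q Q (Hom.mk .crossRight)).trans
      (heq_of_eq (congrArg 𝐐 (onTail_crossRight (Q + W)))))
      (onTail_tensor_left₂ W .Q .Q (Hom.mk .capR))))

theorem xRight_xLeft : xRight W ≫ xLeft W = 𝟙 _ := by
  rw [← onTail_crossRight, ← onTail_crossLeft]
  exact (onTail_comp _ _ W).symm.trans ((onTail_sound W .right_left).trans (onTail_id _ W))

theorem cupR_dotD : cupR W ≫ dotD (P + W) = cupR W ≫ 𝐐 (dotU W) := by
  refine eq_of_heq ((onTail_mk_comp W .cupR (.dotDown ⊠ .up) rfl rfl rfl HEq.rfl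
    (onTail_tensor_right W P (Hom.mk .dotDown))).symm.trans
    ((heq_of_eq (onTail_sound W .dot_cupR)).trans (onTail_mk_comp W _ _ rfl rfl rfl HEq.rfl
      (onTail_tensor_left W .Q (Hom.mk .dotUp)))))

/-- The dot on the downward leg of the cup is traded for one on the upward leg by `cupR_dotD`, so
that from here on only upward dots occur. -/
theorem xLeft_xRight : xLeft W ≫ xRight W =
    𝟙 _ - capL W ≫ cupR W - 𝐐 (dotU W) ≫ capL W ≫ cupR W ≫ 𝐐 (dotU W) := by
  have h₁ : onTail (Hom.mk (.capL ⟫ .cupR)) W = capL W ≫ cupR W :=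
    onTail_comp (Hom.mk .capL) (Hom.mk .cupR) W
  have h₂ : onTail (Hom.mk (((.down ⊠ .dotUp) ⟫ .capL) ⟫ (.cupR ⟫ (.dotDown ⊠ .up)))) W =
      (𝐐 (dotU W) ≫ capL W) ≫ cupR W ≫ dotD (P + W) :=
    eq_of_heq (onTail_mk_comp W _ _ rfl rfl rfl
      (onTail_mk_comp W (.down ⊠ .dotUp) .capL rfl rfl rfl
        (onTail_tensor_left W .Q (Hom.mk .dotUp)) HEq.rfl)
      (onTail_mk_comp W .cupR (.dotDown ⊠ .up) rfl rfl rfl HEq.rfl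
        (onTail_tensor_right W P (Hom.mk .dotDown))))
  rw [cupR_dotD, Category.assoc] at h₂
  have h₃ : xLeft W ≫ xRight W = 𝟙 _ + ((-1 : ℂ) • (capL W ≫ cupR W) +
      (-1 : ℂ) • (𝐐 (dotU W) ≫ capL W ≫ cupR W ≫ 𝐐 (dotU W))) := by
    rw [← onTail_crossRight, ← onTail_crossLeft]
    refine (onTail_comp (Hom.mk .crossLeft) (Hom.mk .crossRight) W).symm.trans
      ((onTail_sound W .left_right).trans ?_)
    rw [onTail_mk_add, onTail_mk_add, onTail_mk_smul, onTail_mk_smul, h₁, h₂]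
    exact congrArg (· + _) (onTail_id (Q + P) W)
  rw [h₃]
  module

theorem left_curl : cupR (P + W) ≫ 𝐐 (xUp W) ≫ capL (P + W) = 0 := by
  refine eq_of_heq ((onTail_mk_comp W _ _ rfl rfl rfl (onTail_tensor_right W P (Hom.mk .cupR))
    (onTail_mk_comp W _ _ rfl rfl rfl (onTail_tensor_left W .Q (Hom.mk .cross))
      (onTail_tensor_right W P (Hom.mk .capL)))).symm.trans
    (heq_of_eq ((onTail_sound W .left_curl).trans (onTail_zero W P P))))

theorem dotU_xUp : dotU (P + W) ≫ xUp W = xUp W ≫ 𝐏 (dotU W) := by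
  refine eq_of_heq ((onTail_mk_comp W (.dotUp ⊠ .up) .cross rfl rfl rfl
    (onTail_tensor_right W P (Hom.mk .dotUp)) HEq.rfl).symm.trans
    ((heq_of_eq (onTail_sound W .dot_cross_left)).trans (onTail_mk_comp W _ _ rfl rfl rfl HEq.rfl
      (onTail_tensor_left W .P (Hom.mk .dotUp)))))

theorem lw_dotU_xUp : 𝐏 (dotU W) ≫ xUp W = xUp W ≫ dotU (P + W) := by
  -- Conjugation of `dotU_xUp` by the involution `xUp` exchanges the roles of the two strands.
  have h := congrArg (fun f => xUp W ≫ f ≫ xUp W) (dotU_xUp W)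
  simp only [Category.assoc, xUp_xUp, Category.comp_id] at h
  rw [← Category.assoc (xUp W) (xUp W), xUp_xUp, Category.id_comp] at h
  exact h.symm

end generators

end

end TwistedHeis

namespace TwistedHeis

noncomputable section

open CategoryTheory

/-! ## Derived relations among string diagrams -/

variable {W W' : Word}

/-- The functor `P` is left adjoint to `Q`. -/
theorem eq_of_lw_comp_capR {A B : Word} {f g : A ⟶ Q + B}
    (hfg : 𝐏 f ≫ capR B = 𝐏 g ≫ capR B) : f = g := by
  -- A morphism into `Q + B` is recovered from its mate by the zigzag identity.
  have key : ∀ f : A ⟶ Q + B, cupR A ≫ 𝐐 (𝐏 f ≫ capR B) = f := by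
    intro f
    rw [lw_comp, reassoc_of% (cupR_natural f), zigzag_down_right, Category.comp_id]
  rw [← key f, ← key g, hfg]

theorem xRight_natural (f : W ⟶ W') : 𝐏 (𝐐 f) ≫ xRight W' = xRight W ≫ 𝐐 (𝐏 f) := by
  unfold xRight
  rw [← reassoc_of% (cupR_natural (𝐏 (𝐐 f)))]
  simp only [Category.assoc, ← lw_comp]
  rw [reassoc_of% (xUp_natural (𝐐 f)), ← lw_comp, capR_natural]

theorem xLeft_natural (f : W ⟶ W') : 𝐐 (𝐏 f) ≫ xLeft W' = xLeft W ≫ 𝐏 (𝐐 f) := by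
  unfold xLeft
  simp only [Category.assoc]
  rw [← capL_natural (𝐏 (𝐐 f)), ← reassoc_of% (lw_comp Letter.Q (xUp _)), ← xUp_natural]
  simp only [lw_comp, Category.assoc]
  simp only [← reassoc_of% (lw_comp Letter.Q (𝐏 _) (𝐏 _)), ← lw_comp Letter.P, cupL_natural]

theorem xDown_natural (f : W ⟶ W') : 𝐐 (𝐐 f) ≫ xDown W' = xDown W ≫ 𝐐 (𝐐 f) := by
  unfold xDown
  rw [← reassoc_of% (cupR_natural (𝐐 (𝐐 f)))]
  simp only [Category.assoc, ← lw_comp]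
  rw [reassoc_of% (xRight_natural (𝐐 f)), ← lw_comp, capR_natural]

variable (W)

/-- This exhibits `xRight` as the mate of `xUp`. Together with `eq_of_lw_comp_capR` it reduces
relations for rotated crossings to those for upward ones. -/
theorem lw_xRight_capR : 𝐏 (xRight W) ≫ capR (P + W) = xUp (Q + W) ≫ 𝐏 (capR W) := by
  unfold xRight
  simp only [lw_comp, Category.assoc]
  rw [capR_natural (𝐏 (capR W)), reassoc_of% (capR_natural (xUp (Q + W))),
    reassoc_of% (zigzag_up_right (P + (Q + W)))]

theorem lw_xDown_capR : 𝐏 (xDown W) ≫ capR (Q + W) = xRight (Q + W) ≫ 𝐐 (capR W) := by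
  unfold xDown
  simp only [lw_comp, Category.assoc]
  rw [capR_natural (𝐐 (capR W)), reassoc_of% (capR_natural (xRight (Q + W))),
    reassoc_of% (zigzag_up_right (Q + (Q + W)))]

/-- The mate of this identity is the braid relation of three upward strands. The next two results
arise in the same way, each rotating one more strand downwards. -/
theorem xUp_xRight_xRight : xUp (Q + W) ≫ 𝐏 (xRight W) ≫ xRight (P + W) =
    𝐏 (xRight W) ≫ xRight (P + W) ≫ 𝐐 (xUp W) := by
  apply eq_of_lw_comp_capR
  simp only [lw_comp, Category.assoc]
  rw [lw_xRight_capR, capR_natural, reassoc_of% (lw_xRight_capR (P + W)),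
    reassoc_of% (xUp_natural (xRight W)), reassoc_of% (xUp_natural (xRight W)), ← lw_comp,
    lw_xRight_capR, ← reassoc_of% (lw_comp Letter.P (𝐏 (xRight W)))]
  rw [lw_xRight_capR]
  simp only [lw_comp, Category.assoc]
  rw [xUp_natural, ← reassoc_of% (xUp_braid (Q + W))]

theorem xDown_xRight_xRight : 𝐏 (xDown W) ≫ xRight (Q + W) ≫ 𝐐 (xRight W) =
    xRight (Q + W) ≫ 𝐐 (xRight W) ≫ xDown (P + W) := by
  apply eq_of_lw_comp_capR
  simp only [lw_comp, Category.assoc]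
  rw [capR_natural, reassoc_of% (lw_xRight_capR (Q + W)), lw_xDown_capR,
    reassoc_of% (xUp_natural (xDown W)), ← reassoc_of% (lw_comp Letter.P (𝐏 (xDown W))),
    lw_xDown_capR, reassoc_of% (xRight_natural (xRight W)), ← lw_comp Letter.Q, lw_xRight_capR]
  simp only [lw_comp, Category.assoc]
  rw [xRight_natural, reassoc_of% (xUp_xRight_xRight (Q + W))]

theorem xDown_braid : xDown (Q + W) ≫ 𝐐 (xDown W) ≫ xDown (Q + W) =
    𝐐 (xDown W) ≫ xDown (Q + W) ≫ 𝐐 (xDown W) := by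
  apply eq_of_lw_comp_capR
  simp only [lw_comp, Category.assoc]
  rw [lw_xDown_capR, capR_natural, reassoc_of% (lw_xDown_capR (Q + W)),
    reassoc_of% (xRight_natural (xDown W)), ← lw_comp Letter.Q, lw_xDown_capR,
    reassoc_of% (xRight_natural (xDown W)), ← reassoc_of% (lw_comp Letter.Q (𝐏 (xDown W))),
    lw_xDown_capR]
  simp only [lw_comp, Category.assoc]
  rw [xDown_natural, reassoc_of% (xDown_xRight_xRight (Q + W))]

/-- Passing to mates twice turns both strands upwards, where the double crossing is `xUp_xUp`. -/
theorem xDown_xDown : xDown W ≫ xDown W = 𝟙 _ := by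
  apply eq_of_lw_comp_capR
  apply eq_of_lw_comp_capR
  simp only [lw_comp, Category.assoc, lw_xDown_capR, lw_id, Category.id_comp]
  rw [capR_natural, reassoc_of% (lw_xRight_capR (Q + W)), reassoc_of% (xUp_natural (xDown W)),
    ← reassoc_of% (lw_comp Letter.P (𝐏 (xDown W))), lw_xDown_capR]
  simp only [lw_comp, Category.assoc]
  rw [capR_natural, reassoc_of% (lw_xRight_capR (Q + W)), reassoc_of% (xUp_xUp (Q + (Q + W)))]

/-- A strand that crosses one leg of a cup can be slid under the cup to cross the other leg; the cap
hidden in the rotated crossing cancels against the cup by a zigzag. -/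
theorem lw_cupR_xDown : 𝐐 (cupR W) ≫ xDown (P + W) = cupR (Q + W) ≫ 𝐐 (xRight W) := by
  unfold xDown
  rw [← reassoc_of% (cupR_natural (𝐐 (cupR W))), ← reassoc_of% (lw_comp Letter.Q),
    xRight_natural, ← lw_comp]
  simp only [Category.assoc]
  rw [← lw_comp, zigzag_up_right, lw_id, Category.comp_id]

theorem lw_cupR_xRight : 𝐏 (cupR W) ≫ xRight (P + W) = cupR (P + W) ≫ 𝐐 (xUp W) := by
  unfold xRight
  rw [← reassoc_of% (cupR_natural (𝐏 (cupR W))), ← reassoc_of% (lw_comp Letter.Q),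
    xUp_natural, ← lw_comp]
  simp only [Category.assoc]
  rw [← lw_comp, zigzag_up_right, lw_id, Category.comp_id]

theorem xLeft_lw_capL : xLeft (P + W) ≫ 𝐏 (capL W) = 𝐐 (xUp W) ≫ capL (P + W) := by
  unfold xLeft
  simp only [Category.assoc]
  rw [← capL_natural (𝐏 (capL W)), ← reassoc_of% (lw_comp Letter.Q (xUp _)), ← xUp_natural,
    ← reassoc_of% (lw_comp Letter.Q), ← reassoc_of% (lw_comp Letter.P), zigzag_up_left]
  simp

/-- Sliding the cup inside `xLeft` to the bottom leaves a left curl. -/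
theorem cupR_xLeft : cupR W ≫ xLeft W = 0 := by
  unfold xLeft
  rw [reassoc_of% (cupR_natural (cupL W)), left_curl, Limits.comp_zero]

theorem xRight_capL : xRight W ≫ capL W = 0 := by
  unfold xRight
  simp only [Category.assoc]
  rw [capL_natural, reassoc_of% (left_curl (Q + W)), Limits.zero_comp]

theorem dotU_xRight : dotU (Q + W) ≫ xRight W = xRight W ≫ 𝐐 (dotU W) := by
  unfold xRight
  rw [← reassoc_of% (cupR_natural (dotU (Q + W)))]
  simp only [Category.assoc, ← lw_comp]
  rw [reassoc_of% (lw_dotU_xUp (Q + W)), dotU_natural]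

theorem lw_dotU_xLeft : 𝐐 (dotU W) ≫ xLeft W = xLeft W ≫ dotU (Q + W) := by
  unfold xLeft
  simp only [Category.assoc]
  rw [← capL_natural, ← reassoc_of% (lw_comp Letter.Q (dotU W)), ← dotU_natural,
    ← reassoc_of% (lw_comp Letter.Q (xUp _)), ← dotU_xUp]
  simp only [lw_comp, Category.assoc]

/-- The triple crossing with alternating orientations. -/
theorem xRight_xDown_xLeft : 𝐐 (xRight W) ≫ xDown (P + W) ≫ 𝐐 (xLeft W) =
    xLeft (Q + W) ≫ 𝐏 (xDown W) ≫ xRight (Q + W) := by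
  -- Inserting a double crossing `xRight ≫ xLeft` makes the right side equal to the left side
  -- preceded by the other double crossing. By `xLeft_xRight` the two differ by terms that contain a
  -- cup at the bottom of the left side; `h₂` and `h₃` show that these vanish because the cup slides
  -- up into a left curl.
  have h₁ : xLeft (Q + W) ≫ 𝐏 (xDown W) ≫ xRight (Q + W) =
      (xLeft (Q + W) ≫ xRight (Q + W)) ≫ 𝐐 (xRight W) ≫ xDown (P + W) ≫ 𝐐 (xLeft W) := by
    simp only [Category.assoc]
    rw [← reassoc_of% (xDown_xRight_xRight W), ← lw_comp .Q, xRight_xLeft, lw_id, Category.comp_id]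
  have h₂ : cupR (Q + W) ≫ 𝐐 (xRight W) ≫ xDown (P + W) ≫ 𝐐 (xLeft W) = 0 := by
    rw [← reassoc_of% (lw_cupR_xDown W), reassoc_of% (xDown_xDown (P + W)), ← lw_comp, cupR_xLeft,
      lw_zero]
  have h₃ : cupR (Q + W) ≫ 𝐐 (dotU (Q + W)) ≫ 𝐐 (xRight W) ≫ xDown (P + W) ≫ 𝐐 (xLeft W) = 0 := by
    rw [← reassoc_of% (lw_comp Letter.Q (dotU (Q + W))), dotU_xRight, lw_comp, Category.assoc,
      reassoc_of% (xDown_natural (dotU W)), ← lw_comp .Q, lw_dotU_xLeft, lw_comp,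
      reassoc_of% h₂, Limits.zero_comp]
  rw [h₁, xLeft_xRight]
  simp only [Preadditive.sub_comp, Category.assoc, Category.id_comp, h₂, h₃, Limits.comp_zero,
    sub_zero]

theorem lw_cupR_xDown_lw_capL : 𝐐 (cupR W) ≫ xDown (P + W) ≫ 𝐐 (capL W) = 0 := by
  rw [reassoc_of% (lw_cupR_xDown W), ← lw_comp, xRight_capL, lw_zero, Limits.comp_zero]

/-- Sliding the strands across the lower cup and the upper cap makes the mixed crossings meet as
`xRight ≫ xLeft`, which cancels. This is the move that shortens two clasped cycles. -/
theorem clasp : 𝐐 (cupR (P + W)) ≫ xDown (P + (P + W)) ≫ 𝐐 (𝐐 (xUp W)) ≫ 𝐐 (capL (P + W)) =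
    capL W ≫ cupR W := by
  rw [reassoc_of% (lw_cupR_xDown (P + W)), ← lw_comp, ← xLeft_lw_capL, ← lw_comp,
    reassoc_of% (xRight_xLeft (P + W)), cupR_natural]

end

end TwistedHeis

namespace TwistedHeis

noncomputable section

open CategoryTheory

/-! ## The trace of an even endomorphism -/

open Classical in
/-- The class of an even endomorphism in the even trace. -/
def tr {X : Word} (f : X ⟶ X) : EvenTrace :=
  -- The value 0 off the even endomorphisms lets `tr` be applied to composites without carrying
  -- membership proofs; evenness is then supplied by instances.
  if hf : f ∈ homPiece 0 X X then trClass ⟨f, hf⟩ else 0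

theorem tr_of_mem {X : Word} {f : X ⟶ X} (hf : f ∈ homPiece 0 X X) : tr f = trClass ⟨f, hf⟩ :=
  dif_pos hf

theorem trClass_add {X : Word} (f g : EvenEnd X) : trClass (f + g) = trClass f + trClass g := by
  simp only [trClass, map_add]

theorem trClass_smul {X : Word} (r : ℂ) (f : EvenEnd X) : trClass (r • f) = r • trClass f := by
  unfold trClass
  rw [← map_smul]
  congr 1
  exact (DirectSum.lof ℂ Word (fun X => EvenEnd X) X).map_smul r f

variable {X Y : Word}

theorem tr_add (f g : X ⟶ X) [hf : IsEven f] [hg : IsEven g] : tr (f + g) = tr f + tr g := by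
  rw [tr_of_mem hf.mem, tr_of_mem hg.mem, ← trClass_add]
  exact tr_of_mem (add_mem hf.mem hg.mem)

theorem tr_smul (r : ℂ) (f : X ⟶ X) [hf : IsEven f] : tr (r • f) = r • tr f := by
  rw [tr_of_mem hf.mem, ← trClass_smul]
  exact tr_of_mem (Submodule.smul_mem _ r hf.mem)

instance (r : ℂ) (f : X ⟶ Y) [hf : IsEven f] : IsEven (r • f) := ⟨Submodule.smul_mem _ r hf.mem⟩

theorem tr_zero : tr (0 : X ⟶ X) = 0 := by
  have := tr_smul (0 : ℂ) (0 : X ⟶ X)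
  rwa [zero_smul, zero_smul] at this

theorem tr_comm_of_mem {p : ZMod 2} {f : X ⟶ Y} {g : Y ⟶ X} (hf : f ∈ homPiece p X Y)
    (hg : g ∈ homPiece p Y X) : tr (f ≫ g) = tr (g ≫ f) := by
  exact (tr_of_mem (comp_mem hf hg)).trans ((RingQuot.mkAlgHom_rel ℂ
    (TraceRel.comm f g hf hg)).trans (tr_of_mem (comp_mem hg hf)).symm)

theorem tr_comm (f : X ⟶ Y) (g : Y ⟶ X) [hf : IsEven f] [hg : IsEven g] :
    tr (f ≫ g) = tr (g ≫ f) := tr_comm_of_mem hf.mem hg.mem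

theorem tr_congr_heq {f : X ⟶ X} {g : Y ⟶ Y} (hXY : X = Y) (hfg : HEq f g) : tr f = tr g := by
  subst hXY; rw [eq_of_heq hfg]

theorem tr_mul_tr (f : X ⟶ X) (g : Y ⟶ Y) [hf : IsEven f] [hg : IsEven g] :
    tr f * tr g = tr (X := X + Y) (Hom.tensor f g) := by
  rw [tr_of_mem hf.mem, tr_of_mem hg.mem, tr_of_mem (tensor_mem hf.mem hg.mem)]
  unfold trClass
  rw [← map_mul, DirectSum.of_mul_of]
  rfl

theorem tr_id_zero : tr (𝟙 (0 : Word)) = 1 := by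
  exact (tr_of_mem (id_mem 0)).trans (map_one (RingQuot.mkAlgHom ℂ TraceRel))

/-! ## Bundles of parallel strands -/

/-- The word `l ⋯ l W`, built from the left. -/
@[reducible] def bundle (l : Letter) : ℕ → Word → Word
  | 0, W => W
  | n + 1, W => FreeAddMonoid.of l + bundle l n W

/-- The word `l ⋯ l W`, built from the right. -/
@[reducible] def pile (l : Letter) : ℕ → Word → Word
  | 0, W => W
  | n + 1, W => pile l n (FreeAddMonoid.of l + W)

/-- Adding `n` strands on the left. -/
def bw (l : Letter) {X Y : Word} : ∀ n : ℕ, (X ⟶ Y) → (bundle l n X ⟶ bundle l n Y)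
  | 0, f => f
  | n + 1, f => lw l (bw l n f)

/-- Adding `n` strands on the left. -/
def pw (l : Letter) : ∀ (n : ℕ) {X Y : Word}, (X ⟶ Y) → (pile l n X ⟶ pile l n Y)
  | 0, _, _, f => f
  | n + 1, _, _, f => pw l n (lw l f)

section

variable (l : Letter) {Z : Word}

@[simp] theorem bw_id : ∀ n : ℕ, bw l n (𝟙 X) = 𝟙 (bundle l n X)
  | 0 => rfl
  | n + 1 => (congrArg (lw l) (bw_id n)).trans (lw_id l _)

@[simp] theorem bw_comp (f : X ⟶ Y) (g : Y ⟶ Z) : ∀ n : ℕ, bw l n (f ≫ g) = bw l n f ≫ bw l n g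
  | 0 => rfl
  | n + 1 => (congrArg (lw l) (bw_comp f g n)).trans (lw_comp l _ _)

instance bw_even (f : X ⟶ Y) [hf : IsEven f] : ∀ n : ℕ, IsEven (bw l n f)
  | 0 => hf
  | n + 1 => by
    have := bw_even f n
    exact inferInstanceAs (IsEven (lw l (bw l n f)))

theorem pw_id : ∀ (n : ℕ) (X : Word), pw l n (𝟙 X) = 𝟙 (pile l n X)
  | 0, _ => rfl
  | n + 1, X => (congrArg (pw l n) (lw_id l X)).trans (pw_id n _)

theorem pw_comp : ∀ (n : ℕ) {X Y Z : Word} (f : X ⟶ Y) (g : Y ⟶ Z),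
    pw l n (f ≫ g) = pw l n f ≫ pw l n g
  | 0, _, _, _, _, _ => rfl
  | n + 1, _, _, _, f, g => (congrArg (pw l n) (lw_comp l f g)).trans (pw_comp n _ _)

theorem pw_add : ∀ (n : ℕ) {X Y : Word} (f g : X ⟶ Y), pw l n (f + g) = pw l n f + pw l n g
  | 0, _, _, _, _ => rfl
  | n + 1, _, _, f, g => (congrArg (pw l n) (lw_add l f g)).trans (pw_add n _ _)

theorem pw_smul (r : ℂ) : ∀ (n : ℕ) {X Y : Word} (f : X ⟶ Y), pw l n (r • f) = r • pw l n f
  | 0, _, _, _ => rfl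
  | n + 1, _, _, f => (congrArg (pw l n) (lw_smul l r f)).trans (pw_smul r n _)

theorem pw_zero (n : ℕ) : pw l n (0 : X ⟶ Y) = 0 := by
  have := pw_smul l (0 : ℂ) n (0 : X ⟶ Y)
  rwa [zero_smul, zero_smul] at this

theorem pw_mem {p : ZMod 2} : ∀ (n : ℕ) {X Y : Word} {f : X ⟶ Y}, f ∈ homPiece p X Y →
    pw l n f ∈ homPiece p (pile l n X) (pile l n Y)
  | 0, _, _, _, hf => hf
  | n + 1, _, _, f, hf => pw_mem n (f := lw l f) (by
      obtain ⟨f, hf, rfl⟩ := hf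
      exact ⟨.id _ ⊠ f, by simpa using Diag.HasParity.tensor (.id _) hf, rfl⟩)

instance (f : X ⟶ Y) [hf : IsEven f] (n : ℕ) : IsEven (pw l n f) := ⟨pw_mem l n hf.mem⟩

end

/-- The data of crossings between strands `l` and strands `Z`. -/
structure Crossing (l Z : Letter) where
  /-- crossing of two strands `l` -/
  s (W : Word) : FreeAddMonoid.of l + (FreeAddMonoid.of l + W) ⟶
    FreeAddMonoid.of l + (FreeAddMonoid.of l + W)
  /-- crossing of two strands `Z` -/
  t (W : Word) : FreeAddMonoid.of Z + (FreeAddMonoid.of Z + W) ⟶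
    FreeAddMonoid.of Z + (FreeAddMonoid.of Z + W)
  /-- crossing of a strand `l` with a strand `Z` -/
  r (W : Word) : FreeAddMonoid.of l + (FreeAddMonoid.of Z + W) ⟶
    FreeAddMonoid.of Z + (FreeAddMonoid.of l + W)
  /-- crossing of a strand `Z` with a strand `l` -/
  r' (W : Word) : FreeAddMonoid.of Z + (FreeAddMonoid.of l + W) ⟶
    FreeAddMonoid.of l + (FreeAddMonoid.of Z + W)
  s_even (W : Word) : IsEven (s W)
  t_even (W : Word) : IsEven (t W)
  r_even (W : Word) : IsEven (r W)
  r'_even (W : Word) : IsEven (r' W)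
  s_natural {W W' : Word} (f : W ⟶ W') : lw l (lw l f) ≫ s W' = s W ≫ lw l (lw l f)
  t_natural {W W' : Word} (f : W ⟶ W') : lw Z (lw Z f) ≫ t W' = t W ≫ lw Z (lw Z f)
  r_natural {W W' : Word} (f : W ⟶ W') : lw l (lw Z f) ≫ r W' = r W ≫ lw Z (lw l f)
  r'_natural {W W' : Word} (f : W ⟶ W') : lw Z (lw l f) ≫ r' W' = r' W ≫ lw l (lw Z f)
  -- Only this composite is required to be the identity. For an upward and a downward strand the
  -- other composite is not, and its defect is what the commutator measures.
  r_r' (W : Word) : r W ≫ r' W = 𝟙 _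
  slide (W : Word) : s (FreeAddMonoid.of Z + W) ≫ lw l (r W) ≫ r (FreeAddMonoid.of l + W) =
    lw l (r W) ≫ r (FreeAddMonoid.of l + W) ≫ lw Z (s W)
  triple (W : Word) : lw Z (r W) ≫ t (FreeAddMonoid.of l + W) ≫ lw Z (r' W) =
    r' (FreeAddMonoid.of Z + W) ≫ lw l (t W) ≫ r (FreeAddMonoid.of Z + W)

attribute [instance] Crossing.s_even Crossing.t_even Crossing.r_even Crossing.r'_even

/-- The cycle on `n` strands built from a crossing. -/
def cyc {l : Letter} (s : ∀ W : Word, FreeAddMonoid.of l + (FreeAddMonoid.of l + W) ⟶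
    FreeAddMonoid.of l + (FreeAddMonoid.of l + W)) (W : Word) :
    ∀ n : ℕ, bundle l n W ⟶ bundle l n W
  | 0 => 𝟙 _
  | 1 => 𝟙 _
  | n + 2 => lw l (cyc s W (n + 1)) ≫ s (bundle l n W)

/-- The cycle on `n` strands, built from the right. -/
def pcyc {l : Letter} (s : ∀ W : Word, FreeAddMonoid.of l + (FreeAddMonoid.of l + W) ⟶
    FreeAddMonoid.of l + (FreeAddMonoid.of l + W)) :
    ∀ (n : ℕ) (W : Word), pile l n W ⟶ pile l n W
  | 0, _ => 𝟙 _
  | 1, _ => 𝟙 _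
  | n + 2, W => pw l n (s W) ≫ pcyc s (n + 1) (FreeAddMonoid.of l + W)

section

variable {l : Letter} {s : ∀ W : Word, FreeAddMonoid.of l + (FreeAddMonoid.of l + W) ⟶
    FreeAddMonoid.of l + (FreeAddMonoid.of l + W)}

theorem cyc_even (hs : ∀ W, IsEven (s W)) (W : Word) : ∀ n : ℕ, IsEven (cyc s W n)
  | 0 => inferInstanceAs (IsEven (𝟙 _))
  | 1 => inferInstanceAs (IsEven (𝟙 _))
  | n + 2 => by
    have := cyc_even hs W (n + 1)
    exact inferInstanceAs (IsEven (lw l (cyc s W (n + 1)) ≫ s (bundle l n W)))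

theorem pcyc_even (hs : ∀ W, IsEven (s W)) : ∀ (n : ℕ) (W : Word), IsEven (pcyc s n W)
  | 0, _ => inferInstanceAs (IsEven (𝟙 _))
  | 1, _ => inferInstanceAs (IsEven (𝟙 _))
  | n + 2, W => by
    have := pcyc_even hs (n + 1) (FreeAddMonoid.of l + W)
    exact inferInstanceAs (IsEven (pw l n (s W) ≫ pcyc s (n + 1) (FreeAddMonoid.of l + W)))

theorem cyc_natural (hs : ∀ {W W' : Word} (f : W ⟶ W'),
    lw l (lw l f) ≫ s W' = s W ≫ lw l (lw l f)) {W W' : Word} (f : W ⟶ W') :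
    ∀ n : ℕ, bw l n f ≫ cyc s W' n = cyc s W n ≫ bw l n f
  | 0 => (Category.comp_id _).trans (Category.id_comp _).symm
  | 1 => (Category.comp_id _).trans (Category.id_comp _).symm
  | n + 2 => by
    have ih := cyc_natural hs f (n + 1)
    change lw l (bw l (n + 1) f) ≫ lw l (cyc s W' (n + 1)) ≫ s (bundle l n W') =
      (lw l (cyc s W (n + 1)) ≫ s (bundle l n W)) ≫ lw l (lw l (bw l n f))
    rw [← reassoc_of% (lw_comp l), ih, Category.assoc, ← hs, lw_comp, Category.assoc]
    rfl

theorem pcyc_natural (hs : ∀ {W W' : Word} (f : W ⟶ W'),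
    lw l (lw l f) ≫ s W' = s W ≫ lw l (lw l f)) :
    ∀ (n : ℕ) {W W' : Word} (f : W ⟶ W'), pw l n f ≫ pcyc s n W' = pcyc s n W ≫ pw l n f
  | 0, _, _, _ => (Category.comp_id _).trans (Category.id_comp _).symm
  | 1, _, _, _ => (Category.comp_id _).trans (Category.id_comp _).symm
  | n + 2, W, W', f => by
    have ih := pcyc_natural hs (n + 1) (lw l f)
    change pw l n (lw l (lw l f)) ≫ pw l n (s W') ≫ pcyc s (n + 1) _ =
      (pw l n (s W) ≫ pcyc s (n + 1) _) ≫ pw l (n + 1) (lw l f)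
    rw [← reassoc_of% (pw_comp l n), hs, Category.assoc, ← ih, pw_comp, Category.assoc]
    rfl

end

end

end TwistedHeis

namespace TwistedHeis

noncomputable section

open CategoryTheory

/-! ## Moving strands through a bundle -/

namespace Crossing

variable {l Z : Letter} (c : Crossing l Z)

/-- A bundle of strands `l` crosses a strand `Z` from left to right. -/
def bR (W : Word) : ∀ n : ℕ,
    bundle l n (FreeAddMonoid.of Z + W) ⟶ FreeAddMonoid.of Z + bundle l n W
  | 0 => 𝟙 _
  | n + 1 => lw l (bR W n) ≫ c.r (bundle l n W)

/-- A bundle of strands `l` crosses a strand `Z` from right to left. -/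
def bL (W : Word) : ∀ n : ℕ,
    FreeAddMonoid.of Z + bundle l n W ⟶ bundle l n (FreeAddMonoid.of Z + W)
  | 0 => 𝟙 _
  | n + 1 => c.r' (bundle l n W) ≫ lw l (bL W n)

instance bR_even (W : Word) : ∀ n : ℕ, IsEven (c.bR W n)
  | 0 => inferInstanceAs (IsEven (𝟙 _))
  | n + 1 => by
    have := bR_even W n
    exact inferInstanceAs (IsEven (lw l (c.bR W n) ≫ c.r (bundle l n W)))

instance bL_even (W : Word) : ∀ n : ℕ, IsEven (c.bL W n)
  | 0 => inferInstanceAs (IsEven (𝟙 _))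
  | n + 1 => by
    have := bL_even W n
    exact inferInstanceAs (IsEven (c.r' (bundle l n W) ≫ lw l (c.bL W n)))

theorem bR_bL (W : Word) : ∀ n : ℕ, c.bR W n ≫ c.bL W n = 𝟙 _
  | 0 => Category.comp_id _
  | n + 1 => by
    have ih := bR_bL W n
    change (lw l (c.bR W n) ≫ c.r (bundle l n W)) ≫ c.r' (bundle l n W) ≫ lw l (c.bL W n) = 𝟙 _
    rw [Category.assoc, reassoc_of% (c.r_r' (bundle l n W)), ← lw_comp, ih, lw_id]

theorem bL_natural {W W' : Word} (f : W ⟶ W') : ∀ n : ℕ,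
    lw Z (bw l n f) ≫ c.bL W' n = c.bL W n ≫ bw l n (lw Z f)
  | 0 => (Category.comp_id _).trans (Category.id_comp _).symm
  | n + 1 => by
    have ih := bL_natural f n
    change lw Z (lw l (bw l n f)) ≫ c.r' (bundle l n W') ≫ lw l (c.bL W' n) =
      (c.r' (bundle l n W) ≫ lw l (c.bL W n)) ≫ lw l (bw l n (lw Z f))
    rw [reassoc_of% (c.r'_natural (bw l n f)), ← lw_comp, ih, lw_comp, Category.assoc]

theorem cyc_bR (W : Word) : ∀ n : ℕ,
    cyc c.s (FreeAddMonoid.of Z + W) n ≫ c.bR W n = c.bR W n ≫ lw Z (cyc c.s W n)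
  | 0 => (Category.id_comp _).trans ((Category.comp_id _).symm.trans
      (congrArg (c.bR W 0 ≫ ·) (lw_id Z _).symm))
  | 1 => (Category.id_comp _).trans ((Category.comp_id _).symm.trans
      (congrArg (c.bR W 1 ≫ ·) (lw_id Z _).symm))
  | n + 2 => by
    have ih := cyc_bR W (n + 1)
    change (lw l (cyc c.s _ (n + 1)) ≫ c.s (bundle l n _)) ≫
      lw l (lw l (c.bR W n) ≫ c.r (bundle l n W)) ≫ c.r (FreeAddMonoid.of l + bundle l n W) =
      (lw l (c.bR W (n + 1)) ≫ c.r (FreeAddMonoid.of l + bundle l n W)) ≫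
        lw Z (lw l (cyc c.s W (n + 1)) ≫ c.s (bundle l n W))
    rw [lw_comp, lw_comp, Category.assoc, Category.assoc, ← reassoc_of% (c.s_natural (c.bR W n)),
      c.slide, Category.assoc, ← reassoc_of% (c.r_natural (cyc c.s W (n + 1))),
      ← reassoc_of% (lw_comp l), ← reassoc_of% (lw_comp l), ← reassoc_of% (lw_comp l)]
    change lw l ((cyc c.s _ (n + 1) ≫ lw l (c.bR W n)) ≫ c.r (bundle l n W)) ≫ _ =
      lw l ((lw l (c.bR W n) ≫ c.r (bundle l n W)) ≫ _) ≫ _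
    rw [Category.assoc]
    exact congrArg (fun f => lw l f ≫ _) ih

theorem bundle_triple (W : Word) : ∀ n : ℕ,
    lw Z (c.bR W n) ≫ c.t (bundle l n W) ≫ lw Z (c.bL W n) =
      c.bL (FreeAddMonoid.of Z + W) n ≫ bw l n (c.t W) ≫ c.bR (FreeAddMonoid.of Z + W) n
  | 0 => by
    change lw Z (𝟙 _) ≫ c.t W ≫ lw Z (𝟙 _) = 𝟙 _ ≫ c.t W ≫ 𝟙 _
    rw [lw_id, Category.id_comp, Category.comp_id]
  | n + 1 => by
    have ih := bundle_triple W n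
    change lw Z (lw l (c.bR W n) ≫ c.r (bundle l n W)) ≫ c.t (FreeAddMonoid.of l + bundle l n W) ≫
      lw Z (c.r' (bundle l n W) ≫ lw l (c.bL W n)) =
      (c.r' (bundle l n (FreeAddMonoid.of Z + W)) ≫ lw l (c.bL (FreeAddMonoid.of Z + W) n)) ≫
        lw l (bw l n (c.t W)) ≫ lw l (c.bR (FreeAddMonoid.of Z + W) n) ≫
          c.r (bundle l n (FreeAddMonoid.of Z + W))
    rw [lw_comp, lw_comp, Category.assoc, reassoc_of% (c.triple (bundle l n W)),
      reassoc_of% (c.r'_natural (c.bR W n)), ← c.r_natural, Category.assoc,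
      ← reassoc_of% (lw_comp l (c.t _)), ← reassoc_of% (lw_comp l (lw Z (c.bR W n))), ih]
    simp only [lw_comp, Category.assoc]

instance cyc_even (W : Word) (n : ℕ) : IsEven (cyc c.s W n) := TwistedHeis.cyc_even c.s_even W n
instance cyc_even' (W : Word) (n : ℕ) : IsEven (cyc c.t W n) := TwistedHeis.cyc_even c.t_even W n
instance pcyc_even (W : Word) (n : ℕ) : IsEven (pcyc c.t n W) :=
  TwistedHeis.pcyc_even c.t_even n W

theorem pcyc_natural (m : ℕ) {W W' : Word} (f : W ⟶ W') :
    pw Z m f ≫ pcyc c.t m W' = pcyc c.t m W ≫ pw Z m f :=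
  TwistedHeis.pcyc_natural c.t_natural m f

/-- After `bundle_triple` the crossing `t` lies on the far side of the bundle, where it extends the
cycle of the strands already moved from length `j + 1` to length `j + 2`. -/
theorem bw_cyc_bL (n j : ℕ) (W : Word) :
    lw Z (bw l n (cyc c.t W (j + 1)) ≫ cyc c.s (bundle Z (j + 1) W) n) ≫
      lw Z (c.bR (bundle Z j W) n) ≫ c.t _ ≫ lw Z (c.bL (bundle Z j W) n) =
      lw Z (cyc c.s (bundle Z (j + 1) W) n) ≫ c.bL (bundle Z (j + 1) W) n ≫
        bw l n (cyc c.t W (j + 2)) ≫ c.bR (bundle Z (j + 1) W) n := by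
  have hc : cyc c.t W (j + 2) = lw Z (cyc c.t W (j + 1)) ≫ c.t (bundle Z j W) := rfl
  rw [c.bundle_triple, cyc_natural c.s_natural, lw_comp, Category.assoc,
    reassoc_of% (c.bL_natural (cyc c.t W (j + 1))), hc, bw_comp, Category.assoc]

/-- One strand passes through the bundle: the crossing `t` joins the cycle on the right by
`bw_cyc_bL`, and cyclicity of the trace together with naturality carries `bL` around to the other
end of the diagram. -/
theorem tr_rotate (n k j : ℕ) (W : Word) :
    tr (pw Z k (lw Z (bw l n (cyc c.t W (j + 1)) ≫ cyc c.s (bundle Z (j + 1) W) n) ≫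
      lw Z (c.bR (bundle Z j W) n) ≫ c.t _ ≫ lw Z (c.bL (bundle Z j W) n)) ≫
      pcyc c.t (k + 1) (bundle l n (bundle Z (j + 1) W))) =
    tr (pw Z k (bw l n (cyc c.t W (j + 2)) ≫ cyc c.s (bundle Z (j + 2) W) n ≫
        c.bR (bundle Z (j + 1) W) n) ≫
        pcyc c.t (k + 1) (bundle l n (bundle Z (j + 1) W)) ≫
          pw Z k (c.bL (bundle Z (j + 1) W) n)) := by
  have h₁ := c.pcyc_natural (k + 1) (cyc c.s (bundle Z (j + 1) W) n)
  change pw Z k (lw Z _) ≫ _ = _ ≫ pw Z k (lw Z _) at h₁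
  rw [c.bw_cyc_bL, pw_comp, Category.assoc, tr_comm, Category.assoc, ← h₁,
    ← reassoc_of% (pw_comp Z k), Category.assoc, Category.assoc, ← c.cyc_bR, pw_comp,
    Category.assoc, tr_comm, Category.assoc]

/-- In the trace, the strands `Z` that form a cycle can be moved one by one through the
bundle of strands `l`. -/
theorem tr_partial (n : ℕ) (W : Word) : ∀ (k j N : ℕ), N = k + j + 2 →
    tr (pw Z k (lw Z (bw l n (cyc c.t W (j + 1)) ≫ cyc c.s (bundle Z (j + 1) W) n) ≫
      lw Z (c.bR (bundle Z j W) n) ≫ c.t _ ≫ lw Z (c.bL (bundle Z j W) n)) ≫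
      pcyc c.t (k + 1) (bundle l n (bundle Z (j + 1) W))) =
    tr (bw l n (cyc c.t W N) ≫ cyc c.s (bundle Z N W) n)
  | 0, j, N, hN => by
    obtain rfl : N = j + 2 := by omega
    rw [tr_rotate]
    change tr ((bw l n _ ≫ _ ≫ c.bR _ n) ≫ 𝟙 _ ≫ c.bL _ n) = _
    rw [Category.id_comp, Category.assoc, Category.assoc, c.bR_bL, Category.comp_id]
  | k + 1, j, N, hN => by
    rw [tr_rotate, ← tr_partial n W k (j + 1) N (by omega)]
    -- The `bL` that was carried around moves past the remaining cycle and stops after its next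
    -- crossing `t`. Now `t` sits between `bR` and `bL`, which is the original pattern with one
    -- strand fewer on the left and one more on the right.
    have h := c.pcyc_natural (k + 1) (c.bL (bundle Z (j + 1) W) n)
    have hp : pcyc c.t (k + 2) (bundle l n (bundle Z (j + 1) W)) =
      pw Z k (c.t _) ≫ pcyc c.t (k + 1) _ := rfl
    rw [hp, Category.assoc, ← h]
    change tr (pw Z k (lw Z _) ≫ pw Z k _ ≫ pw Z k (lw Z _) ≫ _) = _
    rw [← reassoc_of% (pw_comp Z k), ← reassoc_of% (pw_comp Z k)]
    simp only [lw_comp, Category.assoc]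

/-- The identity on the innermost strand `Z` and the bundle is replaced by the double crossing `bL ≫
bR`, at the price of the last summand. Once this is in place the whole cycle can be dragged through,
since the remaining moves use only `bR ≫ bL = 𝟙` and the triple crossing moves. -/
theorem tr_pcyc_cyc (n : ℕ) (W : Word) : ∀ m : ℕ,
    tr (pcyc c.t (m + 1) (bundle l n W) ≫ pw Z (m + 1) (cyc c.s W n)) =
    tr (bw l n (cyc c.t W (m + 1)) ≫ cyc c.s (bundle Z (m + 1) W) n) +
    tr (pcyc c.t (m + 1) (bundle l n W) ≫ pw Z (m + 1) (cyc c.s W n) ≫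
      pw Z m (𝟙 _ - c.bL W n ≫ c.bR W n)) := by
  intro m
  have h₁ : tr (pcyc c.t (m + 1) (bundle l n W) ≫ pw Z (m + 1) (cyc c.s W n)) =
      tr (pcyc c.t (m + 1) (bundle l n W) ≫ pw Z (m + 1) (cyc c.s W n) ≫
        pw Z m (c.bL W n ≫ c.bR W n)) +
      tr (pcyc c.t (m + 1) (bundle l n W) ≫ pw Z (m + 1) (cyc c.s W n) ≫
        pw Z m (𝟙 _ - c.bL W n ≫ c.bR W n)) := by
    rw [← tr_add]
    congr 1
    rw [← Preadditive.comp_add, ← Preadditive.comp_add, ← pw_add, add_sub_cancel, pw_id]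
    exact congrArg _ (Category.comp_id _).symm
  rw [h₁]
  congr 1
  rw [← reassoc_of% (c.pcyc_natural (m + 1) (cyc c.s W n))]
  cases m with
  | zero =>
    change tr (lw Z _ ≫ 𝟙 _ ≫ c.bL W n ≫ c.bR W n) = tr (bw l n (𝟙 _) ≫ _)
    rw [Category.id_comp, bw_id, Category.id_comp, ← Category.assoc, tr_comm, ← reassoc_of% (c.cyc_bR W n),
      c.bR_bL, Category.comp_id]
  | succ k =>
    rw [← c.tr_partial n W k 0 (k + 2) rfl]
    have h := c.pcyc_natural (k + 1) (c.bL W n)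
    have hp : pcyc c.t (k + 2) (bundle l n W) = pw Z k (c.t _) ≫ pcyc c.t (k + 1) _ := rfl
    rw [hp, pw_comp, Category.assoc, ← reassoc_of% h, ← Category.assoc, ← Category.assoc,
      ← Category.assoc, tr_comm]
    change tr (pw Z k (lw Z _) ≫ ((pw Z k (lw Z (lw Z (cyc c.s W n))) ≫ _) ≫ pw Z k (lw Z _)) ≫ _) =
      tr (pw Z k (lw Z (bw l n (𝟙 _) ≫ cyc c.s (FreeAddMonoid.of Z + W) n) ≫
        lw Z (c.bR W n) ≫ _ ≫ lw Z (c.bL W n)) ≫ _)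
    simp only [Category.assoc]
    rw [bw_id, Category.id_comp, ← reassoc_of% (pw_comp Z k), ← lw_comp, ← c.cyc_bR]
    simp only [pw_comp, lw_comp, Category.assoc]

end Crossing

end

end TwistedHeis

namespace TwistedHeis

noncomputable section

open CategoryTheory

/-! ## Products of cycles in the even trace -/

section

variable {l : Letter} {X Y X' Y' : Word}

theorem strands_add (l : Letter) (W : Word) : ∀ n : ℕ, strands l n + W = bundle l n W
  | 0 => zero_add W
  | n + 1 => by
    change FreeAddMonoid.of l + strands l n + W = FreeAddMonoid.of l + bundle l n W
    rw [add_assoc, strands_add l W n]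

/-- The recursion of `bundle` exposes the leftmost strand, that of `pile` the rightmost one next to
`W`. Both are needed: the moved cycle is consumed from the right and rebuilt from the left. They are
compared only under the trace, through heterogeneous equality. -/
theorem pile_eq_bundle (l : Letter) : ∀ (n : ℕ) (W : Word), pile l n W = bundle l n W
  | 0, _ => rfl
  | n + 1, W => (pile_eq_bundle l n _).trans (bundle_succ n W)
where
  bundle_succ : ∀ (n : ℕ) (W : Word),
      bundle l n (FreeAddMonoid.of l + W) = FreeAddMonoid.of l + bundle l n W
    | 0, _ => rfl
    | n + 1, W => congrArg (FreeAddMonoid.of l + ·) (bundle_succ n W)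

theorem lw_heq (hX : X = X') (hY : Y = Y') {f : X ⟶ Y} {f' : X' ⟶ Y'} (hf : HEq f f') :
    HEq (lw l f) (lw l f') := by
  subst hX hY; rw [eq_of_heq hf]

theorem bw_lw_heq (f : X ⟶ Y) : ∀ n : ℕ, HEq (bw l n (lw l f)) (lw l (bw l n f))
  | 0 => HEq.rfl
  | n + 1 => lw_heq (pile_eq_bundle.bundle_succ l n X) (pile_eq_bundle.bundle_succ l n Y)
      (bw_lw_heq f n)

theorem pw_heq : ∀ (n : ℕ) {X Y : Word} (f : X ⟶ Y), HEq (pw l n f) (bw l n f)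
  | 0, _, _, _ => HEq.rfl
  | n + 1, _, _, f => (pw_heq n (lw l f)).trans (bw_lw_heq f n)

theorem tensor_strands_heq (f : X ⟶ Y) : ∀ n : ℕ,
    HEq (Hom.tensor (Hom.id (strands l n)) f) (bw l n f)
  | 0 => Hom.unit_tensor_heq f
  | n + 1 => by
    change HEq (Hom.tensor (Hom.id (FreeAddMonoid.of l + strands l n)) f) (lw l (bw l n f))
    rw [← Hom.id_tensor_id]
    exact (Hom.tensor_tensor_heq _ _ _).trans
      (lw_heq (strands_add l X n) (strands_add l Y n) (tensor_strands_heq f n))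

variable {s₀ : Diag (FreeAddMonoid.of l + FreeAddMonoid.of l)
    (FreeAddMonoid.of l + FreeAddMonoid.of l)}
  {s : ∀ W : Word, FreeAddMonoid.of l + (FreeAddMonoid.of l + W) ⟶
    FreeAddMonoid.of l + (FreeAddMonoid.of l + W)}

theorem cycle_heq (hs : ∀ W, HEq (onTail (Hom.mk s₀) W) (s W)) (W : Word) : ∀ n : ℕ,
    HEq (onTail (Hom.mk (cycle s₀ n)) W) (cyc s W n)
  | 0 => Hom.unit_tensor_heq (Hom.id W)
  | 1 => heq_of_eq (Hom.id_tensor_id (FreeAddMonoid.of l) W)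
  | n + 2 => by
    have hw := strands_add l W (n + 2)
    refine onTail_mk_comp W _ _ hw hw hw ?_ ?_
    · exact (Hom.tensor_tensor_heq _ _ _).trans
        (lw_heq (strands_add l W (n + 1)) (strands_add l W (n + 1)) (cycle_heq hs W (n + 1)))
    · refine (onTail_tensor_right W (strands l n) (Hom.mk s₀)).trans ?_
      rw [strands_add]
      exact hs _

theorem s_heq (s : ∀ W : Word, FreeAddMonoid.of l + (FreeAddMonoid.of l + W) ⟶
    FreeAddMonoid.of l + (FreeAddMonoid.of l + W)) {W W' : Word} (h : W = W') :
    HEq (s W) (s W') := by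
  subst h; rfl

/-- The recursion of `cyc` peels off the crossing at the left end; here the crossing at the right
end is peeled off instead, which is the recursion of `pcyc`. -/
theorem cyc_succ_heq (W : Word) : ∀ (n : ℕ)
    (h : bundle l n (FreeAddMonoid.of l + (FreeAddMonoid.of l + W)) =
      bundle l (n + 1) (FreeAddMonoid.of l + W)),
    HEq ((Hom.cast h h (bw l n (s W)) : _ ⟶ _) ≫ cyc s (FreeAddMonoid.of l + W) (n + 1))
      (cyc s W (n + 2))
  | 0, _ => heq_of_eq ((Category.comp_id _).trans
      ((Category.id_comp _).symm.trans (congrArg (· ≫ s W) (lw_id l _).symm)))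
  | n + 1, h => by
    have hb := pile_eq_bundle.bundle_succ l n W
    have h₁ := pile_eq_bundle.bundle_succ l n (FreeAddMonoid.of l + W)
    have h₂ := pile_eq_bundle.bundle_succ l (n + 1) W
    have hc : (Hom.cast h h (bw l (n + 1) (s W)) : _ ⟶ _) =
        lw l (Hom.cast h₁ h₁ (bw l n (s W)) : _ ⟶ _) := by
      refine eq_of_heq ((Hom.cast_heq h h (bw l (n + 1) (s W))).trans ?_)
      exact lw_heq h₁ h₁ (Hom.cast_heq h₁ h₁ (bw l n (s W))).symm
    rw [hc]
    change HEq (lw l _ ≫ lw l (cyc s (FreeAddMonoid.of l + W) (n + 1)) ≫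
      s (bundle l n (FreeAddMonoid.of l + W))) (lw l (cyc s W (n + 2)) ≫ s (bundle l (n + 1) W))
    rw [← Category.assoc, ← lw_comp]
    have h₃ := congrArg (FreeAddMonoid.of l + ·) h₂
    exact comp_congr_of_heq h₃ h₃ h₃ (lw_heq h₂ h₂ (cyc_succ_heq W n h₁)) (s_heq s hb)

theorem pcyc_heq : ∀ (n : ℕ) (W : Word), HEq (pcyc s n W) (cyc s W n)
  | 0, _ => HEq.rfl
  | 1, _ => HEq.rfl
  | n + 2, W => by
    have h₃ := pile_eq_bundle.bundle_succ l n (FreeAddMonoid.of l + W)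
    refine HEq.trans ?_ (cyc_succ_heq W n h₃)
    have h₂ := pile_eq_bundle l (n + 1) (FreeAddMonoid.of l + W)
    exact comp_congr_of_heq h₂ h₂ h₂ ((pw_heq n (s W)).trans (Hom.cast_heq _ _ _).symm)
      (pcyc_heq (n + 1) _)

theorem tr_mk_cycle (hs : ∀ W, HEq (onTail (Hom.mk s₀) W) (s W)) (n : ℕ) :
    tr (X := strands l n) (Hom.mk (cycle s₀ n)) = tr (cyc s 0 n) :=
  tr_congr_heq ((add_zero _).symm.trans (strands_add l 0 n))
    ((Hom.tensor_unit_heq _).symm.trans (cycle_heq hs 0 n))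

theorem tr_cyc_mul_tr (hs : ∀ W, HEq (onTail (Hom.mk s₀) W) (s W)) (hs₀ : s₀.HasParity 0) (n : ℕ)
    (f : X ⟶ X) [hf : IsEven f] : tr (cyc s 0 n) * tr f = tr (cyc s X n ≫ bw l n f) := by
  have he : IsEven (X := strands l n) (Y := strands l n) (Hom.mk (cycle s₀ n)) :=
    ⟨_, cycle_even hs₀ n, rfl⟩
  rw [← tr_mk_cycle hs, tr_mul_tr]
  have h : Hom.tensor (Hom.mk (cycle s₀ n)) f =
      onTail (Hom.mk (cycle s₀ n)) X ≫ Hom.tensor (Hom.id (strands l n)) f := by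
    refine Eq.trans ?_ (Hom.interchange_left he.mem _ _ _).symm
    rw [Hom.comp_id, Hom.id_comp]
  rw [h]
  have hw := strands_add l X n
  exact tr_congr_heq hw (comp_congr_of_heq hw hw hw (cycle_heq hs X n) (tensor_strands_heq f n))

theorem tr_pcyc_mul_tr (hs : ∀ W, HEq (onTail (Hom.mk s₀) W) (s W)) (hs₀ : s₀.HasParity 0) (n : ℕ)
    (f : X ⟶ X) [hf : IsEven f] : tr (cyc s 0 n) * tr f = tr (pcyc s n X ≫ pw l n f) := by
  rw [tr_cyc_mul_tr hs hs₀]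
  have hw := (pile_eq_bundle l n X).symm
  exact tr_congr_heq hw (comp_congr_of_heq hw hw hw (pcyc_heq n X).symm (pw_heq n f).symm)

end

namespace Crossing

variable {l Z : Letter} (c : Crossing l Z)
  {s₀ : Diag (FreeAddMonoid.of l + FreeAddMonoid.of l)
    (FreeAddMonoid.of l + FreeAddMonoid.of l)}
  {t₀ : Diag (FreeAddMonoid.of Z + FreeAddMonoid.of Z)
    (FreeAddMonoid.of Z + FreeAddMonoid.of Z)}

/-- The commutator of two cycles in the even trace. -/
theorem cyc_mul_cyc (hs : ∀ W, HEq (onTail (Hom.mk s₀) W) (c.s W)) (hs₀ : s₀.HasParity 0)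
    (ht : ∀ W, HEq (onTail (Hom.mk t₀) W) (c.t W)) (ht₀ : t₀.HasParity 0) (m n : ℕ) :
    tr (cyc c.t 0 (m + 1)) * tr (cyc c.s 0 n) = tr (cyc c.s 0 n) * tr (cyc c.t 0 (m + 1)) +
      tr (pcyc c.t (m + 1) (bundle l n 0) ≫ pw Z (m + 1) (cyc c.s 0 n) ≫
        pw Z m (𝟙 _ - c.bL 0 n ≫ c.bR 0 n)) := by
  rw [tr_pcyc_mul_tr ht ht₀, tr_cyc_mul_tr hs hs₀, c.tr_pcyc_cyc, cyc_natural c.s_natural]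

theorem bL_bR_of_r'_r (h : ∀ W, c.r' W ≫ c.r W = 𝟙 _) (W : Word) : ∀ n : ℕ,
    c.bL W n ≫ c.bR W n = 𝟙 _
  | 0 => Category.comp_id _
  | n + 1 => by
    have ih := bL_bR_of_r'_r h W n
    change (c.r' (bundle l n W) ≫ lw l (c.bL W n)) ≫ lw l (c.bR W n) ≫ c.r (bundle l n W) = 𝟙 _
    rw [Category.assoc, ← reassoc_of% (lw_comp l), ih, lw_id, Category.id_comp, h]

theorem cyc_comm_cyc (h : ∀ W, c.r' W ≫ c.r W = 𝟙 _)
    (hs : ∀ W, HEq (onTail (Hom.mk s₀) W) (c.s W)) (hs₀ : s₀.HasParity 0)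
    (ht : ∀ W, HEq (onTail (Hom.mk t₀) W) (c.t W)) (ht₀ : t₀.HasParity 0) (m n : ℕ) :
    tr (cyc c.t 0 (m + 1)) * tr (cyc c.s 0 n) = tr (cyc c.s 0 n) * tr (cyc c.t 0 (m + 1)) := by
  rw [c.cyc_mul_cyc hs hs₀ ht ht₀, c.bL_bR_of_r'_r h, sub_self, pw_zero, Limits.comp_zero,
    Limits.comp_zero, tr_zero, add_zero]

end Crossing

/-- Two upward strands. -/
def upUp : Crossing .P .P where
  s := xUp
  t := xUp
  r := xUp
  r' := xUp
  s_even _ := inferInstance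
  t_even _ := inferInstance
  r_even _ := inferInstance
  r'_even _ := inferInstance
  s_natural := xUp_natural
  t_natural := xUp_natural
  r_natural := xUp_natural
  r'_natural := xUp_natural
  r_r' := xUp_xUp
  slide := xUp_braid
  triple W := (xUp_braid W).symm

/-- Two downward strands. -/
def downDown : Crossing .Q .Q where
  s := xDown
  t := xDown
  r := xDown
  r' := xDown
  s_even _ := inferInstance
  t_even _ := inferInstance
  r_even _ := inferInstance
  r'_even _ := inferInstance
  s_natural := xDown_natural
  t_natural := xDown_natural
  r_natural := xDown_natural
  r'_natural := xDown_natural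
  r_r' := xDown_xDown
  slide := xDown_braid
  triple W := (xDown_braid W).symm

/-- An upward strand and a downward strand. -/
def upDown : Crossing .P .Q where
  s := xUp
  t := xDown
  r := xRight
  r' := xLeft
  s_even _ := inferInstance
  t_even _ := inferInstance
  r_even _ := inferInstance
  r'_even _ := inferInstance
  s_natural := xUp_natural
  t_natural := xDown_natural
  r_natural := xRight_natural
  r'_natural := xLeft_natural
  r_r' := xRight_xLeft
  slide := xUp_xRight_xRight
  triple := xRight_xDown_xLeft

theorem h_natCast (n : ℕ) : h (n : ℤ) = tr (cyc xUp 0 n) := by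
  rw [← tr_mk_cycle (s := xUp) (s₀ := .cross) (fun W => HEq.rfl)]
  exact (tr_of_mem (X := strands .P n) ⟨_, cycle_even (.gen .cross) n, rfl⟩).symm

theorem h_neg_natCast_succ (n : ℕ) : h (-(n + 1 : ℕ)) = tr (cyc xDown 0 (n + 1)) := by
  rw [← tr_mk_cycle (s₀ := .crossDown) (fun W => heq_of_eq (onTail_crossDown W))]
  exact (tr_of_mem (X := strands .Q (n + 1)) ⟨_, cycle_even crossDown_even (n + 1), rfl⟩).symm

theorem h_pos_comm (m n : ℕ) : h (m + 1 : ℕ) * h n = h n * h (m + 1 : ℕ) := by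
  rw [h_natCast, h_natCast]
  exact upUp.cyc_comm_cyc xUp_xUp (s₀ := .cross) (t₀ := .cross) (fun _ => HEq.rfl) (.gen .cross)
    (fun _ => HEq.rfl) (.gen .cross) m n

theorem h_neg_comm (m n : ℕ) :
    h (-(m + 1 : ℕ)) * h (-(n + 1 : ℕ)) = h (-(n + 1 : ℕ)) * h (-(m + 1 : ℕ)) := by
  rw [h_neg_natCast_succ, h_neg_natCast_succ]
  exact downDown.cyc_comm_cyc xDown_xDown (s₀ := .crossDown) (t₀ := .crossDown)
    (fun W => heq_of_eq (onTail_crossDown W)) crossDown_even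
    (fun W => heq_of_eq (onTail_crossDown W)) crossDown_even m (n + 1)

theorem h_neg_mul_h_pos (m n : ℕ) : h (-(m + 1 : ℕ)) * h n = h n * h (-(m + 1 : ℕ)) +
    tr (pcyc xDown (m + 1) (bundle .P n 0) ≫ pw .Q (m + 1) (cyc xUp 0 n) ≫
        pw .Q m (𝟙 _ - upDown.bL 0 n ≫ upDown.bR 0 n)) := by
  rw [h_neg_natCast_succ, h_natCast]
  exact upDown.cyc_mul_cyc (s₀ := .cross) (t₀ := .crossDown) (fun _ => HEq.rfl) (.gen .cross)
    (fun W => heq_of_eq (onTail_crossDown W)) crossDown_even m n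

end

end TwistedHeis

namespace TwistedHeis

noncomputable section

open CategoryTheory

/-! ## The commutator of an upward and a downward cycle -/

/-- A family of endomorphisms of the leftmost upward strand: the plain strand or the hollow dot.
Exchanging the heights of two of them gives the factor `ζ`. -/
structure IsDot (p : ZMod 2) (ζ : ℂ) (δ : ∀ W : Word, P + W ⟶ P + W) : Prop where
  mem (W : Word) : δ W ∈ homPiece p (P + W) (P + W)
  mul_self (W : Word) : δ W ≫ δ W = 𝟙 _
  natural {W W' : Word} (f : W ⟶ W') [IsEven f] : 𝐏 f ≫ δ W' = δ W ≫ 𝐏 f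
  cross (W : Word) : δ (P + W) ≫ xUp W = xUp W ≫ 𝐏 (δ W)
  lw_cross (W : Word) : 𝐏 (δ W) ≫ xUp W = xUp W ≫ δ (P + W)
  exchange (W : Word) : 𝐏 (δ W) ≫ δ (P + W) = ζ • (δ (P + W) ≫ 𝐏 (δ W))

theorem isDot_id : IsDot 0 1 (fun W => 𝟙 (P + W)) where
  mem W := id_mem _
  mul_self W := Category.id_comp _
  natural f _ := (Category.comp_id _).trans (Category.id_comp _).symm
  cross W := by rw [lw_id, Category.id_comp]; exact (Category.comp_id _).symm
  lw_cross W := by rw [lw_id, Category.comp_id]; exact Category.id_comp _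
  exchange W := by rw [one_smul, lw_id]

theorem isDot_dotU : IsDot 1 (-1) dotU where
  mem W := ⟨Diag.dotUp ⊠ .id W,
    Diag.HasParity.tensor (p := 1) (q := 0) (.gen .dotUp) (.id W), rfl⟩
  mul_self := dotU_dotU
  natural f _ := dotU_natural f
  cross := dotU_xUp
  lw_cross := lw_dotU_xUp
  exchange W := by rw [dotU_dotU_anticomm, neg_one_smul, neg_neg]

/-- The endomorphism of `QPW` that caps and then cups off, decorated with `δ`. -/
def capCup (δ : ∀ W : Word, P + W ⟶ P + W) (W : Word) : Q + (P + W) ⟶ Q + (P + W) :=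
  (𝐐 (δ W) ≫ capL W) ≫ cupR W ≫ 𝐐 (δ W)

theorem comp_mem_of_even {p : ZMod 2} {X Y Z : Word} {f : X ⟶ Y} {g : Y ⟶ Z}
    (hf : f ∈ homPiece p X Y) [hg : IsEven g] : f ≫ g ∈ homPiece p X Z := by
  obtain ⟨f, hf, rfl⟩ := hf
  obtain ⟨⟨g, hg, rfl⟩⟩ := hg
  exact ⟨f ⟫ g, by simpa using Diag.HasParity.comp hf hg, rfl⟩

theorem even_comp_mem {p : ZMod 2} {X Y Z : Word} {f : X ⟶ Y} {g : Y ⟶ Z}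
    [hf : IsEven f] (hg : g ∈ homPiece p Y Z) : f ≫ g ∈ homPiece p X Z := by
  obtain ⟨⟨f, hf, rfl⟩⟩ := hf
  obtain ⟨g, hg, rfl⟩ := hg
  exact ⟨f ⟫ g, by simpa using Diag.HasParity.comp hf hg, rfl⟩

namespace IsDot

variable {p : ZMod 2} {ζ : ℂ} {δ : ∀ W : Word, P + W ⟶ P + W}

theorem cap_mem (hδ : IsDot p ζ δ) (W : Word) : 𝐐 (δ W) ≫ capL W ∈ homPiece p (Q + (P + W)) W :=
  comp_mem_of_even (pw_mem .Q 1 (hδ.mem W))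

theorem cup_mem (hδ : IsDot p ζ δ) (W : Word) : cupR W ≫ 𝐐 (δ W) ∈ homPiece p W (Q + (P + W)) :=
  even_comp_mem (pw_mem .Q 1 (hδ.mem W))

theorem capCup_even (hδ : IsDot p ζ δ) (W : Word) : IsEven (capCup δ W) :=
  ⟨comp_mem (hδ.cap_mem W) (hδ.cup_mem W)⟩

theorem capCup_natural (hδ : IsDot p ζ δ) {W W' : Word} (f : W ⟶ W') [IsEven f] :
    𝐐 (𝐏 f) ≫ capCup δ W' = capCup δ W ≫ 𝐐 (𝐏 f) := by
  have h := congrArg 𝐐 (hδ.natural f)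
  simp only [lw_comp] at h
  simp only [capCup, Category.assoc]
  rw [reassoc_of% h, reassoc_of% (capL_natural f), ← reassoc_of% (cupR_natural f), h]

/-- The decorated crossing equals the crossing decorated on its right strand. -/
theorem conj_cross (hδ : IsDot p ζ δ) (W : Word) : δ (P + W) ≫ xUp W ≫ δ (P + W) =
    ζ • (𝐏 (δ W) ≫ xUp W ≫ 𝐏 (δ W)) := by
  have h : 𝐏 (δ W) ≫ xUp W ≫ 𝐏 (δ W) = xUp W ≫ δ (P + W) ≫ 𝐏 (δ W) := by
    rw [reassoc_of% (hδ.lw_cross W)]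
  rw [h, reassoc_of% (hδ.cross W), hδ.exchange, Linear.comp_smul]

/-- The leftmost strand takes part only in the last crossing of the cycle. Hence the lower
decoration slides past the shorter cycle and `conj_cross` applies, moving both decorations one
strand to the right. -/
theorem conj_cyc (hδ : IsDot p ζ δ) (W : Word) (k : ℕ) :
    δ (bundle .P (k + 1) W) ≫ cyc xUp W (k + 2) ≫
    δ (bundle .P (k + 1) W) = ζ • (𝐏 (cyc xUp W (k + 1) ≫ δ (bundle .P k W)) ≫
      xUp (bundle .P k W) ≫ 𝐏 (δ (bundle .P k W))) := by
  have := cyc_even (s := xUp) inferInstance W (k + 1)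
  have h := hδ.natural (cyc xUp W (k + 1))
  have h' := hδ.conj_cross (bundle .P k W)
  change δ (bundle .P (k + 1) W) ≫ (𝐏 (cyc xUp W (k + 1)) ≫ xUp (bundle .P k W)) ≫
    δ (bundle .P (k + 1) W) = _
  rw [Category.assoc, ← reassoc_of% h, h', Linear.comp_smul, lw_comp, Category.assoc]

/-- The partial closure of a cycle, decorated, on at least two strands vanishes. -/
theorem closure_cyc (hδ : IsDot p ζ δ) (W : Word) (k : ℕ) : (cupR (bundle .P (k + 1) W) ≫
    𝐐 (δ (bundle .P (k + 1) W))) ≫ 𝐐 (cyc xUp W (k + 2)) ≫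
      𝐐 (δ (bundle .P (k + 1) W)) ≫ capL (bundle .P (k + 1) W) = 0 := by
  have h := congrArg 𝐐 (hδ.conj_cyc W k)
  simp only [lw_comp, lw_smul] at h
  simp only [Category.assoc]
  rw [reassoc_of% h, Linear.smul_comp, Linear.comp_smul]
  simp only [Category.assoc]
  rw [capL_natural, reassoc_of% (cupR_natural (cyc xUp W (k + 1))),
    reassoc_of% (cupR_natural (δ (bundle .P k W))), reassoc_of% (left_curl (bundle .P k W))]
  simp

/-- The decorations slide past the downward crossing, meet and cancel by `mul_self`; what is left
contains a left curl. -/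
theorem lw_cup_xDown_lw_cap (hδ : IsDot p ζ δ) (W : Word) :
    𝐐 (cupR W ≫ 𝐐 (δ W)) ≫ xDown (P + W) ≫ 𝐐 (𝐐 (δ W) ≫ capL W) = 0 := by
  simp only [lw_comp, Category.assoc]
  rw [← reassoc_of% (xDown_natural (δ W)), ← reassoc_of% (lw_comp .Q (𝐐 (δ W))), ← lw_comp,
    hδ.mul_self, lw_id, lw_id, Category.id_comp, lw_cupR_xDown_lw_capL]

/-- Moving the decorations inwards by `conj_cyc` costs `ζ` and leaves a bare `xUp` between the cup
and the cap. This is the picture of `clasp`, which opens to a cap and a cup around a cycle with one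
strand fewer. -/
theorem clasp_cyc (hδ : IsDot p ζ δ) (W : Word) (k : ℕ) :
    𝐐 (cupR (bundle .P (k + 1) W) ≫ 𝐐 (δ (bundle .P (k + 1) W))) ≫
      xDown (bundle .P (k + 2) W) ≫ 𝐐 (𝐐 (cyc xUp W (k + 2)) ≫
        𝐐 (δ (bundle .P (k + 1) W)) ≫ capL (bundle .P (k + 1) W)) =
      ζ • (𝐐 (cyc xUp W (k + 1)) ≫ capCup δ (bundle .P k W)) := by
  have h := congrArg 𝐐 (congrArg 𝐐 (hδ.conj_cyc W k))
  have hx := xDown_natural (δ (bundle .P (k + 1) W))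
  have hc := clasp (bundle .P k W)
  simp only [lw_comp, lw_smul] at h
  simp only [lw_comp, Category.assoc]
  rw [reassoc_of% hx, reassoc_of% h, Linear.smul_comp, Linear.comp_smul, Linear.comp_smul]
  simp only [Category.assoc, capCup]
  congr 1
  have h₁ := xDown_natural (𝐏 (cyc xUp W (k + 1)))
  have h₂ := xDown_natural (𝐏 (δ (bundle .P k W)))
  have h₃ := congrArg 𝐐 (cupR_natural (cyc xUp W (k + 1)))
  have h₄ := congrArg 𝐐 (cupR_natural (δ (bundle .P k W)))
  have h₅ := congrArg 𝐐 (capL_natural (δ (bundle .P k W)))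
  simp only [lw_comp] at h₃ h₄ h₅
  rw [h₅, ← reassoc_of% h₁, ← reassoc_of% h₂, reassoc_of% h₃, reassoc_of% h₄, reassoc_of% hc]

end IsDot

/-- The trace of two cycles connected by a cap and a cup. -/
def clasped (δ : ∀ W : Word, P + W ⟶ P + W) (W : Word) (m k : ℕ) : EvenTrace :=
  tr (pcyc xDown (m + 1) (bundle .P (k + 1) W) ≫ pw .Q (m + 1) (cyc xUp W (k + 1)) ≫
    pw .Q m (capCup δ (bundle .P k W)))

namespace IsDot

variable {p : ZMod 2} {ζ : ℂ} {δ : ∀ W : Word, P + W ⟶ P + W}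

/-- Closing up joins the cup to the cap, the two decorations cancel, and a counterclockwise bubble
remains. For the dot, the decorated cap and cup are odd, so the trace relation is used here for odd
morphisms, without sign. -/
theorem clasped_zero_zero (hδ : IsDot p ζ δ) (W : Word) : clasped δ W 0 0 = tr (𝟙 W) := by
  have h : clasped δ W 0 0 = tr (capCup δ W) := by
    change tr (𝟙 _ ≫ 𝐐 (𝟙 _) ≫ capCup δ W) = _
    rw [lw_id, Category.id_comp]
    exact congrArg tr (Category.id_comp _)
  rw [h, capCup, tr_comm_of_mem (hδ.cap_mem W) (hδ.cup_mem W), Category.assoc,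
    ← reassoc_of% (lw_comp .Q), hδ.mul_self, lw_id, Category.id_comp, cupR_capL]

theorem clasped_zero_succ (hδ : IsDot p ζ δ) (W : Word) (k : ℕ) : clasped δ W 0 (k + 1) = 0 := by
  have := cyc_even (s := xUp) inferInstance W (k + 2)
  have h : clasped δ W 0 (k + 1) = tr ((𝐐 (cyc xUp W (k + 2)) ≫
      𝐐 (δ (bundle .P (k + 1) W)) ≫ capL (bundle .P (k + 1) W)) ≫
      cupR (bundle .P (k + 1) W) ≫ 𝐐 (δ (bundle .P (k + 1) W))) :=
    congrArg tr ((Category.id_comp _).trans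
      (Category.assoc (𝐐 (cyc xUp W (k + 2))) (𝐐 (δ _) ≫ capL _) _).symm)
  rw [h, tr_comm_of_mem (even_comp_mem (hδ.cap_mem _)) (hδ.cup_mem _), hδ.closure_cyc, tr_zero]

/-- Pulling the leftmost downward strand of a cycle through a cap and a cup. -/
theorem tr_contract (hδ : IsDot p ζ δ) (m : ℕ) {X : Word}
    (f : Q + (P + X) ⟶ X) (hf : f ∈ homPiece p _ _) :
    tr (pcyc xDown (m + 2) (P + X) ≫ pw .Q (m + 1) (f ≫ cupR X ≫ 𝐐 (δ X))) =
      tr (pw .Q m (𝐐 (cupR X ≫ 𝐐 (δ X)) ≫ xDown (P + X) ≫ 𝐐 f) ≫ pcyc xDown (m + 1) X) := by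
  have h₁ := pcyc_natural (s := xDown) xDown_natural (m + 1) f
  have := pcyc_even (s := xDown) inferInstance (m + 1) X
  have := pcyc_even (s := xDown) inferInstance (m + 2) (P + X)
  rw [pw_comp, ← Category.assoc, tr_comm_of_mem (p := p)
    (even_comp_mem (pw_mem .Q (m + 1) hf)) (pw_mem .Q (m + 1) (hδ.cup_mem X))]
  change tr (pw .Q m (𝐐 (cupR X ≫ 𝐐 (δ X))) ≫ (pw .Q m (xDown (P + X)) ≫
    pcyc xDown (m + 1) (Q + (P + X))) ≫ pw .Q (m + 1) f) = _
  rw [Category.assoc, ← h₁, pw_comp, pw_comp, Category.assoc, Category.assoc]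
  rfl

/-- After contraction a single upward strand crosses the remaining downward strand between a cup and
a cap, which produces a curl. -/
theorem clasped_succ_zero (hδ : IsDot p ζ δ) (W : Word) (m : ℕ) : clasped δ W (m + 1) 0 = 0 := by
  have h : clasped δ W (m + 1) 0 = tr (pcyc xDown (m + 2) (P + W) ≫
      pw .Q (m + 1) ((𝐐 (δ W) ≫ capL W) ≫ cupR W ≫ 𝐐 (δ W))) := by
    change tr (pcyc xDown (m + 2) (P + W) ≫ pw .Q (m + 2) (𝟙 _) ≫ pw .Q (m + 1) (capCup δ W)) = _
    rw [pw_id]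
    exact congrArg tr (congrArg (pcyc xDown (m + 2) (P + W) ≫ ·) (Category.id_comp _))
  rw [h, hδ.tr_contract m _ (hδ.cap_mem W), hδ.lw_cup_xDown_lw_cap, pw_zero, Limits.zero_comp,
    tr_zero]

theorem clasped_succ_succ (hδ : IsDot p ζ δ) (W : Word) (m k : ℕ) :
    clasped δ W (m + 1) (k + 1) = ζ • clasped δ W m k := by
  have := cyc_even (s := xUp) inferInstance W (k + 2)
  have := cyc_even (s := xUp) inferInstance W (k + 1)
  have := pcyc_even (s := xDown) inferInstance (m + 1) (bundle .P (k + 1) W)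
  have := hδ.capCup_even (bundle .P k W)
  have h : clasped δ W (m + 1) (k + 1) = tr (pcyc xDown (m + 2) (bundle .P (k + 2) W) ≫
      pw .Q (m + 1) ((𝐐 (cyc xUp W (k + 2)) ≫ 𝐐 (δ (bundle .P (k + 1) W)) ≫
        capL (bundle .P (k + 1) W)) ≫ cupR (bundle .P (k + 1) W) ≫
          𝐐 (δ (bundle .P (k + 1) W)))) := by
    rw [Category.assoc, pw_comp, Category.assoc]
    change tr (_ ≫ _ ≫ pw .Q (m + 1) ((𝐐 (δ (bundle .P (k + 1) W)) ≫ _) ≫ _)) = _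
    rw [Category.assoc]
    rfl
  rw [h, hδ.tr_contract m _ (even_comp_mem (hδ.cap_mem _)), hδ.clasp_cyc, pw_smul,
    Linear.smul_comp, tr_smul, tr_comm, pw_comp]
  rfl

/-- Each contraction removes one strand from both cycles and gives a factor `ζ`. Unequal lengths end
in a curl, equal lengths in a bubble after `k` contractions. -/
theorem clasped_eq (hδ : IsDot p ζ δ) (m k : ℕ) :
    clasped δ 0 m k = if m = k then algebraMap ℂ _ (ζ ^ k) else 0 := by
  induction m generalizing k with
  | zero =>
    cases k with
    | zero => rw [hδ.clasped_zero_zero, tr_id_zero]; simp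
    | succ k => rw [hδ.clasped_zero_succ]; simp
  | succ m ih =>
    cases k with
    | zero => rw [hδ.clasped_succ_zero]; simp
    | succ k =>
      rw [hδ.clasped_succ_succ, ih]
      by_cases h : m = k
      · simp [h, pow_succ', Algebra.smul_def]
      · simp [h]

end IsDot

/-! ### The double crossing of a downward strand with a bundle of upward strands -/

/-- The strand in position `i` moves to the left end. -/
def toFront (W : Word) : ∀ k _i : ℕ, bundle .P (k + 1) W ⟶ bundle .P (k + 1) W
  | 0, _ => 𝟙 _
  | _ + 1, 0 => 𝟙 _
  | k + 1, i + 1 => 𝐏 (toFront W k i) ≫ xUp (bundle .P k W)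

/-- The leftmost strand moves to position `i`. -/
def fromFront (W : Word) : ∀ k _i : ℕ, bundle .P (k + 1) W ⟶ bundle .P (k + 1) W
  | 0, _ => 𝟙 _
  | _ + 1, 0 => 𝟙 _
  | k + 1, i + 1 => xUp (bundle .P k W) ≫ 𝐏 (fromFront W k i)

theorem toFront_zero (W : Word) (k : ℕ) : toFront W k 0 = 𝟙 _ := by cases k <;> rfl
theorem fromFront_zero (W : Word) (k : ℕ) : fromFront W k 0 = 𝟙 _ := by cases k <;> rfl

instance toFront_even (W : Word) : ∀ k i : ℕ, IsEven (toFront W k i)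
  | 0, _ => inferInstanceAs (IsEven (𝟙 _))
  | _ + 1, 0 => inferInstanceAs (IsEven (𝟙 _))
  | k + 1, i + 1 => by
    have := toFront_even W k i
    exact inferInstanceAs (IsEven (𝐏 (toFront W k i) ≫ xUp (bundle .P k W)))

instance fromFront_even (W : Word) : ∀ k i : ℕ, IsEven (fromFront W k i)
  | 0, _ => inferInstanceAs (IsEven (𝟙 _))
  | _ + 1, 0 => inferInstanceAs (IsEven (𝟙 _))
  | k + 1, i + 1 => by
    have := fromFront_even W k i
    exact inferInstanceAs (IsEven (xUp (bundle .P k W) ≫ 𝐏 (fromFront W k i)))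

theorem toFront_fromFront (W : Word) : ∀ k i : ℕ, toFront W k i ≫ fromFront W k i = 𝟙 _
  | 0, _ => Category.id_comp _
  | _ + 1, 0 => Category.id_comp _
  | k + 1, i + 1 => by
    change (𝐏 (toFront W k i) ≫ xUp _) ≫ xUp _ ≫ 𝐏 (fromFront W k i) = _
    rw [Category.assoc, reassoc_of% (xUp_xUp (bundle .P k W)), ← lw_comp, toFront_fromFront, lw_id]

theorem fromFront_toFront (W : Word) : ∀ k i : ℕ, fromFront W k i ≫ toFront W k i = 𝟙 _
  | 0, _ => Category.id_comp _
  | _ + 1, 0 => Category.id_comp _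
  | k + 1, i + 1 => by
    change (xUp _ ≫ 𝐏 (fromFront W k i)) ≫ 𝐏 (toFront W k i) ≫ xUp _ = _
    rw [Category.assoc, ← reassoc_of% (lw_comp .P), fromFront_toFront, lw_id, Category.id_comp,
      xUp_xUp]

/-- The cycle sends position `i` to position `i + 1`, so bringing that strand to the front before or
after the cycle differs only by a shorter cycle on the other strands. -/
theorem cyc_toFront (W : Word) : ∀ k i : ℕ, i ≤ k → cyc xUp W (k + 2) ≫ toFront W (k + 1) (i + 1) =
    toFront W (k + 1) i ≫ 𝐏 (cyc xUp W (k + 1))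
  | k, 0, _ => by
    change (𝐏 (cyc xUp W (k + 1)) ≫ xUp _) ≫ 𝐏 (toFront W k 0) ≫ xUp _ = 𝟙 _ ≫ _
    rw [toFront_zero, lw_id, Category.id_comp, Category.assoc, xUp_xUp, Category.comp_id,
      Category.id_comp]
  | k + 1, i + 1, h => by
    have ih := congrArg 𝐏 (cyc_toFront W k i (by omega))
    have hx := xUp_natural (toFront W k i)
    have hx' := xUp_natural (cyc xUp W (k + 1))
    have hb := xUp_braid (bundle .P k W)
    simp only [lw_comp] at ih
    change (𝐏 (cyc xUp W (k + 2)) ≫ xUp _) ≫ 𝐏 (𝐏 (toFront W k i) ≫ xUp _) ≫ xUp _ =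
      (𝐏 (toFront W (k + 1) i) ≫ xUp _) ≫ 𝐏 (𝐏 (cyc xUp W (k + 1)) ≫ xUp _)
    simp only [lw_comp, Category.assoc]
    rw [← reassoc_of% hx, hb, ← reassoc_of% hx', ← reassoc_of% ih]
    change _ = 𝐏 (cyc xUp W (k + 2)) ≫ 𝐏 (𝐏 (toFront W k i) ≫ xUp _) ≫ _
    simp only [lw_comp, Category.assoc]

/-- A downward strand that crosses a bundle of upward strands twice. -/
theorem one_sub_bL_bR (W : Word) (k : ℕ) :
    𝟙 _ - upDown.bL W (k + 1) ≫ upDown.bR W (k + 1) = ∑ i ∈ Finset.range (k + 1),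
      𝐐 (toFront W k i) ≫ (capCup (fun W => 𝟙 (P + W)) (bundle .P k W) +
        capCup dotU (bundle .P k W)) ≫ 𝐐 (fromFront W k i) := by
  have hκ : ∀ W, 𝟙 _ - xLeft W ≫ xRight W = capCup (fun W => 𝟙 (P + W)) W + capCup dotU W := by
    intro W
    rw [xLeft_xRight]
    simp only [capCup, lw_id, Category.id_comp, Category.comp_id, Category.assoc]
    abel
  -- Conjugating a cap and cup by the mixed crossings with a further upward strand amounts to
  -- conjugating by the upward crossing, because strands slide across cups and caps.
  have hx : ∀ W, xLeft (P + W) ≫ 𝐏 (capCup (fun W => 𝟙 (P + W)) W + capCup dotU W) ≫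
      xRight (P + W) = 𝐐 (xUp W) ≫ (capCup (fun W => 𝟙 (P + W)) (P + W) + capCup dotU (P + W)) ≫
        𝐐 (xUp W) := by
    intro W
    have h₀ := lw_cupR_xRight W
    have h₁ := xLeft_lw_capL W
    have h₂ := xLeft_natural (dotU W)
    have h₃ := xRight_natural (dotU W)
    have h₄ := congrArg 𝐐 (lw_dotU_xUp W)
    have h₅ := congrArg 𝐐 (dotU_xUp W)
    simp only [lw_comp] at h₄ h₅
    simp only [capCup, lw_id, Category.id_comp, Category.comp_id, Category.assoc, lw_add, lw_comp,
      Preadditive.add_comp, Preadditive.comp_add]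
    rw [h₀, reassoc_of% h₁, h₃, ← reassoc_of% h₂, reassoc_of% h₀, reassoc_of% h₁, ← h₅,
      reassoc_of% h₄]
  induction k with
  | zero =>
    rw [Finset.sum_range_one, toFront_zero, fromFront_zero, lw_id, Category.id_comp,
      Category.comp_id, ← hκ]
    change 𝟙 _ - (xLeft _ ≫ 𝐏 (𝟙 _)) ≫ 𝐏 (𝟙 _) ≫ xRight _ = _
    rw [lw_id, Category.comp_id, Category.id_comp]
  | succ k ih =>
    rw [Finset.sum_range_succ', toFront_zero, fromFront_zero, lw_id, Category.id_comp,
      Category.comp_id]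
    refine Eq.trans ?_ (congrArg (_ + ·) (hκ (bundle .P (k + 1) W)))
    -- The outermost strand is split off: the inner double crossing is the identity minus its own
    -- defect, so the defects add up, the inner ones being conjugated by `xLeft` and `xRight`.
    have h : upDown.bL W (k + 2) ≫ upDown.bR W (k + 2) =
        xLeft (bundle .P (k + 1) W) ≫ xRight (bundle .P (k + 1) W) -
        xLeft (bundle .P (k + 1) W) ≫ 𝐏 (𝟙 _ - upDown.bL W (k + 1) ≫ upDown.bR W (k + 1)) ≫
          xRight (bundle .P (k + 1) W) := by
      rw [lw_sub, lw_id, Preadditive.sub_comp, Category.id_comp, Preadditive.comp_sub,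
        sub_sub_cancel, lw_comp, Category.assoc]
      exact Category.assoc _ _ _
    have h' : ∀ i, xLeft (bundle .P (k + 1) W) ≫ 𝐏 (𝐐 (toFront W k i) ≫
        (capCup (fun W => 𝟙 (P + W)) (bundle .P k W) + capCup dotU (bundle .P k W)) ≫
          𝐐 (fromFront W k i)) ≫ xRight (bundle .P (k + 1) W) =
        𝐐 (toFront W (k + 1) (i + 1)) ≫ (capCup (fun W => 𝟙 (P + W)) (bundle .P (k + 1) W) +
          capCup dotU (bundle .P (k + 1) W)) ≫ 𝐐 (fromFront W (k + 1) (i + 1)) := by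
      intro i
      have h₂ := xLeft_natural (toFront W k i)
      have h₃ := xRight_natural (fromFront W k i)
      change _ = 𝐐 (𝐏 (toFront W k i) ≫ xUp _) ≫ _ ≫ 𝐐 (xUp _ ≫ 𝐏 (fromFront W k i))
      rw [lw_comp, lw_comp, Category.assoc, Category.assoc, h₃, ← reassoc_of% h₂,
        reassoc_of% (hx (bundle .P k W))]
      simp only [lw_comp, Category.assoc]
    rw [h, ih, sub_sub_eq_add_sub, add_sub_right_comm]
    refine (add_comm _ _).trans ?_
    congr 1
    have hs : ∀ (s : Finset ℕ) {X Y : Word} (f : ℕ → (X ⟶ Y)),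
        𝐏 (∑ i ∈ s, f i) = ∑ i ∈ s, 𝐏 (f i) := fun s X Y f =>
      map_sum (AddMonoidHom.mk' (lw .P : (X ⟶ Y) → _) (lw_add .P)) f s
    rw [hs, Preadditive.sum_comp, Preadditive.comp_sum]
    exact Finset.sum_congr rfl fun i _ => h' i

/-- Carried around the trace, `toFront` and `fromFront` conjugate the upward cycle. By `cyc_toFront`
the conjugates for `i` and `i + 1` are products of the same two factors in opposite orders. The
exchanged factor is a cycle that does not involve the capped strand, so it commutes with the cap and
cup and with the downward cycle, and the trace does not change. -/
theorem IsDot.tr_toFront_fromFront {p : ZMod 2} {ζ : ℂ} {δ : ∀ W : Word, P + W ⟶ P + W}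
    (hδ : IsDot p ζ δ) (W : Word) (m k : ℕ) : ∀ i : ℕ, i ≤ k →
    tr (pcyc xDown (m + 1) (bundle .P (k + 1) W) ≫ pw .Q (m + 1) (cyc xUp W (k + 1)) ≫
      pw .Q m (𝐐 (toFront W k i) ≫ capCup δ (bundle .P k W) ≫ 𝐐 (fromFront W k i))) =
    clasped δ W m k := by
  have := cyc_even (s := xUp) inferInstance W (k + 1)
  have := pcyc_even (s := xDown) inferInstance (m + 1) (bundle .P (k + 1) W)
  have := hδ.capCup_even (bundle .P k W)
  have hn : ∀ {X Y : Word} (f : X ⟶ Y), _ := pcyc_natural (s := xDown) xDown_natural (m + 1)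
  have hrot : ∀ i, tr (pcyc xDown (m + 1) (bundle .P (k + 1) W) ≫
      pw .Q (m + 1) (cyc xUp W (k + 1)) ≫
      pw .Q m (𝐐 (toFront W k i) ≫ capCup δ (bundle .P k W) ≫ 𝐐 (fromFront W k i))) =
      tr (pcyc xDown (m + 1) (bundle .P (k + 1) W) ≫ pw .Q (m + 1)
        (fromFront W k i ≫ cyc xUp W (k + 1) ≫ toFront W k i) ≫
          pw .Q m (capCup δ (bundle .P k W))) := by
    intro i
    have h := hn (fromFront W k i)
    rw [pw_comp, pw_comp, ← Category.assoc, ← Category.assoc, ← Category.assoc, tr_comm]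
    change tr (pw .Q (m + 1) (fromFront W k i) ≫ ((_ ≫ _) ≫ pw .Q (m + 1) (toFront W k i)) ≫ _) = _
    simp only [pw_comp, Category.assoc]
    rw [reassoc_of% h]
  intro i
  induction i with
  | zero => intro _; rw [toFront_zero, fromFront_zero, lw_id, Category.id_comp, Category.comp_id,
      clasped]
  | succ i ih =>
    intro hi
    rw [← ih (by omega), hrot, hrot]
    obtain ⟨k, rfl⟩ : ∃ k', k = k' + 1 := ⟨k - 1, by omega⟩
    have := cyc_even (s := xUp) inferInstance W (k + 1)
    have hc := cyc_toFront W k i (by omega)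
    -- Here `𝐏` of the shorter cycle is the last factor; in `h₂` it is the first.
    have h₁ : fromFront W (k + 1) (i + 1) ≫ cyc xUp W (k + 2) ≫ toFront W (k + 1) (i + 1) =
        (fromFront W (k + 1) (i + 1) ≫ toFront W (k + 1) i) ≫ 𝐏 (cyc xUp W (k + 1)) := by
      rw [hc, Category.assoc]
    have h₂ : fromFront W (k + 1) i ≫ cyc xUp W (k + 2) ≫ toFront W (k + 1) i =
        𝐏 (cyc xUp W (k + 1)) ≫ fromFront W (k + 1) (i + 1) ≫ toFront W (k + 1) i := by
      have h := congrArg (fun f => fromFront W (k + 1) i ≫ f ≫ fromFront W (k + 1) (i + 1) ≫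
        toFront W (k + 1) i) hc
      simp only [Category.assoc] at h
      rwa [reassoc_of% (toFront_fromFront W (k + 1) (i + 1)),
        reassoc_of% (fromFront_toFront W (k + 1) i)] at h
    have h₃ := hδ.capCup_natural (cyc xUp W (k + 1))
    have h₄ := hn (𝐏 (cyc xUp W (k + 1)))
    refine Eq.trans (congrArg (fun f => tr (_ ≫ pw .Q (m + 1) f ≫ _)) h₁) (Eq.trans ?_
      (congrArg (fun f => tr (_ ≫ pw .Q (m + 1) f ≫ _)) h₂).symm)
    rw [pw_comp, pw_comp .Q (m + 1) (𝐏 _), Category.assoc, Category.assoc]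
    change tr (_ ≫ _ ≫ pw .Q m (𝐐 (𝐏 (cyc xUp W (k + 1)))) ≫ pw .Q m _) = _
    rw [← pw_comp, h₃, pw_comp, ← reassoc_of% h₄]
    refine Eq.trans ?_ (tr_comm _ _).symm
    simp only [Category.assoc]
    rw [pw_comp .Q m]
    rfl

/-- Each of the `k + 1` upward strands contributes a plain clasp with `ζ = 1` and a dotted clasp
with `ζ = -1`, both evaluated by `clasped_eq`. -/
theorem h_neg_mul_h_succ (m k : ℕ) : h (-(m + 1 : ℕ)) * h (k + 1 : ℕ) =
    h (k + 1 : ℕ) * h (-(m + 1 : ℕ)) +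
      algebraMap ℂ EvenTrace (if m = k then (k + 1) * (1 + (-1) ^ k) else 0) := by
  have := cyc_even (s := xUp) inferInstance 0 (k + 1)
  have := pcyc_even (s := xDown) inferInstance (m + 1) (bundle .P (k + 1) 0)
  have := isDot_id.capCup_even (bundle .P k 0)
  have := isDot_dotU.capCup_even (bundle .P k 0)
  have hs : ∀ (s : Finset ℕ) (f : ℕ → (Q + bundle .P (k + 1) 0 ⟶ Q + bundle .P (k + 1) 0))
      [∀ i, IsEven (f i)], tr (pcyc xDown (m + 1) (bundle .P (k + 1) 0) ≫
        pw .Q (m + 1) (cyc xUp 0 (k + 1)) ≫ pw .Q m (∑ i ∈ s, f i)) =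
      ∑ i ∈ s, tr (pcyc xDown (m + 1) (bundle .P (k + 1) 0) ≫
        pw .Q (m + 1) (cyc xUp 0 (k + 1)) ≫ pw .Q m (f i)) := by
    intro s f _
    have he : ∀ s : Finset ℕ, IsEven (∑ i ∈ s, f i) := fun s =>
      ⟨Submodule.sum_mem _ fun i _ => IsEven.mem⟩
    induction s using Finset.induction_on with
    | empty => simp [pw_zero, tr_zero]
    | insert a s ha ih =>
      have := he s
      rw [Finset.sum_insert ha, Finset.sum_insert ha, pw_add, Preadditive.comp_add,
        Preadditive.comp_add, tr_add, ih]
  rw [h_neg_mul_h_pos, one_sub_bL_bR, hs]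
  congr 1
  have ht : ∀ i ∈ Finset.range (k + 1), tr (pcyc xDown (m + 1) (bundle .P (k + 1) 0) ≫
      pw .Q (m + 1) (cyc xUp 0 (k + 1)) ≫ pw .Q m (𝐐 (toFront 0 k i) ≫
        (capCup (fun W => 𝟙 (P + W)) (bundle .P k 0) + capCup dotU (bundle .P k 0)) ≫
          𝐐 (fromFront 0 k i))) =
      algebraMap ℂ EvenTrace (if m = k then 1 + (-1) ^ k else 0) := by
    intro i hi
    rw [Finset.mem_range] at hi
    rw [Preadditive.add_comp, Preadditive.comp_add, pw_add, Preadditive.comp_add,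
      Preadditive.comp_add, tr_add, isDot_id.tr_toFront_fromFront 0 m k i (by omega),
      isDot_dotU.tr_toFront_fromFront 0 m k i (by omega), isDot_id.clasped_eq,
      isDot_dotU.clasped_eq]
    split_ifs <;> simp
  rw [Finset.sum_congr rfl ht, Finset.sum_const, Finset.card_range]
  split_ifs <;> simp [nsmul_eq_mul, mul_add]

theorem h_odd_comm_aux (a b : ℕ) : h (2 * a + 1) * h (-(2 * b + 1)) - h (-(2 * b + 1)) *
    h (2 * a + 1) = algebraMap ℂ EvenTrace (if a = b then -2 * (2 * (a : ℂ) + 1) else 0) := by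
  have hc := h_neg_mul_h_succ (2 * b) (2 * a)
  push_cast at hc
  refine (sub_eq_of_eq_add' (b := h (-(2 * b + 1)) * h (2 * a + 1)) (c := algebraMap ℂ EvenTrace
    (-(if 2 * b = 2 * a then (2 * (a : ℂ) + 1) * (1 + (-1) ^ (2 * a)) else 0))) ?_).trans (congrArg _ ?_)
  · rw [hc, add_assoc, ← map_add, add_neg_cancel, map_zero, add_zero]
  by_cases h : a = b
  · subst h; simp; ring
  · rw [if_neg h, if_neg (by omega), neg_zero]

theorem h_odd_comm (a b : ℤ) : h (2 * a + 1) * h (2 * b + 1) - h (2 * b + 1) * h (2 * a + 1) =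
    algebraMap ℂ EvenTrace (if a + b + 1 = 0 then -2 * (2 * (a : ℂ) + 1) else 0) := by
  have hneg : ∀ n : ℕ, (2 * Int.negSucc n + 1 : ℤ) = -(2 * n + 1) := fun n => by
    rw [Int.negSucc_eq]; ring
  rcases a with a | a <;> rcases b with b | b
  · have hc := h_pos_comm (2 * a) (2 * b + 1)
    push_cast at hc
    rw [if_neg (by simp only [Int.ofNat_eq_natCast]; omega), map_zero]
    exact sub_eq_zero.2 hc
  · have hc := h_odd_comm_aux a b
    rw [hneg]
    refine hc.trans (congrArg _ (if_congr ?_ (by simp) rfl))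
    rw [Int.negSucc_eq]; simp only [Int.ofNat_eq_natCast]; omega
  · have hc := h_odd_comm_aux b a
    rw [hneg]
    refine (neg_sub _ _).symm.trans ((congrArg _ hc).trans ((map_neg (algebraMap ℂ EvenTrace)
      _).symm.trans (congrArg _ ?_)))
    by_cases h : b = a
    · rw [if_pos h, if_pos (by rw [Int.negSucc_eq]; simp only [Int.ofNat_eq_natCast]; omega), h]
      push_cast; ring
    · rw [if_neg h, if_neg (by rw [Int.negSucc_eq]; simp only [Int.ofNat_eq_natCast]; omega),
        neg_zero]
  · have hc := h_neg_comm (2 * a) (2 * b)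
    push_cast at hc
    rw [hneg, hneg, if_neg (by rw [Int.negSucc_eq, Int.negSucc_eq]; omega), map_zero]
    exact sub_eq_zero.2 hc

end

end TwistedHeis

namespace TwistedHeis

noncomputable section

/-! ## The twisted Heisenberg algebra is simple -/

namespace HeisTw

theorem heisGen_comm (k l : ℤ) : heisGen k * heisGen l - heisGen l * heisGen k =
    algebraMap ℂ HeisTw (if k + l + 1 = 0 then (k : ℂ) + 1 / 2 else 0) := by
  have h := RingQuot.mkAlgHom_rel ℂ (HeisRel.comm k l)
  rw [map_sub, map_mul, map_mul, AlgHom.commutes] at h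
  exact h

theorem half_ne_zero (k : ℤ) : (k : ℂ) + 1 / 2 ≠ 0 := by
  intro h
  have h' : ((2 * k + 1 : ℤ) : ℂ) = 0 := by push_cast; linear_combination 2 * h
  have := Int.cast_eq_zero.1 h'
  omega

/-- The span of `1` and of the generators. -/
def lin : Submodule ℂ HeisTw := Submodule.span ℂ (insert 1 (Set.range heisGen))

theorem one_mem_lin : (1 : HeisTw) ∈ lin := Submodule.subset_span (Set.mem_insert _ _)

theorem heisGen_mem_lin (k : ℤ) : heisGen k ∈ lin :=
  Submodule.subset_span (Set.mem_insert_of_mem _ ⟨k, rfl⟩)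

/-- The elements of degree less than `n`. -/
def low : ℕ → Submodule ℂ HeisTw
  | 0 => ⊥
  | n + 1 => lin ^ n

theorem lin_mul_low {v x : HeisTw} {n : ℕ} (hv : v ∈ lin) (hx : x ∈ low n) : v * x ∈ lin ^ n := by
  cases n with
  | zero => rw [(Submodule.mem_bot ℂ).1 hx, mul_zero]; exact zero_mem _
  | succ n => rw [pow_succ']; exact Submodule.mul_mem_mul hv hx

theorem lin_pow_le (n : ℕ) : lin ^ n ≤ lin ^ (n + 1) := fun x hx => by
  rw [pow_succ', ← one_mul x]
  exact Submodule.mul_mem_mul one_mem_lin hx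

theorem low_le (n : ℕ) : low n ≤ lin ^ n := fun x hx => by
  rw [← one_mul x]
  exact lin_mul_low one_mem_lin hx

theorem exists_mem_lin_pow (x : HeisTw) : ∃ n, x ∈ lin ^ n := by
  have hmono : Monotone fun n : ℕ => lin ^ n := monotone_nat_of_le_succ lin_pow_le
  obtain ⟨a, rfl⟩ := RingQuot.mkAlgHom_surjective ℂ HeisRel x
  induction a using FreeAlgebra.induction with
  | grade0 r => exact ⟨0, by rw [AlgHom.commutes, pow_zero]; exact Submodule.algebraMap_mem r⟩
  | grade1 k => exact ⟨1, by rw [pow_one]; exact heisGen_mem_lin k⟩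
  | mul a b ha hb =>
    obtain ⟨m, hm⟩ := ha
    obtain ⟨n, hn⟩ := hb
    exact ⟨m + n, by rw [map_mul, pow_add]; exact Submodule.mul_mem_mul hm hn⟩
  | add a b ha hb =>
    obtain ⟨m, hm⟩ := ha
    obtain ⟨n, hn⟩ := hb
    exact ⟨max m n, by
      rw [map_add]; exact add_mem (hmono (le_max_left m n) hm) (hmono (le_max_right m n) hn)⟩

/-- The commutator with a generator. -/
def ad (k : ℤ) : HeisTw →ₗ[ℂ] HeisTw :=
  LinearMap.mulLeft ℂ (heisGen k) - LinearMap.mulRight ℂ (heisGen k)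

theorem ad_apply (k : ℤ) (x : HeisTw) : ad k x = heisGen k * x - x * heisGen k := rfl

theorem commutator_mul {R : Type*} [Ring R] (a x y : R) :
    a * (x * y) - x * y * a = (a * x - x * a) * y + x * (a * y - y * a) := by
  noncomm_ring

theorem ad_mul (k : ℤ) (x y : HeisTw) : ad k (x * y) = ad k x * y + x * ad k y := by
  exact commutator_mul _ x y

theorem ad_algebraMap (k : ℤ) (c : ℂ) : ad k (algebraMap ℂ HeisTw c) = 0 := by
  rw [ad_apply, Algebra.commutes, sub_self]

theorem ad_heisGen (k l : ℤ) : ad k (heisGen l) =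
    algebraMap ℂ HeisTw (if k + l + 1 = 0 then (k : ℂ) + 1 / 2 else 0) := heisGen_comm k l

theorem ad_lin (k : ℤ) {v : HeisTw} (hv : v ∈ lin) : ∃ c : ℂ, ad k v = algebraMap ℂ HeisTw c := by
  induction hv using Submodule.span_induction with
  | mem v hv =>
    rcases hv with rfl | ⟨l, rfl⟩
    · exact ⟨0, by rw [← map_one (algebraMap ℂ HeisTw), ad_algebraMap, map_zero]⟩
    · exact ⟨_, ad_heisGen k l⟩
  | zero => exact ⟨0, by rw [map_zero, map_zero]⟩
  | add v w _ _ hv hw =>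
    obtain ⟨c, hc⟩ := hv
    obtain ⟨d, hd⟩ := hw
    exact ⟨c + d, by rw [map_add, map_add, hc, hd]⟩
  | smul r v _ hv =>
    obtain ⟨c, hc⟩ := hv
    exact ⟨r * c, by rw [map_smul, hc, map_mul, Algebra.smul_def]⟩

/-- Commutators of generators are scalars, so by the Leibniz rule each summand loses one factor.
Scalars themselves commute with everything, which is why `low 0` is zero. -/
theorem ad_mem_low (k : ℤ) {n : ℕ} {x : HeisTw} (hx : x ∈ lin ^ n) : ad k x ∈ low n := by
  induction n generalizing x with
  | zero =>
    rw [pow_zero] at hx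
    obtain ⟨c, rfl⟩ := Submodule.mem_one.1 hx
    rw [ad_algebraMap]
    exact zero_mem _
  | succ n ih =>
    rw [pow_succ'] at hx
    induction hx using Submodule.mul_induction_on' with
    | mem_mul_mem v hv w hw =>
      obtain ⟨c, hc⟩ := ad_lin k hv
      rw [ad_mul, hc, ← Algebra.smul_def]
      exact add_mem (Submodule.smul_mem _ _ hw) (lin_mul_low hv (ih hw))
    | add x _ y _ hx hy => rw [map_add]; exact add_mem hx hy

/-- A truncated Euler operator. -/
def euler (T : Finset ℤ) : HeisTw →ₗ[ℂ] HeisTw :=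
  ∑ k ∈ T, ((k : ℂ) + 1 / 2)⁻¹ • (LinearMap.mulLeft ℂ (heisGen (-k - 1)) ∘ₗ ad k)

theorem euler_apply (T : Finset ℤ) (x : HeisTw) :
    euler T x = ∑ k ∈ T, ((k : ℂ) + 1 / 2)⁻¹ • (heisGen (-k - 1) * ad k x) := by
  simp [euler, LinearMap.sum_apply]

/-- The generator `heisGen l` has a nonzero commutator only with index `-l - 1`, and the weight in
`euler` is the inverse of its value, so that term gives back `heisGen l * x`. The last sum, from
commuting `heisGen (-k - 1)` past `heisGen l`, is of lower degree. -/
theorem euler_heisGen_mul {T : Finset ℤ} {l : ℤ} (hl : -l - 1 ∈ T) (x : HeisTw) :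
    euler T (heisGen l * x) = heisGen l * x + heisGen l * euler T x +
      ∑ k ∈ T, ((k : ℂ) + 1 / 2)⁻¹ • (ad (-k - 1) (heisGen l) * ad k x) := by
  have h₁ : ∀ k : ℤ, ((k : ℂ) + 1 / 2)⁻¹ • (heisGen (-k - 1) * ad k (heisGen l * x)) =
      ((k : ℂ) + 1 / 2)⁻¹ • (heisGen (-k - 1) * (ad k (heisGen l) * x)) +
      (heisGen l * (((k : ℂ) + 1 / 2)⁻¹ • (heisGen (-k - 1) * ad k x)) +
      ((k : ℂ) + 1 / 2)⁻¹ • (ad (-k - 1) (heisGen l) * ad k x)) := by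
    intro k
    rw [ad_mul, mul_add, smul_add, mul_smul_comm]
    simp only [ad_apply (-k - 1), sub_mul, mul_assoc]
    have h : ∀ (c : ℂ) (y z : HeisTw), c • y = c • z + c • (y - z) := fun c y z => by
      rw [← smul_add]
      exact congrArg (c • ·) (add_sub_cancel z y).symm
    exact congrArg _ (h _ _ _)
  rw [euler_apply, Finset.sum_congr rfl fun k _ => h₁ k, Finset.sum_add_distrib,
    Finset.sum_add_distrib, ← Finset.mul_sum, ← euler_apply, ← add_assoc]
  congr 2
  rw [Finset.sum_eq_single_of_mem _ hl]
  · rw [ad_heisGen, if_pos (by ring), ← Algebra.smul_def, mul_smul_comm, smul_smul,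
      inv_mul_cancel₀ (half_ne_zero _), one_smul]
    congr 2
    ring
  · intro k _ hk
    rw [ad_heisGen, if_neg (by omega), map_zero, zero_mul, mul_zero, smul_zero]

/-- By `euler_heisGen_mul` every generator in a product adds 1 to the eigenvalue, modulo lower
degree. The index set has to contain the partners of the finitely many generators that occur;
allowing every larger `T` makes the sets for different summands compatible. -/
theorem exists_euler {n : ℕ} {x : HeisTw} (hx : x ∈ lin ^ n) :
    ∃ S : Finset ℤ, ∀ T, S ⊆ T → euler T x - (n : ℂ) • x ∈ low n := by
  have hsum : ∀ {n : ℕ} {x : HeisTw} (T : Finset ℤ) (l : ℤ), x ∈ lin ^ n →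
      ∑ k ∈ T, ((k : ℂ) + 1 / 2)⁻¹ • (ad (-k - 1) (heisGen l) * ad k x) ∈ low n := by
    intro n x T l hx
    refine Submodule.sum_mem _ fun k _ => Submodule.smul_mem _ _ ?_
    rw [ad_heisGen, ← Algebra.smul_def]
    exact Submodule.smul_mem _ _ (ad_mem_low k hx)
  induction n generalizing x with
  | zero =>
    refine ⟨∅, fun T _ => ?_⟩
    have h : ∀ k, ad k x = 0 := fun k => (Submodule.mem_bot ℂ).1 (ad_mem_low k hx)
    simp [euler_apply, h]
  | succ n ih =>
    rw [pow_succ'] at hx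
    induction hx using Submodule.mul_induction_on' with
    | mem_mul_mem v hv w hw =>
      obtain ⟨S, hS⟩ := ih hw
      induction hv using Submodule.span_induction with
      | mem v hv =>
        rcases hv with rfl | ⟨l, rfl⟩
        · refine ⟨S, fun T hT => ?_⟩
          have h := sub_mem (low_le n (hS T hT)) hw
          rw [sub_sub] at h
          rwa [one_mul, Nat.cast_succ, add_smul, one_smul]
        · refine ⟨insert (-l - 1) S, fun T hT => ?_⟩
          rw [Finset.insert_subset_iff] at hT
          have h := add_mem (lin_mul_low (heisGen_mem_lin l) (hS T hT.2))
            (low_le n (hsum T l hw))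
          rw [euler_heisGen_mul hT.1, Nat.cast_succ, add_smul, one_smul, ← mul_smul_comm]
          rw [mul_sub] at h
          change _ ∈ lin ^ n
          convert h using 1
          abel
      | zero => exact ⟨∅, fun T _ => by rw [zero_mul, map_zero, smul_zero, sub_zero]; exact zero_mem _⟩
      | add v v' _ _ h h' =>
        obtain ⟨S, hS⟩ := h
        obtain ⟨S', hS'⟩ := h'
        refine ⟨S ∪ S', fun T hT => ?_⟩
        rw [Finset.union_subset_iff] at hT
        convert add_mem (hS T hT.1) (hS' T hT.2) using 1
        rw [add_mul, map_add]
        module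
      | smul r v _ h =>
        obtain ⟨S, hS⟩ := h
        refine ⟨S, fun T hT => ?_⟩
        convert Submodule.smul_mem _ r (hS T hT) using 1
        rw [smul_mul_assoc, map_smul]
        module
    | add x _ y _ h h' =>
      obtain ⟨S, hS⟩ := h
      obtain ⟨S', hS'⟩ := h'
      refine ⟨S ∪ S', fun T hT => ?_⟩
      rw [Finset.union_subset_iff] at hT
      convert add_mem (hS T hT.1) (hS' T hT.2) using 1
      rw [map_add]
      module

/-- If `x` of degree at most `n + 1` is in the kernel, its commutators with the generators are in
the kernel and of smaller degree, hence zero by induction. So the Euler operator kills `x`, although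
it acts as `n + 1` modulo lower degree; thus `x` itself has lower degree. In degree 0 only scalars
are left, and these inject into a nonzero algebra. -/
theorem injective_of_nontrivial {R : Type*} [Ring R] [Algebra ℂ R] [Nontrivial R]
    (f : HeisTw →ₐ[ℂ] R) : Function.Injective f := by
  have key : ∀ n : ℕ, ∀ x ∈ lin ^ n, f x = 0 → x = 0 := by
    intro n
    induction n with
    | zero =>
      intro x hx hf
      rw [pow_zero] at hx
      obtain ⟨c, rfl⟩ := Submodule.mem_one.1 hx
      rw [AlgHom.commutes] at hf
      rw [(map_eq_zero_iff _ (algebraMap ℂ R).injective).1 hf, map_zero]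
    | succ n ih =>
      intro x hx hf
      have had : ∀ k, ad k x = 0 := fun k => ih _ (ad_mem_low k hx) (by
        rw [ad_apply, map_sub, map_mul, map_mul, hf, mul_zero, zero_mul, sub_zero])
      obtain ⟨S, hS⟩ := exists_euler hx
      have h := hS S subset_rfl
      have he : euler S x = 0 := by simp [euler_apply, had]
      rw [he, zero_sub, neg_mem_iff] at h
      refine ih x ?_ hf
      have h' := Submodule.smul_mem _ ((n + 1 : ℕ) : ℂ)⁻¹ h
      rwa [smul_smul, inv_mul_cancel₀ (Nat.cast_ne_zero.2 n.succ_ne_zero), one_smul] at h'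
  refine (injective_iff_map_eq_zero f).2 fun x hx => ?_
  obtain ⟨n, hn⟩ := exists_mem_lin_pow x
  exact key n x hn hx

end HeisTw

end

end TwistedHeis

namespace TwistedHeis

noncomputable section

/-! ## The oscillator representation of the Lie algebra of differential operators -/

namespace Osc

open MvPolynomial

/-- The Fock space. -/
abbrev Fock : Type := MvPolynomial ℤ ℂ

/-- Multiplication by a variable. -/
def mulX (k : ℤ) : Module.End ℂ Fock := LinearMap.mulLeft ℂ (X k)

/-- Partial derivative. -/
def pd (k : ℤ) : Module.End ℂ Fock := (pderiv (R := ℂ) k : Derivation ℂ Fock Fock).toLinearMap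

theorem mulX_apply (k : ℤ) (p : Fock) : mulX k p = X k * p := rfl
theorem pd_apply (k : ℤ) (p : Fock) : pd k p = pderiv k p := rfl

theorem mulX_mulX (k l : ℤ) : mulX k * mulX l - mulX l * mulX k = 0 := by
  refine LinearMap.ext fun p => ?_
  simp only [LinearMap.sub_apply, Module.End.mul_apply, mulX_apply, LinearMap.zero_apply]
  ring

theorem pd_pd (k l : ℤ) : pd k * pd l - pd l * pd k = 0 := by
  have h : ⁅(pderiv k : Derivation ℂ Fock Fock), (pderiv l : Derivation ℂ Fock Fock)⁆ = 0 := by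
    refine derivation_ext fun i => ?_
    rw [Derivation.commutator_apply, pderiv_X, pderiv_X]
    simp [Pi.single_apply, apply_ite]
  exact congrArg (fun D : Derivation ℂ Fock Fock => D.toLinearMap) h

theorem pd_mulX (k l : ℤ) : pd k * mulX l - mulX l * pd k = if k = l then 1 else 0 := by
  refine LinearMap.ext fun p => ?_
  rw [LinearMap.sub_apply, Module.End.mul_apply, Module.End.mul_apply, mulX_apply,
    mulX_apply, pd_apply, pd_apply, pderiv_mul, pderiv_X]
  by_cases h : k = l
  · subst h; simp
  · simp [h, Ne.symm h]

theorem mulX_pd (k l : ℤ) : mulX k * pd l - pd l * mulX k = if k = l then (-1 : ℂ) • 1 else 0 := by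
  rw [← neg_sub, pd_mulX]
  by_cases h : k = l
  · rw [if_pos h.symm, if_pos h]
    exact (neg_one_smul ℂ _).symm
  · simp [h, Ne.symm h]

/-- The part of `∑ φ(j) :b*_{j+r} b_j:` with one multiplication and one derivative. -/
def drv (r : ℤ) (φ : ℤ → ℂ) : Derivation ℂ Fock Fock :=
  mkDerivation ℂ fun k =>
    if 0 ≤ k then (if 0 ≤ k + r then φ k • X (k + r) else 0)
    else (if k - r < 0 then -φ (k - r) • X (k - r) else 0)

/-- The part of `∑ φ(j) :b*_{j+r} b_j:` with two multiplications. -/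
def quad (r : ℤ) (φ : ℤ → ℂ) : Module.End ℂ Fock :=
  ∑ j ∈ Finset.Ico (-r) 0, -φ j • (mulX (j + r) * mulX j)

/-- The part of `∑ φ(j) :b*_{j+r} b_j:` with two derivatives. -/
def lapl (r : ℤ) (φ : ℤ → ℂ) : Module.End ℂ Fock :=
  ∑ j ∈ Finset.Ico 0 (-r), φ j • (pd (j + r) * pd j)

/-- The operator `∑ φ(j) :b*_{j+r} b_j:`. -/
def osc (r : ℤ) : (ℤ → ℂ) →ₗ[ℂ] Module.End ℂ Fock where
  toFun φ := (drv r φ).toLinearMap + quad r φ + lapl r φ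
  map_add' φ χ := by
    have hd : drv r (φ + χ) = drv r φ + drv r χ := by
      refine derivation_ext fun k => ?_
      simp only [drv, Derivation.add_apply, mkDerivation_X, Pi.add_apply]
      split_ifs <;> module
    rw [hd]
    simp only [quad, lapl, Pi.add_apply, add_smul, neg_add, Finset.sum_add_distrib]
    change (drv r φ).toLinearMap + (drv r χ).toLinearMap + _ + _ = _
    abel
  map_smul' c φ := by
    have hd : drv r (c • φ) = c • drv r φ := by
      refine derivation_ext fun k => ?_
      simp only [drv, Derivation.smul_apply, mkDerivation_X, Pi.smul_apply, smul_eq_mul]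
      split_ifs <;> module
    rw [hd]
    simp only [quad, lapl, Pi.smul_apply, smul_eq_mul, mul_smul, ← mul_neg,
      ← Finset.smul_sum, RingHom.id_apply, smul_add]
    rfl

theorem osc_apply (r : ℤ) (φ : ℤ → ℂ) :
    osc r φ = (drv r φ).toLinearMap + quad r φ + lapl r φ := rfl

theorem drv_mulX (r : ℤ) (φ : ℤ → ℂ) (k : ℤ) :
    (drv r φ).toLinearMap * mulX k - mulX k * (drv r φ).toLinearMap =
    if 0 ≤ k then (if 0 ≤ k + r then φ k • mulX (k + r) else 0)
    else (if k - r < 0 then -φ (k - r) • mulX (k - r) else 0) := by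
  refine LinearMap.ext fun p => ?_
  have h : drv r φ (X k) = _ := mkDerivation_X ℂ _ k
  change drv r φ (X k * p) - X k * drv r φ p = _
  rw [Derivation.leibniz, smul_eq_mul, smul_eq_mul, add_sub_cancel_left, h]
  split_ifs <;> simp [mulX_apply, mul_comm]

theorem drv_pd (r : ℤ) (φ : ℤ → ℂ) (k : ℤ) :
    (drv r φ).toLinearMap * pd k - pd k * (drv r φ).toLinearMap =
    if 0 ≤ k then (if 0 ≤ k - r then -φ (k - r) • pd (k - r) else 0)
    else (if k + r < 0 then φ k • pd (k + r) else 0) := by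
  have h : ⁅drv r φ, (pderiv k : Derivation ℂ Fock Fock)⁆ =
      if 0 ≤ k then (if 0 ≤ k - r then -φ (k - r) • pderiv (k - r) else 0)
      else (if k + r < 0 then φ k • pderiv (k + r) else 0) := by
    refine derivation_ext fun i => ?_
    have h₁ : drv r φ (pderiv k (X i)) = 0 := by
      rw [pderiv_X]
      by_cases h : i = k
      · subst h; simp
      · simp [Ne.symm h]
    have h₂ : drv r φ (X i) = _ := mkDerivation_X ℂ _ i
    rw [Derivation.commutator_apply, h₁, h₂, zero_sub]
    by_cases hr : r = 0
    · subst hr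
      by_cases hi : i = k
      · subst hi
        split_ifs <;> first | omega | simp [pderiv_X]
      · split_ifs <;> simp [pderiv_X, hi]
    by_cases hi : i + r = k
    · subst hi
      have h₃ : i - r ≠ i + r := by omega
      have h₄ : i ≠ i + r + r := by omega
      split_ifs <;> first | omega | simp [pderiv_X, h₃, h₄]
    by_cases hi : i - r = k
    · subst hi
      have h₃ : i + r ≠ i - r := by omega
      have h₄ : i ≠ i - r - r := by omega
      split_ifs <;> first | omega | simp [pderiv_X, h₃, h₄]
    have h₃ : k - r ≠ i := by omega
    have h₄ : k + r ≠ i := by omega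
    split_ifs <;> simp [pderiv_X, *]
  refine (congrArg (fun D : Derivation ℂ Fock Fock => D.toLinearMap) h).trans ?_
  split_ifs <;> rfl

theorem sum_smul_comm {ι : Type*} (s : Finset ι) (c : ι → ℂ) (T : ι → Module.End ℂ Fock)
    (B : Module.End ℂ Fock) : (∑ j ∈ s, c j • T j) * B - B * ∑ j ∈ s, c j • T j =
      ∑ j ∈ s, c j • (T j * B - B * T j) := by
  simp only [Finset.sum_mul, Finset.mul_sum, smul_mul_assoc, mul_smul_comm, smul_sub,
    Finset.sum_sub_distrib]

theorem mul_comm_eq (A B C : Module.End ℂ Fock) :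
    A * B * C - C * (A * B) = A * (B * C - C * B) + (A * C - C * A) * B := by
  exact h A B C
where
  h {R : Type} [Ring R] (A B C : R) :
      A * B * C - C * (A * B) = A * (B * C - C * B) + (A * C - C * A) * B := by
    noncomm_ring

theorem quad_mulX (r : ℤ) (φ : ℤ → ℂ) (k : ℤ) : quad r φ * mulX k - mulX k * quad r φ = 0 := by
  simp only [quad, sum_smul_comm, mul_comm_eq, mulX_mulX]
  simp

theorem lapl_pd (r : ℤ) (φ : ℤ → ℂ) (k : ℤ) : lapl r φ * pd k - pd k * lapl r φ = 0 := by
  simp only [lapl, sum_smul_comm, mul_comm_eq, pd_pd]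
  simp

theorem quad_pd (r : ℤ) (φ : ℤ → ℂ) (k : ℤ) : quad r φ * pd k - pd k * quad r φ =
    (if -r ≤ k ∧ k < 0 then φ k • mulX (k + r) else 0) +
      (if 0 ≤ k ∧ k < r then φ (k - r) • mulX (k - r) else 0) := by
  have h : ∀ j, -φ j • (mulX (j + r) * (if j = k then (-1 : ℂ) • 1 else 0) +
      (if j + r = k then (-1 : ℂ) • 1 else 0) * mulX j) =
      (if j = k then φ k • mulX (k + r) else 0) +
        (if j = k - r then φ (k - r) • mulX (k - r) else 0) := by
    intro j
    by_cases h₁ : j = k <;> by_cases h₂ : j + r = k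
    · obtain rfl : r = 0 := by omega
      subst h₁; simp
    · rw [if_pos h₁, if_neg h₂, if_pos h₁, if_neg (by omega), h₁]; simp
    · rw [if_neg h₁, if_pos h₂, if_neg h₁, if_pos (by omega), ← h₂]; simp
    · rw [if_neg h₁, if_neg h₂, if_neg h₁, if_neg (by omega)]; simp
  simp only [quad, sum_smul_comm, mul_comm_eq, mulX_pd, h, Finset.sum_add_distrib,
    Finset.sum_ite_eq', Finset.mem_Ico]
  congr 2
  exact propext (by omega)

theorem lapl_mulX (r : ℤ) (φ : ℤ → ℂ) (k : ℤ) : lapl r φ * mulX k - mulX k * lapl r φ =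
    (if 0 ≤ k ∧ k < -r then φ k • pd (k + r) else 0) +
      (if r ≤ k ∧ k < 0 then φ (k - r) • pd (k - r) else 0) := by
  have h : ∀ j, φ j • (pd (j + r) * (if j = k then 1 else 0) +
      (if j + r = k then 1 else 0) * pd j) =
      (if j = k then φ k • pd (k + r) else 0) +
        (if j = k - r then φ (k - r) • pd (k - r) else 0) := by
    intro j
    by_cases h₁ : j = k <;> by_cases h₂ : j + r = k
    · obtain rfl : r = 0 := by omega
      subst h₁; simp
    · rw [if_pos h₁, if_neg h₂, if_pos h₁, if_neg (by omega), h₁]; simp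
    · rw [if_neg h₁, if_pos h₂, if_neg h₁, if_pos (by omega), ← h₂]; simp
    · rw [if_neg h₁, if_neg h₂, if_neg h₁, if_neg (by omega)]; simp
  simp only [lapl, sum_smul_comm, mul_comm_eq, pd_mulX, h, Finset.sum_add_distrib,
    Finset.sum_ite_eq', Finset.mem_Ico]
  congr 2
  exact propext (by omega)

/-- The oscillator `b*_k`. -/
def bStar (k : ℤ) : Module.End ℂ Fock := if 0 ≤ k then mulX k else pd k

/-- The oscillator `b_k`. -/
def bLow (k : ℤ) : Module.End ℂ Fock := if 0 ≤ k then pd k else (-1 : ℂ) • mulX k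

theorem osc_comm (r : ℤ) (φ : ℤ → ℂ) (B : Module.End ℂ Fock) : osc r φ * B - B * osc r φ =
    ((drv r φ).toLinearMap * B - B * (drv r φ).toLinearMap) + (quad r φ * B - B * quad r φ) +
      (lapl r φ * B - B * lapl r φ) := by
  rw [osc_apply]; noncomm_ring

/-- The oscillators `b*_k` transform like the powers `t ^ k` under `t ^ r f(D)`; normal ordering
alters the bilinear expression only by a scalar. The four cases say whether `b*_k` and `b*_{k+r}`
are multiplications or derivatives, and exactly one of the three parts of `osc` contributes to each.
-/
theorem osc_bStar (r : ℤ) (φ : ℤ → ℂ) (k : ℤ) :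
    osc r φ * bStar k - bStar k * osc r φ = φ k • bStar (k + r) := by
  unfold bStar
  by_cases hk : 0 ≤ k <;> by_cases hr : 0 ≤ k + r
  · rw [if_pos hk, if_pos hr, osc_comm, drv_mulX, quad_mulX, lapl_mulX, if_pos hk, if_pos hr,
      if_neg (by omega), if_neg (by omega)]
    simp
  · rw [if_pos hk, if_neg hr, osc_comm, drv_mulX, quad_mulX, lapl_mulX, if_pos hk, if_neg hr,
      if_pos (by omega), if_neg (by omega)]
    simp
  · rw [if_neg hk, if_pos hr, osc_comm, drv_pd, quad_pd, lapl_pd, if_neg hk, if_neg (by omega),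
      if_pos (by omega), if_neg (by omega)]
    simp
  · rw [if_neg hk, if_neg hr, osc_comm, drv_pd, quad_pd, lapl_pd, if_neg hk, if_pos (by omega),
      if_neg (by omega), if_neg (by omega)]
    simp

theorem osc_bLow (r : ℤ) (φ : ℤ → ℂ) (k : ℤ) :
    osc r φ * bLow k - bLow k * osc r φ = -φ (k - r) • bLow (k - r) := by
  have h := osc_comm r φ (mulX k)
  unfold bLow
  by_cases hk : 0 ≤ k <;> by_cases hr : 0 ≤ k - r
  · rw [if_pos hk, if_pos hr, osc_comm, drv_pd, quad_pd, lapl_pd, if_pos hk, if_pos hr,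
      if_neg (by omega), if_neg (by omega)]
    simp
  · rw [if_pos hk, if_neg hr, osc_comm, drv_pd, quad_pd, lapl_pd, if_pos hk, if_neg hr,
      if_neg (by omega), if_pos (by omega)]
    module
  · rw [if_neg hk, if_pos hr, mul_smul_comm, smul_mul_assoc]
    refine (smul_sub (-1 : ℂ) _ _).symm.trans ?_
    rw [h, drv_mulX, quad_mulX, lapl_mulX, if_neg hk, if_neg (by omega), if_neg (by omega),
      if_pos (by omega)]
    module
  · rw [if_neg hk, if_neg hr, mul_smul_comm, smul_mul_assoc]
    refine (smul_sub (-1 : ℂ) _ _).symm.trans ?_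
    rw [h, drv_mulX, quad_mulX, lapl_mulX, if_neg hk, if_pos (by omega), if_neg (by omega),
      if_neg (by omega)]
    module

/-- An operator that commutes with all oscillators is a scalar. -/
theorem eq_zero_of_commute {T : Module.End ℂ Fock} (h : ∀ k, T * bStar k = bStar k * T)
    (h' : ∀ k, T * bLow k = bLow k * T) (h₀ : constantCoeff (T 1) = 0) : T = 0 := by
  have hX : ∀ k, T * mulX k = mulX k * T := by
    intro k
    by_cases hk : 0 ≤ k
    · simpa [bStar, hk] using h k
    · have := h' k
      rw [bLow, if_neg hk, mul_smul_comm, smul_mul_assoc] at this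
      exact smul_right_injective _ (by norm_num : (-1 : ℂ) ≠ 0) this
  have hD : ∀ k, T * pd k = pd k * T := by
    intro k
    by_cases hk : 0 ≤ k
    · simpa [bLow, hk] using h' k
    · simpa [bStar, hk] using h k
  -- All partial derivatives of `T 1` vanish, so `T 1` is constant, and its constant term is zero by
  -- assumption. As `T` commutes with multiplication by the variables, it then vanishes everywhere.
  have h₁ : T 1 = 0 := by
    ext m
    rw [coeff_zero]
    by_cases hm : m = 0
    · rw [hm]; exact h₀
    · obtain ⟨i, hi⟩ := Finsupp.ne_iff.1 hm
      obtain ⟨m, rfl⟩ : ∃ m', m = m' + Finsupp.single i 1 :=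
        ⟨m - Finsupp.single i 1, (tsub_add_cancel_of_le (by
          rw [Finsupp.single_le_iff]; exact Nat.one_le_iff_ne_zero.2 hi)).symm⟩
      have hd := congrArg (coeff m) (LinearMap.congr_fun (hD i) 1)
      rw [Module.End.mul_apply, Module.End.mul_apply, pd_apply, pd_apply, pderiv_one, map_zero,
        coeff_pderiv, coeff_zero] at hd
      exact (mul_eq_zero.1 hd.symm).resolve_right ((Nat.cast_add_one_ne_zero _))
  refine LinearMap.ext fun p => ?_
  rw [LinearMap.zero_apply]
  induction p using MvPolynomial.induction_on with
  | C a => rw [C_eq_smul_one, map_smul, h₁, smul_zero]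
  | add p q hp hq => rw [map_add, hp, hq, add_zero]
  | mul_X p k hp =>
    have := LinearMap.congr_fun (hX k) p
    rw [Module.End.mul_apply, Module.End.mul_apply, hp, map_zero, mulX_apply, mul_comm] at this
    exact this

theorem quad_one (r : ℤ) (φ : ℤ → ℂ) :
    quad r φ 1 = ∑ j ∈ Finset.Ico (-r) 0, -φ j • (X (j + r) * X j : Fock) := by
  simp [quad, mulX_apply, LinearMap.sum_apply]

theorem osc_one (r : ℤ) (φ : ℤ → ℂ) : osc r φ 1 = quad r φ 1 := by
  have h : lapl r φ 1 = 0 := by simp [lapl, LinearMap.sum_apply, pd_apply]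
  rw [osc_apply, LinearMap.add_apply, LinearMap.add_apply, h]
  simp

theorem constantCoeff_osc_one (r : ℤ) (φ : ℤ → ℂ) : constantCoeff (osc r φ 1) = 0 := by
  simp [osc_one, quad_one, map_sum]

/-- A constant survives only when two derivatives hit the two variables created from the vacuum. One
of these has a nonnegative and one a negative index, so they are distinct and there is only one
pairing. -/
theorem constantCoeff_osc_osc (r s : ℤ) (φ χ : ℤ → ℂ) :
    constantCoeff (osc r φ (osc s χ 1)) =
      if r + s = 0 then -∑ j ∈ Finset.Ico 0 (-r), φ j * χ (j + r) else 0 := by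
  have hq : constantCoeff (quad r φ (quad s χ 1)) = 0 := by
    simp [quad, LinearMap.sum_apply, mulX_apply, map_sum]
  have hd : ∀ k l, constantCoeff (drv r φ (X k * X l)) = 0 := by
    intro k l; simp [Derivation.leibniz]
  have hd' : constantCoeff ((drv r φ).toLinearMap (quad s χ 1)) = 0 := by
    rw [quad_one, map_sum, map_sum]
    refine Finset.sum_eq_zero fun j _ => ?_
    rw [map_smul]
    change constantCoeff (-χ j • drv r φ _) = 0
    simp [smul_eq_C_mul]
  have hl : ∀ i j k l : ℤ, 0 ≤ j → l < 0 → constantCoeff (pd i (pd j (X k * X l))) =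
      if k = j ∧ l = i then 1 else 0 := by
    intro i j k l hj hl
    rw [pd_apply, pd_apply, pderiv_mul, pderiv_X_of_ne (i := j) (j := l) (by omega), mul_zero,
      add_zero, pderiv_X]
    by_cases hk : k = j
    · subst hk
      by_cases hi : l = i
      · subst hi; simp
      · simp [hi, pderiv_X]
    · simp [hk]
  rw [osc_one, osc_apply, LinearMap.add_apply, LinearMap.add_apply, map_add, map_add, hq, hd',
    quad_one, zero_add, zero_add]
  have hs : ∀ i ∈ Finset.Ico 0 (-r), constantCoeff (φ i • (pd (i + r) * pd i)
      (∑ j ∈ Finset.Ico (-s) 0, -χ j • (X (j + s) * X j : Fock))) =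
      if r + s = 0 then -(φ i * χ (i + r)) else 0 := by
    intro i hi
    rw [Finset.mem_Ico] at hi
    rw [map_sum, constantCoeff_smul, map_sum]
    have ht : ∀ j ∈ Finset.Ico (-s) 0, constantCoeff ((pd (i + r) * pd i)
        (-χ j • (X (j + s) * X j : Fock))) = if j = i + r ∧ r + s = 0 then -χ (i + r) else 0 := by
      intro j hj
      rw [Finset.mem_Ico] at hj
      rw [map_smul, constantCoeff_smul, Module.End.mul_apply, hl _ _ _ _ hi.1 hj.2]
      by_cases h : j = i + r ∧ r + s = 0
      · rw [if_pos h, if_pos (by omega), h.1]; simp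
      · rw [if_neg h, if_neg (by omega)]; simp
    rw [Finset.sum_congr rfl ht]
    by_cases h : r + s = 0
    · simp only [h, and_true, if_true]
      rw [Finset.sum_ite_eq', if_pos (by rw [Finset.mem_Ico]; omega)]
      simp
    · simp [h]
  simp only [lapl, LinearMap.sum_apply, LinearMap.smul_apply, map_sum constantCoeff]
  rw [Finset.sum_congr rfl hs]
  split_ifs
  · rw [Finset.sum_neg_distrib]
  · simp

/-! ### Differential operators acting on the Fock space, and the cocycle -/

/-- The action of a differential operator on the Fock space. -/
def oscOp : DiffOp →ₗ[ℂ] Module.End ℂ Fock :=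
  Finsupp.lsum ℂ fun r => osc r ∘ₗ LinearMap.pi fun j => Polynomial.leval (j : ℂ)

theorem oscOp_mon (r : ℤ) (f : Polynomial ℂ) :
    oscOp (DiffOp.mon r f) = osc r fun j => f.eval (j : ℂ) := by
  simp [oscOp]; rfl

/-- Here `A` and `B` are two operators, `M` and `N` those of the two products of symbols, and `x` is
an oscillator. The hypothesis `h` says that the symbols obey the same commutation rule, so the
defect commutes with `x`, whatever the scalar `c`. -/
theorem commute_commutator {R : Type*} [Ring R] [Algebra ℂ R] {A B M N x u v w : R}
    {α β γ δ μ ν : ℂ} (c : ℂ) (hA : A * x - x * A = α • u) (hB : B * x - x * B = β • v)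
    (hAv : A * v - v * A = γ • w) (hBu : B * u - u * B = δ • w) (hM : M * x - x * M = μ • w)
    (hN : N * x - x * N = ν • w) (h : β * γ - α * δ = μ - ν) :
    (A * B - B * A - (M - N) - c • 1) * x = x * (A * B - B * A - (M - N) - c • 1) := by
  have h₁ : (A * B - B * A - (M - N) - c • 1) * x - x * (A * B - B * A - (M - N) - c • 1) =
      A * (B * x - x * B) - (B * x - x * B) * A + (A * x - x * A) * B - B * (A * x - x * A) -
        (M * x - x * M) + (N * x - x * N) - (c • (1 : R) * x - x * (c • (1 : R))) := by
    noncomm_ring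
  rw [← sub_eq_zero, h₁, hA, hB, hM, hN, smul_one_mul, mul_smul_one, sub_self, sub_zero,
    mul_smul_comm, smul_mul_assoc, mul_smul_comm, smul_mul_assoc]
  have h₂ : β • (A * v) - β • (v * A) + α • (u * B) - α • (B * u) - μ • w + ν • w =
      β • (A * v - v * A) - α • (B * u - u * B) - (μ - ν) • w := by module
  rw [h₂, hAv, hBu, ← h]
  module

/-- The defect of the commutation rule commutes with all oscillators, so `eq_zero_of_commute`
reduces the claim to a comparison of constant terms on the vacuum; this is where the cocycle comes
from. -/
theorem oscOp_comm_mon (r s : ℤ) (f g : Polynomial ℂ) :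
    oscOp (DiffOp.mon r f) * oscOp (DiffOp.mon s g) -
      oscOp (DiffOp.mon s g) * oscOp (DiffOp.mon r f) =
    oscOp (DiffOp.mul (DiffOp.mon r f) (DiffOp.mon s g) -
      DiffOp.mul (DiffOp.mon s g) (DiffOp.mon r f)) +
      DiffOp.psi (DiffOp.mon r f) (DiffOp.mon s g) • 1 := by
  refine sub_eq_zero.1 ((sub_add_eq_sub_sub _ _ _).trans ?_)
  rw [map_sub, DiffOp.mul_mon, DiffOp.mul_mon, oscOp_mon, oscOp_mon, oscOp_mon, oscOp_mon]
  refine eq_zero_of_commute (fun k => ?_) (fun k => ?_) ?_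
  · have h₁ := osc_bStar r (fun j => f.eval (j : ℂ)) (k + s)
    have h₂ := osc_bStar s (fun j => g.eval (j : ℂ)) (k + r)
    have h₃ := osc_bStar (s + r) (fun j => (DiffOp.shift r g * f).eval (j : ℂ)) k
    rw [add_assoc, add_comm s r] at h₁
    rw [add_assoc] at h₂
    rw [add_comm s r] at h₃ ⊢
    refine commute_commutator _ (osc_bStar r _ k) (osc_bStar s _ k) h₁ h₂ (osc_bStar (r + s) _ k)
      h₃ ?_
    simp only [Polynomial.eval_mul, DiffOp.eval_shift]
    push_cast
    ring
  · have h₁ := osc_bLow r (fun j => f.eval (j : ℂ)) (k - s)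
    have h₂ := osc_bLow s (fun j => g.eval (j : ℂ)) (k - r)
    have h₃ := osc_bLow (s + r) (fun j => (DiffOp.shift r g * f).eval (j : ℂ)) k
    rw [sub_sub, add_comm s r] at h₁
    rw [sub_sub] at h₂
    rw [add_comm s r] at h₃ ⊢
    refine commute_commutator _ (osc_bLow r _ k) (osc_bLow s _ k) h₁ h₂ (osc_bLow (r + s) _ k)
      h₃ ?_
    simp only [Polynomial.eval_mul, DiffOp.eval_shift]
    push_cast
    ring_nf
  · simp only [LinearMap.sub_apply, LinearMap.smul_apply, Module.End.mul_apply, map_sub,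
      Module.End.one_apply, constantCoeff_smul, constantCoeff_osc_one, constantCoeff_osc_osc,
      map_one, sub_zero, DiffOp.psi_mon, smul_eq_mul, mul_one, add_comm s r]
    split_ifs with hrs
    · obtain rfl : s = -r := by omega
      rw [DiffOp.cutSum_apply, neg_neg]
      -- The substitution of `j - r` for `j` moves the sum to the range used by `DiffOp.cutSum`.
      have h₁ : ∑ j ∈ Finset.Ico 0 r, g.eval ((j : ℤ) : ℂ) * f.eval ((j + -r : ℤ) : ℂ) =
          ∑ j ∈ Finset.Ico (-r) 0, (f * DiffOp.shift r g).eval (j : ℂ) := by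
        refine Finset.sum_bij' (fun j _ => j - r) (fun j _ => j + r) ?_ ?_ ?_ ?_ ?_
        · intro j hj; rw [Finset.mem_Ico] at hj ⊢; omega
        · intro j hj; rw [Finset.mem_Ico] at hj ⊢; omega
        · intro j _; omega
        · intro j _; omega
        · intro j _
          rw [Polynomial.eval_mul, DiffOp.eval_shift, mul_comm]
          push_cast
          ring_nf
      rw [h₁]
      simp only [Polynomial.eval_mul, DiffOp.eval_shift]
      push_cast
      ring
    · simp

theorem oscOp_comm (a b : DiffOp) : oscOp a * oscOp b - oscOp b * oscOp a =
    oscOp (DiffOp.mul a b - DiffOp.mul b a) + DiffOp.psi a b • 1 := by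
  induction a using Finsupp.induction_linear with
  | zero => simp
  | add a a' h h' =>
    simp only [map_add, LinearMap.add_apply, add_mul, mul_add, map_sub, add_smul] at h h' ⊢
    rw [add_sub_add_comm, h, h']
    module
  | single r f =>
  induction b using Finsupp.induction_linear with
  | zero => simp
  | add a a' h h' =>
    simp only [map_add, LinearMap.add_apply, add_mul, mul_add, map_sub, add_smul] at h h' ⊢
    rw [add_sub_add_comm, h, h']
    module
  | single s g => exact oscOp_comm_mon r s f g

attribute [local instance] LieRing.ofAssociativeRing

/-- The oscillator representation; the central element acts as `1`. -/
def rep : HatD →ₗ⁅ℂ⁆ Module.End ℂ Fock where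
  toFun x := oscOp x.1 + x.2 • 1
  map_add' x y := by
    rw [HatD.fst_add, HatD.snd_add, map_add, add_smul]
    exact add_add_add_comm _ _ _ _
  map_smul' c x := by
    rw [HatD.fst_smul, HatD.snd_smul, map_smul, smul_eq_mul, mul_smul, smul_add]
    rfl
  map_lie' {x y} := by
    change oscOp (DiffOp.mul x.1 y.1 - DiffOp.mul y.1 x.1) + DiffOp.psi x.1 y.1 • 1 =
      (oscOp x.1 + x.2 • 1) * (oscOp y.1 + y.2 • 1) - (oscOp y.1 + y.2 • 1) * (oscOp x.1 + x.2 • 1)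
    rw [← oscOp_comm]
    exact h _ _ _ _
where
  h {R : Type} [Ring R] [Algebra ℂ R] (A B : R) (a b : ℂ) :
      A * B - B * A = (A + a • 1) * (B + b • 1) - (B + b • 1) * (A + a • 1) := by
    simp only [mul_add, add_mul, smul_one_mul, mul_smul_one, smul_add]
    rw [smul_comm a b]
    abel

end Osc

attribute [local instance] LieRing.ofAssociativeRing in
/-- The representation of `W⁻ / ⟨C - 1⟩` on the Fock space. -/
def oscRep : WMinusOne →ₐ[ℂ] Module.End ℂ Osc.Fock :=
  RingQuot.liftAlgHom ℂ ⟨UniversalEnvelopingAlgebra.lift ℂ (Osc.rep.comp HatDMinus.incl), by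
    rintro _ _ ⟨⟩
    rw [wC, UniversalEnvelopingAlgebra.lift_ι_apply, map_one]
    change Osc.oscOp 0 + (1 : ℂ) • 1 = 1
    rw [map_zero, zero_add, one_smul]⟩

/-- The algebra has a unital representation on the nonzero Fock space. -/
instance : Nontrivial WMinusOne := oscRep.toRingHom.domain_nontrivial

attribute [local instance] LieRing.ofAssociativeRing in
theorem wOdd_comm (n m : ℤ) : wOdd n * wOdd m - wOdd m * wOdd n =
    (if n + m + 1 = 0 then 2 * (n : ℂ) + 1 else 0) • wC := by
  have h := LieHom.map_lie (UniversalEnvelopingAlgebra.ι ℂ (L := HatDMinus))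
  refine (h _ _).symm.trans ?_
  rw [wC, ← map_smul]
  congr 1
  refine Subtype.ext (HatD.ext ?_ ?_)
  · change DiffOp.mul (DiffOp.mon _ 1) (DiffOp.mon _ 1) -
      DiffOp.mul (DiffOp.mon _ 1) (DiffOp.mon _ 1) = _ • 0
    rw [DiffOp.mul_mon, DiffOp.mul_mon, add_comm, smul_zero]
    simp [DiffOp.shift]
  · change DiffOp.psi (DiffOp.mon _ 1) (DiffOp.mon _ 1) = _ • 1
    rw [DiffOp.psi_mon]
    by_cases hnm : n + m + 1 = 0
    · rw [if_pos hnm, if_pos (by omega), DiffOp.cutSum_apply]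
      have h₁ : ∀ j : ℤ, (1 * DiffOp.shift (2 * n + 1) 1 : Polynomial ℂ).eval (j : ℂ) = 1 := by
        intro j; simp [DiffOp.shift]
      simp only [h₁, Finset.sum_const, Int.card_Ico, nsmul_eq_mul, mul_one, smul_eq_mul]
      -- With constant symbols `cutSum` counts integers with sign. At most one of the two intervals
      -- is nonempty, so the difference is `2 * n + 1` for either sign.
      have h₂ : ((0 - -(2 * n + 1)).toNat : ℤ) - ((-(2 * n + 1) - 0).toNat : ℤ) = 2 * n + 1 := by
        omega
      have h₃ := congrArg (Int.cast : ℤ → ℂ) h₂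
      push_cast at h₃
      convert h₃ using 3
    · rw [if_neg hnm, if_neg (by omega), zero_smul]

end

end TwistedHeis

namespace TwistedHeis

noncomputable section

/-! ## A model of the twisted Heisenberg category -/

namespace Model

/-- The vector space spanned by the finite sequences of labels with a parity. -/
abbrev V : Type := List (ℕ × Bool) →₀ ℂ

/-- The empty sequence. -/
def nil : V := Finsupp.single [] 1

/-- Adding a label on the left. -/
def cons (a : ℕ × Bool) : Module.End ℂ V := Finsupp.lmapDomain ℂ ℂ (List.cons a)

/-- A linear map given by its values on the basis. -/
def lin (g : List (ℕ × Bool) → V) : Module.End ℂ V := Finsupp.linearCombination ℂ g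

theorem lin_single (g : List (ℕ × Bool) → V) (w : List (ℕ × Bool)) :
    lin g (Finsupp.single w 1) = g w := by
  simp [lin]

theorem cons_single (a : ℕ × Bool) (w : List (ℕ × Bool)) :
    cons a (Finsupp.single w 1) = Finsupp.single (a :: w) 1 := by
  simp [cons]

theorem end_ext {A B : Module.End ℂ V}
    (h : ∀ w, A (Finsupp.single w 1) = B (Finsupp.single w 1)) : A = B := by
  ext w : 2
  exact h w

theorem hom_induction {A B : Module.End ℂ V} (h₀ : A nil = B nil)
    (h : ∀ a v, A v = B v → A (cons a v) = B (cons a v)) : A = B := by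
  refine end_ext fun w => ?_
  induction w with
  | nil => exact h₀
  | cons a w ih => rw [← cons_single]; exact h a _ ih

theorem hom_cases {A B : Module.End ℂ V} (h₀ : A nil = B nil)
    (h : ∀ a v, A (cons a v) = B (cons a v)) : A = B := hom_induction h₀ fun a v _ => h a v

/-- The linear map defined by recursion on the sequence. -/
def fold (g : ℕ × Bool → List (ℕ × Bool) → V → V) (v₀ : V) : List (ℕ × Bool) → V
  | [] => v₀
  | a :: w => g a w (fold g v₀ w)

/-- The linear map defined by cases on the first label. -/
def byHead (g : ℕ × Bool → Module.End ℂ V) : Module.End ℂ V :=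
  lin fun w => w.casesOn 0 fun a w => g a (Finsupp.single w 1)

@[simp] theorem byHead_nil (g : ℕ × Bool → Module.End ℂ V) : byHead g nil = 0 := lin_single _ _

@[simp] theorem byHead_cons (g : ℕ × Bool → Module.End ℂ V) (a : ℕ × Bool) (v : V) :
    byHead g (cons a v) = g a v := by
  refine LinearMap.congr_fun (f := byHead g * cons a) (g := g a) (end_ext fun w => ?_) v
  rw [Module.End.mul_apply, cons_single]
  exact lin_single _ _

/-- The sign of a parity. -/
def sgn (b : Bool) : ℂ := if b then -1 else 1

@[simp] theorem sgn_true : sgn true = -1 := rfl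
@[simp] theorem sgn_false : sgn false = 1 := rfl
@[simp] theorem sgn_mul_self (b : Bool) : sgn b * sgn b = 1 := by cases b <;> simp
@[simp] theorem sgn_not (b : Bool) : sgn (!b) = -sgn b := by cases b <;> simp

/-- Renaming the labels. -/
def rel (φ : ℕ → ℕ) : Module.End ℂ V :=
  lin fun w => Finsupp.single (w.map (Prod.map φ id)) 1

/-- The projection to the sequences without the label `i`. -/
def zz (i : ℕ) : Module.End ℂ V :=
  lin fun w => if i ∈ w.map Prod.fst then 0 else Finsupp.single w 1

/-- The projection to the sequences with the label `i`. -/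
def ee (i : ℕ) : Module.End ℂ V :=
  lin fun w => if i ∈ w.map Prod.fst then Finsupp.single w 1 else 0

/-- The parity operator. -/
def par : Module.End ℂ V :=
  lin (fold (fun a _ v => sgn a.2 • cons a v) nil)

/-- Changing the parity of the first occurrence of the label `i`. -/
def cl (i : ℕ) : Module.End ℂ V :=
  lin (fold (fun a w v => sgn a.2 • if a.1 = i then Finsupp.single ((i, !a.2) :: w) 1 else cons a v) 0)

/-- The projection to the empty sequence. -/
def pnil : Module.End ℂ V := lin fun w => if w = [] then nil else 0

section

variable (a : ℕ × Bool) (v : V) (φ : ℕ → ℕ) (i : ℕ)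

theorem lin_cons_eq {g : List (ℕ × Bool) → V} {B : Module.End ℂ V}
    (h : ∀ w, g (a :: w) = B (Finsupp.single w 1)) : lin g (cons a v) = B v := by
  refine LinearMap.congr_fun (f := lin g * cons a) (g := B) (end_ext fun w => ?_) v
  rw [Module.End.mul_apply, cons_single, lin_single, h]

@[simp] theorem rel_nil : rel φ nil = nil := lin_single _ _

@[simp] theorem rel_cons : rel φ (cons a v) = cons (φ a.1, a.2) (rel φ v) :=
  lin_cons_eq a v (B := cons (φ a.1, a.2) * rel φ) fun w => by
    rw [Module.End.mul_apply, rel, lin_single, cons_single]; rfl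

@[simp] theorem zz_nil : zz i nil = nil := lin_single _ _

@[simp] theorem zz_cons : zz i (cons a v) = if a.1 = i then 0 else cons a (zz i v) := by
  by_cases h : a.1 = i
  · rw [if_pos h]
    exact lin_cons_eq a v (B := 0) fun w => by simp [h]
  · rw [if_neg h]
    refine lin_cons_eq a v (B := cons a * zz i) fun w => ?_
    rw [Module.End.mul_apply, zz, lin_single]
    by_cases h' : i ∈ w.map Prod.fst
    · simp only [List.map_cons, List.mem_cons, h', or_true, if_true, map_zero]
    · simp only [List.map_cons, List.mem_cons, h', Ne.symm h, or_self, if_false, cons_single]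

@[simp] theorem ee_nil : ee i nil = 0 := lin_single _ _

theorem zz_add_ee : zz i v + ee i v = v := by
  refine LinearMap.congr_fun (f := zz i + ee i) (g := 1) (end_ext fun w => ?_) v
  rw [LinearMap.add_apply, zz, ee, lin_single, lin_single]
  split_ifs <;> simp

@[simp] theorem ee_cons : ee i (cons a v) = if a.1 = i then cons a v else cons a (ee i v) := by
  have h := zz_add_ee (cons a v) i
  rw [zz_cons] at h
  split_ifs at h ⊢ with h'
  · exact (zero_add _).symm.trans h
  · refine add_left_cancel (h.trans ?_)
    rw [← map_add, zz_add_ee]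

@[simp] theorem par_nil : par nil = nil := lin_single _ _

@[simp] theorem par_cons : par (cons a v) = sgn a.2 • cons a (par v) :=
  lin_cons_eq a v (B := sgn a.2 • (cons a * par)) fun w => by
    rw [LinearMap.smul_apply, Module.End.mul_apply, par, lin_single]; rfl

@[simp] theorem cl_nil : cl i nil = 0 := lin_single _ _

@[simp] theorem cl_cons : cl i (cons a v) =
    sgn a.2 • if a.1 = i then cons (i, !a.2) v else cons a (cl i v) := by
  by_cases h : a.1 = i
  · rw [if_pos h]
    exact lin_cons_eq a v (B := sgn a.2 • cons (i, !a.2)) fun w => by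
      rw [LinearMap.smul_apply, cons_single, fold, if_pos h]
  · rw [if_neg h]
    exact lin_cons_eq a v (B := sgn a.2 • (cons a * cl i)) fun w => by
      rw [LinearMap.smul_apply, Module.End.mul_apply, cl, lin_single, fold, if_neg h]

@[simp] theorem pnil_nil : pnil nil = nil := lin_single _ _

@[simp] theorem pnil_cons : pnil (cons a v) = 0 :=
  lin_cons_eq a v (B := 0) fun w => by simp

end

/-! ### Relations between the basic operators -/

theorem rel_rel (φ χ : ℕ → ℕ) (v : V) : rel φ (rel χ v) = rel (φ ∘ χ) v := by
  refine LinearMap.congr_fun (f := rel φ * rel χ) (hom_induction (by simp) fun a v h => ?_) v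
  simp only [Module.End.mul_apply] at h
  simp [h]

theorem rel_id (v : V) : rel id v = v := by
  refine LinearMap.congr_fun (g := 1) (hom_induction (by simp) fun a v h => ?_) v
  simp only [Module.End.one_apply] at h
  simp [h]

theorem par_par (v : V) : par (par v) = v := by
  refine LinearMap.congr_fun (f := par * par) (g := 1) (hom_induction (by simp) fun a v h => ?_) v
  simp only [Module.End.mul_apply, Module.End.one_apply] at h
  simp [h, smul_smul]

theorem par_rel (φ : ℕ → ℕ) (v : V) : par (rel φ v) = rel φ (par v) := by
  refine LinearMap.congr_fun (f := par * rel φ) (g := rel φ * par)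
    (hom_induction (by simp) fun a v h => ?_) v
  simp only [Module.End.mul_apply] at h
  simp [h]

theorem par_zz (i : ℕ) (v : V) : par (zz i v) = zz i (par v) := by
  refine LinearMap.congr_fun (f := par * zz i) (g := zz i * par)
    (hom_induction (by simp) fun a v h => ?_) v
  simp only [Module.End.mul_apply] at h
  by_cases h' : a.1 = i <;> simp [h, h']

theorem par_cl (i : ℕ) (v : V) : par (cl i v) = (-1 : ℂ) • cl i (par v) := by
  refine LinearMap.congr_fun (f := par * cl i) (g := (-1 : ℂ) • (cl i * par))
    (hom_induction (by simp) fun a v h => ?_) v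
  simp only [Module.End.mul_apply, LinearMap.smul_apply] at h
  by_cases h' : a.1 = i <;> simp [h, h', smul_smul]

theorem zz_zz (i k : ℕ) (v : V) : zz i (zz k v) = zz k (zz i v) := by
  refine LinearMap.congr_fun (f := zz i * zz k) (g := zz k * zz i)
    (hom_induction (by simp) fun a v h => ?_) v
  simp only [Module.End.mul_apply] at h
  by_cases h' : a.1 = i <;> by_cases h'' : a.1 = k <;> simp [h, h', h''] <;> simp_all

theorem zz_zz_self (i : ℕ) (v : V) : zz i (zz i v) = zz i v := by
  refine LinearMap.congr_fun (f := zz i * zz i) (hom_induction (by simp) fun a v h => ?_) v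
  simp only [Module.End.mul_apply] at h
  by_cases h' : a.1 = i <;> simp [h, h']

theorem rel_zz {φ : ℕ → ℕ} (hφ : φ.Injective) (i : ℕ) (v : V) :
    rel φ (zz i v) = zz (φ i) (rel φ v) := by
  refine LinearMap.congr_fun (f := rel φ * zz i) (g := zz (φ i) * rel φ)
    (hom_induction (by simp) fun a v h => ?_) v
  simp only [Module.End.mul_apply] at h
  by_cases h' : a.1 = i <;> simp [h, h', hφ.eq_iff]

theorem rel_cl {φ : ℕ → ℕ} (hφ : φ.Injective) (i : ℕ) (v : V) :
    rel φ (cl i v) = cl (φ i) (rel φ v) := by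
  refine LinearMap.congr_fun (f := rel φ * cl i) (g := cl (φ i) * rel φ)
    (hom_induction (by simp) fun a v h => ?_) v
  simp only [Module.End.mul_apply] at h
  by_cases h' : a.1 = i <;> simp [h, h', hφ.eq_iff]

theorem zz_cl {i k : ℕ} (v : V) : zz i (cl k v) = cl k (zz i v) := by
  refine LinearMap.congr_fun (f := zz i * cl k) (g := cl k * zz i)
    (hom_induction (by simp) fun a v h => ?_) v
  simp only [Module.End.mul_apply] at h
  by_cases h' : a.1 = i <;> by_cases h'' : a.1 = k <;> simp_all

/-- The operators `cl i` are Clifford generators: the factor `sgn a.2` is the Koszul sign for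
passing an odd entry. At the entry `i` itself the same factor makes the square -1, as the relation
for downward dots demands. -/
theorem cl_cl {i k : ℕ} (hik : i ≠ k) (v : V) : cl i (cl k v) = (-1 : ℂ) • cl k (cl i v) := by
  refine LinearMap.congr_fun (f := cl i * cl k) (g := (-1 : ℂ) • (cl k * cl i))
    (hom_induction (by simp) fun a v h => ?_) v
  simp only [Module.End.mul_apply, LinearMap.smul_apply] at h
  by_cases h' : a.1 = i <;> by_cases h'' : a.1 = k <;> simp_all [smul_smul]

theorem cl_cl_self (i : ℕ) (v : V) : cl i (cl i v) = (-1 : ℂ) • ee i v := by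
  refine LinearMap.congr_fun (f := cl i * cl i) (g := (-1 : ℂ) • ee i)
    (hom_induction (by simp) fun a v h => ?_) v
  simp only [Module.End.mul_apply, LinearMap.smul_apply] at h
  obtain ⟨k, ε⟩ := a
  by_cases h' : k = i
  · subst h'; simp [smul_smul]
  · simp [h, h', smul_smul]

theorem cl_zz_self (i : ℕ) (v : V) : cl i (zz i v) = 0 := by
  refine LinearMap.congr_fun (f := cl i * zz i) (g := 0)
    (hom_induction (by simp) fun a v h => ?_) v
  simp only [Module.End.mul_apply, LinearMap.zero_apply] at h
  by_cases h' : a.1 = i <;> simp_all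

/-- An injective renaming of the labels followed by the inverse renaming. -/
theorem rel_zz_eq {φ χ : ℕ → ℕ} {i : ℕ} (h : ∀ n, n ≠ i → φ n = χ n) (v : V) :
    rel φ (zz i v) = rel χ (zz i v) := by
  refine LinearMap.congr_fun (f := rel φ * zz i) (g := rel χ * zz i)
    (hom_induction (by simp) fun a v h' => ?_) v
  simp only [Module.End.mul_apply] at h'
  by_cases h'' : a.1 = i <;> simp_all

theorem zz_rel_of_forall_ne {φ : ℕ → ℕ} {i : ℕ} (h : ∀ n, φ n ≠ i) (v : V) :
    zz i (rel φ v) = rel φ v := by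
  refine LinearMap.congr_fun (f := zz i * rel φ) (hom_induction (by simp) fun a v h' => ?_) v
  simp only [Module.End.mul_apply] at h'
  simp_all

theorem ee_apply (i : ℕ) (v : V) : ee i v = v - zz i v := eq_sub_of_add_eq' (zz_add_ee v i)

theorem rel_ee {φ : ℕ → ℕ} (hφ : φ.Injective) (i : ℕ) (v : V) :
    rel φ (ee i v) = ee (φ i) (rel φ v) := by
  simp only [ee_apply, map_sub, rel_zz hφ]

theorem zz_ee (i k : ℕ) (v : V) : zz i (ee k v) = ee k (zz i v) := by
  simp only [ee_apply, map_sub, zz_zz i k]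

theorem ee_ee (i k : ℕ) (v : V) : ee i (ee k v) = ee k (ee i v) := by
  rw [ee_apply k, ee_apply k, map_sub, zz_ee]

theorem ee_ee_self (i : ℕ) (v : V) : ee i (ee i v) = ee i v := by
  simp only [ee_apply, map_sub, zz_zz_self]; abel

theorem ee_zz_self (i : ℕ) (v : V) : ee i (zz i v) = 0 := by
  rw [ee_apply, zz_zz_self, sub_self]

theorem zz_ee_self (i : ℕ) (v : V) : zz i (ee i v) = 0 := by
  rw [zz_ee, ee_zz_self]

theorem ee_cl (i k : ℕ) (v : V) : ee i (cl k v) = cl k (ee i v) := by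
  simp only [ee_apply, map_sub, zz_cl]

theorem cl_ee_self (i : ℕ) (v : V) : cl i (ee i v) = cl i v := by
  rw [ee_apply, map_sub, cl_zz_self, sub_zero]

theorem par_ee (i : ℕ) (v : V) : par (ee i v) = ee i (par v) := by
  simp only [ee_apply, map_sub, par_zz]

theorem ee_rel_of_forall_ne {φ : ℕ → ℕ} {i : ℕ} (h : ∀ n, φ n ≠ i) (v : V) :
    ee i (rel φ v) = 0 := by
  rw [ee_apply, zz_rel_of_forall_ne h, sub_self]

end Model

end

end TwistedHeis

namespace TwistedHeis

noncomputable section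

namespace Model

/-! ### Twisting by the parity operator -/

/-- Conjugation by the parity operator if `b` is true. -/
def tw (b : Bool) (A : Module.End ℂ V) : Module.End ℂ V := if b then par * A * par else A

section tw

variable (b : Bool) (A B : Module.End ℂ V) (v : V)

@[simp] theorem tw_false : tw false A = A := rfl
@[simp] theorem tw_true_apply : tw true A v = par (A (par v)) := rfl

@[simp] theorem tw_mul : tw b (A * B) = tw b A * tw b B := by
  cases b
  · rfl
  · refine LinearMap.ext fun v => ?_; simp [par_par]

@[simp] theorem tw_one : tw b 1 = 1 := by
  cases b
  · rfl
  · refine LinearMap.ext fun v => ?_; simp [par_par]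

@[simp] theorem tw_zero : tw b 0 = 0 := by
  cases b
  · rfl
  · refine LinearMap.ext fun v => ?_; simp

@[simp] theorem tw_add : tw b (A + B) = tw b A + tw b B := by
  cases b
  · rfl
  · refine LinearMap.ext fun v => ?_; simp

@[simp] theorem tw_smul (r : ℂ) : tw b (r • A) = r • tw b A := by
  cases b
  · rfl
  · refine LinearMap.ext fun v => ?_; simp

theorem tw_tw_self : tw b (tw b A) = A := by
  cases b
  · rfl
  · refine LinearMap.ext fun v => ?_; simp [par_par]

theorem tw_comm (b' : Bool) : tw b (tw b' A) = tw b' (tw b A) := by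
  cases b <;> cases b' <;> rfl

end tw

/-! ### Inserting and deleting a label -/

/-- The order embedding that omits `j`. -/
def shift (j n : ℕ) : ℕ := if n < j then n else n + 1

/-- A left inverse of `shift j`. -/
def pred (j n : ℕ) : ℕ := if n ≤ j then n else n - 1

/-- Making room for a new label `j`. -/
def sh (j : ℕ) : Module.End ℂ V := rel (shift j)

/-- Removing the label `j`. -/
def del (j : ℕ) : Module.End ℂ V := rel (pred j) * zz j

theorem shift_ne (j n : ℕ) : shift j n ≠ j := by
  unfold shift; split_ifs <;> omega

theorem shift_injective (j : ℕ) : (shift j).Injective := by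
  intro m n; unfold shift; split_ifs <;> omega

theorem del_apply (j : ℕ) (v : V) : del j v = rel (pred j) (zz j v) := rfl

theorem zz_sh (j : ℕ) (v : V) : zz j (sh j v) = sh j v := zz_rel_of_forall_ne (shift_ne j) v

theorem del_sh (j : ℕ) (v : V) : del j (sh j v) = v := by
  rw [del_apply, zz_sh, sh, rel_rel]
  refine Eq.trans (congrArg (fun φ => rel φ v) (funext fun n => ?_)) (rel_id v)
  simp only [Function.comp_apply, shift, pred, id]
  split_ifs <;> omega

theorem sh_del (j : ℕ) (v : V) : sh j (del j v) = zz j v := by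
  rw [del_apply, sh, rel_rel]
  refine (rel_zz_eq (χ := id) (fun n hn => ?_) v).trans (rel_id _)
  simp only [Function.comp_apply, shift, pred, id]
  split_ifs <;> omega

theorem del_zz (j : ℕ) (v : V) : del j (zz j v) = del j v := by
  rw [del_apply, zz_zz_self, del_apply]

/-- As `del j` vanishes off the image of `sh j` and is inverse to it there, a commutation rule for
deletion follows from the rules for `sh` and `zz`. -/
theorem del_comm {j j' : ℕ} {A B : Module.End ℂ V} (h₁ : ∀ v, A (sh j v) = sh j' (B v))
    (h₂ : ∀ v, A (zz j v) = zz j' (A v)) (v : V) : del j' (A v) = B (del j v) := by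
  rw [← del_zz, ← h₂, ← sh_del, h₁, del_sh]

theorem del_cons (j : ℕ) (a : ℕ × Bool) (v : V) :
    del j (cons a v) = if a.1 = j then 0 else cons (pred j a.1, a.2) (del j v) := by
  rw [del_apply, zz_cons]
  split_ifs <;> simp [del_apply]

theorem sh_cons (j : ℕ) (a : ℕ × Bool) (v : V) :
    sh j (cons a v) = cons (shift j a.1, a.2) (sh j v) := rel_cons _ _ _

theorem par_sh (j : ℕ) (v : V) : par (sh j v) = sh j (par v) := par_rel _ _

theorem par_del (j : ℕ) (v : V) : par (del j v) = del j (par v) := by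
  rw [del_apply, par_rel, par_zz, del_apply]

theorem shift_of_lt {i j : ℕ} (h : i < j) : shift j i = i := if_pos h

theorem zz_sh_of_lt {i j : ℕ} (h : i < j) (v : V) : zz i (sh j v) = sh j (zz i v) := by
  rw [sh, rel_zz (shift_injective j), shift_of_lt h]

theorem ee_sh_of_lt {i j : ℕ} (h : i < j) (v : V) : ee i (sh j v) = sh j (ee i v) := by
  rw [sh, rel_ee (shift_injective j), shift_of_lt h]

theorem cl_sh_of_lt {i j : ℕ} (h : i < j) (v : V) : cl i (sh j v) = sh j (cl i v) := by
  rw [sh, rel_cl (shift_injective j), shift_of_lt h]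

theorem del_zz_of_lt {i j : ℕ} (h : i < j) (v : V) : del j (zz i v) = zz i (del j v) :=
  del_comm (fun v => zz_sh_of_lt h v) (fun v => zz_zz i j v) v

theorem del_cl_of_lt {i j : ℕ} (h : i < j) (v : V) : del j (cl i v) = cl i (del j v) :=
  del_comm (fun v => cl_sh_of_lt h v) (fun v => (zz_cl v).symm) v

/-! ### Families of operators -/

/-- Families of operators, one for every number of strands to the left. -/
abbrev Fam : Type := ℕ → Module.End ℂ V

/-- The renamings from level `j` to level `j'`. -/
structure Adm (j j' : ℕ) (φ : ℕ → ℕ) : Prop where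
  inj : φ.Injective
  lt : ∀ n < j, φ n < j'
  -- Labels from `j` on are the ones that further downward strands will introduce in order, so a
  -- renaming has to translate them rigidly.
  add : ∀ t, φ (j + t) = j' + t

namespace Adm

variable {j j' : ℕ} {φ : ℕ → ℕ}

theorem lt_iff (h : Adm j j' φ) (n : ℕ) : φ n < j' ↔ n < j := by
  refine ⟨fun hn => ?_, h.lt n⟩
  by_contra hj
  obtain ⟨t, rfl⟩ := Nat.exists_eq_add_of_le (not_lt.1 hj)
  rw [h.add] at hn
  omega

theorem eq (h : Adm j j' φ) : φ j = j' := h.add 0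

theorem succ (h : Adm j j' φ) : Adm (j + 1) (j' + 1) φ where
  inj := h.inj
  lt n hn := by
    rcases Nat.lt_succ_iff_lt_or_eq.1 hn with hn | rfl
    · exact (h.lt n hn).trans (Nat.lt_succ_self _)
    · rw [h.eq]; exact Nat.lt_succ_self _
  add t := by rw [Nat.add_assoc, h.add, Nat.add_assoc]

theorem rel_sh (h : Adm j j' φ) (v : V) : rel φ (sh j v) = sh j' (rel φ v) := by
  rw [sh, sh, rel_rel, rel_rel]
  congr 2
  funext n
  simp only [Function.comp_apply, shift, h.lt_iff]
  split_ifs with hn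
  · rfl
  · obtain ⟨t, rfl⟩ := Nat.exists_eq_add_of_le (not_lt.1 hn)
    rw [Nat.add_assoc, h.add, h.add, Nat.add_assoc]

theorem rel_del (h : Adm j j' φ) (v : V) : rel φ (del j v) = del j' (rel φ v) := by
  refine (del_comm (fun v => h.rel_sh v) (fun v => ?_) v).symm
  rw [rel_zz h.inj, h.eq]

end Adm

theorem adm_shift (j : ℕ) : Adm j (j + 1) (shift j) where
  inj := shift_injective j
  lt n hn := by rw [shift_of_lt hn]; omega
  add t := by unfold shift; split_ifs <;> omega

theorem adm_swap {i k j : ℕ} (hi : i < j) (hk : k < j) : Adm j j (Equiv.swap i k) where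
  inj := (Equiv.swap i k).injective
  lt n hn := by
    rw [Equiv.swap_apply_def]; split_ifs <;> omega
  add t := Equiv.swap_apply_of_ne_of_ne (by omega) (by omega)

/-- Families of operators that do not interfere with the strands to the left. -/
structure Natural (T : Fam) : Prop where
  rel : ∀ {j j' φ}, Adm j j' φ → ∀ v, T j' (rel φ v) = rel φ (T j v)
  zz : ∀ {i j}, i < j → ∀ v, T j (zz i v) = zz i (T j v)
  -- Twisting by the parity operator encodes the sign for moving the odd operator `cl i` past the
  -- parts of `T`, without assuming `T` homogeneous.
  cl : ∀ {i j}, i < j → ∀ v, T j (cl i v) = cl i (tw true (T j) v)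

namespace Natural

variable {S T : Fam}

theorem ee (h : Natural T) {i j : ℕ} (hi : i < j) (v : V) : T j (ee i v) = ee i (T j v) := by
  simp only [ee_apply, map_sub, h.zz hi]

theorem sh (h : Natural T) (j : ℕ) (v : V) : T (j + 1) (sh j v) = sh j (T j v) :=
  h.rel (adm_shift j) v

theorem del (h : Natural T) (j : ℕ) (v : V) : del j (T (j + 1) v) = T j (del j v) :=
  del_comm (fun v => h.sh j v) (fun v => h.zz (Nat.lt_succ_self j) v) v

theorem one : Natural 1 where
  rel _ _ := rfl
  zz _ _ := rfl
  cl _ _ := by simp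

theorem zero : Natural 0 where
  rel _ _ := by simp
  zz _ _ := by simp
  cl _ _ := by simp

theorem add (hS : Natural S) (hT : Natural T) : Natural (S + T) where
  rel hφ v := by simp [hS.rel hφ, hT.rel hφ]
  zz hi v := by simp [hS.zz hi, hT.zz hi]
  cl hi v := by simp [hS.cl hi, hT.cl hi]

theorem smul (r : ℂ) (hT : Natural T) : Natural (r • T) where
  rel hφ v := by simp [hT.rel hφ]
  zz hi v := by simp [hT.zz hi]
  cl hi v := by simp [hT.cl hi]

theorem mul (hS : Natural S) (hT : Natural T) : Natural (S * T) where
  rel hφ v := by simp [hS.rel hφ, hT.rel hφ]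
  zz hi v := by simp [hS.zz hi, hT.zz hi]
  cl hi v := by simp [hS.cl hi, hT.cl hi, par_par]

theorem bar (b : Bool) (hT : Natural T) : Natural (fun j => tw b (T j)) := by
  cases b
  · exact hT
  · constructor
    · intro j j' φ hφ v; simp [par_rel, hT.rel hφ]
    · intro i j hi v; simp [par_zz, hT.zz hi]
    · intro i j hi v; simp [par_cl, hT.cl hi, par_par]

end Natural

/-! ### Adding strands on the left -/

/-- Adding an upward strand on the left. -/
def actP (T : Fam) : Fam := fun j =>
  byHead fun a => if a.1 < j then cons a * tw a.2 (T j) * zz a.1 else 0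

/-- Adding a downward strand on the left. -/
def actQ (T : Fam) : Fam := fun j => T (j + 1) * ee j

/-- Adding a strand on the left. -/
def actLetter : Letter → Fam → Fam
  | .P => actP
  | .Q => actQ

/-- Adding the strands of `X` on the left. -/
def act (X : Word) (T : Fam) : Fam := (FreeAddMonoid.toList X).foldr actLetter T

section act

variable (S T : Fam) (j : ℕ) (a : ℕ × Bool) (v : V)

@[simp] theorem act_zero : act 0 T = T := rfl
@[simp] theorem act_of (l : Letter) : act (FreeAddMonoid.of l) T = actLetter l T := rfl

@[simp] theorem act_add (X Y : Word) : act (X + Y) T = act X (act Y T) := by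
  simp [act, FreeAddMonoid.toList_add, List.foldr_append]

@[simp] theorem actLetter_P : actLetter .P T = actP T := rfl
@[simp] theorem actLetter_Q : actLetter .Q T = actQ T := rfl

@[simp] theorem actP_nil : actP T j nil = 0 := byHead_nil _

@[simp] theorem actP_cons :
    actP T j (cons a v) = if a.1 < j then cons a (tw a.2 (T j) (zz a.1 v)) else 0 := by
  rw [actP, byHead_cons]; split_ifs <;> rfl

@[simp] theorem actQ_apply : actQ T j v = T (j + 1) (ee j v) := rfl

theorem act_induction {p : (Fam → Fam) → Prop} (h₀ : p _root_.id) (hP : ∀ F, p F → p (actP ∘ F))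
    (hQ : ∀ F, p F → p (actQ ∘ F)) (X : Word) : p (act X) := by
  induction X using FreeAddMonoid.inductionOn' with
  | zero => exact h₀
  | of_add l X ih =>
    have : act (FreeAddMonoid.of l + X) = actLetter l ∘ act X := funext fun T => act_add T _ _
    rw [this]
    cases l
    · exact hP _ ih
    · exact hQ _ ih

variable {S T}

theorem Natural.actP (h : Natural T) : Natural (actP T) where
  rel {j j' φ} hφ v := by
    refine LinearMap.congr_fun (f := Model.actP T j' * Model.rel φ)
      (g := Model.rel φ * Model.actP T j) (hom_cases (by simp) fun a v => ?_) v
    have h' := (h.bar a.2).rel hφ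
    simp only [Module.End.mul_apply, rel_cons, actP_cons, hφ.lt_iff]
    split_ifs
    · rw [rel_cons, ← h', rel_zz hφ.inj]
    · simp
  zz {i j} hi v := by
    refine LinearMap.congr_fun (f := Model.actP T j * Model.zz i)
      (g := Model.zz i * Model.actP T j) (hom_cases (by simp) fun a v => ?_) v
    have h' := fun hi : i < j => (h.bar a.2).zz hi
    obtain ⟨k, ε⟩ := a
    by_cases ha : k = i
    · simp [ha, hi]
    · by_cases hj : k < j
      · simp [ha, hj, h' hi, zz_zz k]
      · simp [ha, hj]
  cl {i j} hi v := by
    refine LinearMap.congr_fun (f := Model.actP T j * Model.cl i)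
      (g := Model.cl i * tw true (Model.actP T j)) (hom_cases (by simp) fun a v => ?_) v
    obtain ⟨k, ε⟩ := a
    by_cases ha : k = i
    · subst ha
      cases ε <;> simp [hi, par_zz, par_par]
    · by_cases hj : k < j
      · cases ε <;> simp [ha, hj, h.cl hi, par_zz, zz_cl, par_par, par_cl]
      · simp [ha, hj]

theorem Natural.actQ (h : Natural T) : Natural (actQ T) where
  rel hφ v := by
    simp only [actQ_apply]
    rw [← h.rel hφ.succ, rel_ee hφ.inj, hφ.eq]
  zz {i j} hi v := by
    simp only [actQ_apply]
    rw [← zz_ee, h.zz (by omega)]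
  cl {i j} hi v := by
    simp [ee_cl, h.cl (show i < j + 1 by omega), par_ee]

theorem Natural.act (h : Natural T) (X : Word) : Natural (act X T) :=
  act_induction (p := fun F => Natural (F T)) h (fun _ h => h.actP) (fun _ h => h.actQ) X

/-- The product on the right contains the projection `zz` twice. Naturality of `T` moves the two
copies together, where they merge. -/
theorem actP_mul (S : Fam) (hT : Natural T) : actP (S * T) = actP S * actP T := by
  funext j
  refine hom_cases (by simp) fun a v => ?_
  by_cases hj : a.1 < j
  · simp [hj, ← (hT.bar a.2).zz hj, zz_zz_self]
  · simp [hj]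

theorem actQ_mul (S : Fam) (hT : Natural T) : actQ (S * T) = actQ S * actQ T := by
  funext j
  refine LinearMap.ext fun v => ?_
  simp [← hT.ee (Nat.lt_succ_self j), ee_ee_self]

theorem act_mul (S : Fam) (hT : Natural T) (X : Word) : act X (S * T) = act X S * act X T := by
  refine (act_induction (p := fun F => Natural (F T) ∧ F (S * T) = F S * F T) ⟨hT, rfl⟩
    (fun F h => ⟨h.1.actP, ?_⟩) (fun F h => ⟨h.1.actQ, ?_⟩) X).2
  · simp only [Function.comp_apply]; rw [h.2, actP_mul _ h.1]
  · simp only [Function.comp_apply]; rw [h.2, actQ_mul _ h.1]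

theorem act_add_fam (S T : Fam) (X : Word) : act X (S + T) = act X S + act X T := by
  refine act_induction (p := fun F => F (S + T) = F S + F T) rfl (fun F h => ?_) (fun F h => ?_) X <;>
    simp only [Function.comp_apply] <;> rw [h] <;> funext j
  · refine hom_cases (by simp) fun a v => ?_
    by_cases hj : a.1 < j <;> simp [hj]
  · refine LinearMap.ext fun v => ?_; simp

theorem act_smul_fam (r : ℂ) (T : Fam) (X : Word) : act X (r • T) = r • act X T := by
  refine act_induction (p := fun F => F (r • T) = r • F T) rfl (fun F h => ?_) (fun F h => ?_) X <;>
    simp only [Function.comp_apply] <;> rw [h] <;> funext j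
  · refine hom_cases (by simp) fun a v => ?_
    by_cases hj : a.1 < j <;> simp [hj]
  · refine LinearMap.ext fun v => ?_; simp

/-- Twisting all members of a family. -/
def bar (b : Bool) (T : Fam) : Fam := fun j => tw b (T j)

theorem actP_bar (b : Bool) (T : Fam) : actP (bar b T) = bar b (actP T) := by
  cases b
  · rfl
  · funext j
    refine hom_cases (by simp [bar]) fun a v => ?_
    obtain ⟨k, ε⟩ := a
    by_cases hj : k < j <;> cases ε <;> simp [bar, hj, par_par, par_zz]

theorem actQ_bar (b : Bool) (T : Fam) : actQ (bar b T) = bar b (actQ T) := by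
  cases b
  · rfl
  · funext j
    refine LinearMap.ext fun v => ?_
    simp [bar, par_ee]

theorem act_bar (b : Bool) (T : Fam) (X : Word) : act X (bar b T) = bar b (act X T) := by
  refine act_induction (p := fun F => F (bar b T) = bar b (F T)) rfl (fun F h => ?_)
    (fun F h => ?_) X <;> simp only [Function.comp_apply] <;> rw [h]
  · exact actP_bar b _
  · exact actQ_bar b _

end act

end Model

end

end TwistedHeis

namespace TwistedHeis

noncomputable section

namespace Model

theorem hom_cases₂ {A B : Module.End ℂ V} (h₀ : A nil = B nil)
    (h₁ : ∀ a, A (cons a nil) = B (cons a nil))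
    (h₂ : ∀ a b v, A (cons a (cons b v)) = B (cons a (cons b v))) : A = B :=
  hom_cases h₀ fun a => LinearMap.congr_fun (f := A * cons a) (g := B * cons a)
    (hom_cases (h₁ a) fun b v => h₂ a b v)

/-! ### The operators of the generating morphisms -/

/-- A power of `cl i`. -/
def clp (i : ℕ) (b : Bool) : Module.End ℂ V := if b then cl i else 1

@[simp] theorem clp_true (i : ℕ) : clp i true = cl i := rfl
@[simp] theorem clp_false (i : ℕ) : clp i false = 1 := rfl

/-- The operators of the hollow dot on an upward strand. -/
def fDotU : Fam := fun j =>
  byHead fun a => if a.1 < j then cons (a.1, !a.2) * zz a.1 else 0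

/-- The operators of the hollow dot on a downward strand. -/
def fDotD : Fam := cl

/-- The operators of the crossing. -/
def fCross : Fam := fun j => byHead fun a => byHead fun b =>
  if a.1 < j ∧ b.1 < j ∧ a.1 ≠ b.1 then
    sgn (a.2 && b.2) • (cons b * cons a * zz a.1 * zz b.1) else 0

/-- The operators of the cup `1 → QP`. -/
def fCupR : Fam := fun j => cons (j, false) * sh j

/-- The operators of the cap `QP → 1`. -/
def fCapL : Fam := fun j => byHead fun a => if a = (j, false) then del j else 0

/-- The operators of the cap `PQ → 1`. -/
def fCapR : Fam := fun j => byHead fun a =>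
  -- The new label `j` in the rest is replaced by the label of the upward strand, whose parity acts
  -- on that entry as a Clifford element. After the swap, `del j` removes sequences in which the
  -- label of the upward strand occurred already.
  if a.1 < j then del j * rel (Equiv.swap a.1 j) * clp j a.2 * ee j else 0

/-- A summand of the cup `1 → PQ`. -/
def cupTerm (j i : ℕ) : Module.End ℂ V :=
  -- The upward strand takes the label `i`, and the fresh label `j` replaces it in the rest. The two
  -- terms are the two parities of the upward strand.
  cons (i, false) * rel (Equiv.swap i j) * ee i * sh j -
    cons (i, true) * rel (Equiv.swap i j) * cl i * sh j

/-- The operators of the cup `1 → PQ`. -/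
def fCupL : Fam := fun j => ∑ i ∈ Finset.range j, cupTerm j i

section

variable (j i : ℕ) (a b : ℕ × Bool) (v : V)

@[simp] theorem fDotU_nil : fDotU j nil = 0 := byHead_nil _
@[simp] theorem fDotU_cons :
    fDotU j (cons a v) = if a.1 < j then cons (a.1, !a.2) (zz a.1 v) else 0 := by
  rw [fDotU, byHead_cons]; split_ifs <;> rfl

@[simp] theorem fDotD_apply : fDotD j v = cl j v := rfl

@[simp] theorem fCross_nil : fCross j nil = 0 := byHead_nil _
@[simp] theorem fCross_cons_nil : fCross j (cons a nil) = 0 := by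
  rw [fCross, byHead_cons, byHead_nil]
@[simp] theorem fCross_cons_cons : fCross j (cons a (cons b v)) =
    if a.1 < j ∧ b.1 < j ∧ a.1 ≠ b.1 then
      sgn (a.2 && b.2) • cons b (cons a (zz a.1 (zz b.1 v))) else 0 := by
  rw [fCross, byHead_cons, byHead_cons]; split_ifs <;> rfl

@[simp] theorem fCupR_apply : fCupR j v = cons (j, false) (sh j v) := rfl

@[simp] theorem fCapL_nil : fCapL j nil = 0 := byHead_nil _
@[simp] theorem fCapL_cons :
    fCapL j (cons a v) = if a = (j, false) then del j v else 0 := by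
  rw [fCapL, byHead_cons]; split_ifs <;> rfl

@[simp] theorem fCapR_nil : fCapR j nil = 0 := byHead_nil _
@[simp] theorem fCapR_cons : fCapR j (cons a v) =
    if a.1 < j then del j (rel (Equiv.swap a.1 j) (clp j a.2 (ee j v))) else 0 := by
  rw [fCapR, byHead_cons]; split_ifs <;> rfl

theorem cupTerm_apply : cupTerm j i v = cons (i, false) (rel (Equiv.swap i j) (ee i (sh j v))) -
    cons (i, true) (rel (Equiv.swap i j) (cl i (sh j v))) := rfl

theorem fCupL_apply : fCupL j v = ∑ i ∈ Finset.range j, cupTerm j i v := by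
  rw [fCupL, LinearMap.sum_apply]

end

/-- The operators of the generating morphisms. -/
def genFam : ∀ {X Y : Word}, Gen X Y → Fam
  | _, _, .dotUp => fDotU
  | _, _, .dotDown => fDotD
  | _, _, .cross => fCross
  | _, _, .cupR => fCupR
  | _, _, .cupL => fCupL
  | _, _, .capR => fCapR
  | _, _, .capL => fCapL

/-! ### Parity of the generating morphisms -/

theorem bar_fDotU : bar true fDotU = (-1 : ℂ) • fDotU := by
  funext j
  refine hom_cases (by simp [bar]) fun a v => ?_
  obtain ⟨k, ε⟩ := a
  by_cases hj : k < j <;> cases ε <;> simp [bar, hj, par_par, par_zz]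

theorem bar_fDotD : bar true fDotD = (-1 : ℂ) • fDotD := by
  funext j
  refine LinearMap.ext fun v => ?_
  simp [bar, par_cl, par_par]

theorem bar_fCross : bar true fCross = fCross := by
  funext j
  refine hom_cases₂ (by simp [bar]) (fun a => by simp [bar]) fun a b v => ?_
  obtain ⟨k, ε⟩ := a
  obtain ⟨l, η⟩ := b
  by_cases hj : k < j ∧ l < j ∧ k ≠ l
  · cases ε <;> cases η <;> simp [bar, hj, par_par, par_zz]
  · simp [bar, hj]

theorem bar_fCupR : bar true fCupR = fCupR := by
  funext j
  refine LinearMap.ext fun v => ?_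
  simp [bar, par_sh, par_par]

theorem bar_fCapL : bar true fCapL = fCapL := by
  funext j
  refine hom_cases (by simp [bar]) fun a v => ?_
  by_cases ha : a = (j, false)
  · simp [bar, ha, par_par, par_del]
  · simp [bar, ha]

theorem bar_fCapR : bar true fCapR = fCapR := by
  funext j
  refine hom_cases (by simp [bar]) fun a v => ?_
  obtain ⟨k, ε⟩ := a
  by_cases hj : k < j
  · cases ε <;> simp [bar, hj, par_par, par_del, par_rel, par_cl, par_ee]
  · simp [bar, hj]

theorem bar_fCupL : bar true fCupL = fCupL := by
  funext j
  refine LinearMap.ext fun v => ?_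
  simp only [bar, tw_true_apply, fCupL_apply, map_sum]
  refine Finset.sum_congr rfl fun i _ => ?_
  simp [cupTerm_apply, par_rel, par_ee, par_cl, par_sh, par_par]

/-! ### The generating morphisms do not interfere with the strands to the left -/

theorem swap_comp {i j : ℕ} {φ : ℕ → ℕ} (hφ : φ.Injective) (v : V) :
    rel (Equiv.swap (φ i) (φ j)) (rel φ v) = rel φ (rel (Equiv.swap i j) v) := by
  rw [rel_rel, rel_rel]
  rw [hφ.swap_comp]

theorem rel_swap_zz (i k j : ℕ) (v : V) :
    rel (Equiv.swap k j) (zz i v) = zz (Equiv.swap k j i) (rel (Equiv.swap k j) v) :=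
  rel_zz (Equiv.injective _) i v

theorem rel_swap_ee (i k j : ℕ) (v : V) :
    rel (Equiv.swap k j) (ee i v) = ee (Equiv.swap k j i) (rel (Equiv.swap k j) v) :=
  rel_ee (Equiv.injective _) i v

theorem rel_swap_cl (i k j : ℕ) (v : V) :
    rel (Equiv.swap k j) (cl i v) = cl (Equiv.swap k j i) (rel (Equiv.swap k j) v) :=
  rel_cl (Equiv.injective _) i v

theorem natural_fDotU : Natural fDotU where
  rel {j j' φ} hφ v := by
    refine LinearMap.congr_fun (f := fDotU j' * rel φ) (g := rel φ * fDotU j)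
      (hom_cases (by simp) fun a v => ?_) v
    by_cases hj : a.1 < j <;> simp [hφ.lt_iff, hj, rel_zz hφ.inj]
  zz {i j} hi v := by
    refine LinearMap.congr_fun (f := fDotU j * zz i) (g := zz i * fDotU j)
      (hom_cases (by simp) fun a v => ?_) v
    obtain ⟨k, ε⟩ := a
    by_cases ha : k = i
    · simp [ha, hi]
    · by_cases hj : k < j
      · simp [ha, hj, zz_zz k]
      · simp [ha, hj]
  cl {i j} hi v := by
    change _ = cl i (bar true fDotU j v)
    rw [bar_fDotU]
    refine LinearMap.congr_fun (f := fDotU j * cl i) (g := cl i * (-1 : ℂ) • fDotU j)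
      (hom_cases (by simp) fun a v => ?_) v
    obtain ⟨k, ε⟩ := a
    by_cases ha : k = i
    · subst ha
      cases ε <;> simp [hi]
    · by_cases hj : k < j
      · cases ε <;> simp [ha, hj, zz_cl]
      · simp [ha, hj]

theorem natural_fDotD : Natural fDotD where
  rel {j j' φ} hφ v := by simp [rel_cl hφ.inj, hφ.eq]
  zz {i j} hi v := (zz_cl v).symm
  cl {i j} hi v := by
    change _ = cl i (bar true fDotD j v)
    rw [bar_fDotD]
    simp [cl_cl hi.ne']

theorem natural_fCross : Natural fCross where
  rel {j j' φ} hφ v := by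
    refine LinearMap.congr_fun (f := fCross j' * rel φ) (g := rel φ * fCross j)
      (hom_cases₂ (by simp) (fun a => by simp) fun a b v => ?_) v
    by_cases hj : a.1 < j ∧ b.1 < j ∧ a.1 ≠ b.1 <;>
      simp [hφ.lt_iff, hφ.inj.eq_iff, hj, rel_zz hφ.inj]
  zz {i j} hi v := by
    refine LinearMap.congr_fun (f := fCross j * zz i) (g := zz i * fCross j)
      (hom_cases₂ (by simp) (fun a => by by_cases ha : a.1 = i <;> simp [ha]) fun a b v => ?_) v
    obtain ⟨k, ε⟩ := a
    obtain ⟨l, η⟩ := b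
    by_cases hj : k < j ∧ l < j ∧ k ≠ l
    · by_cases ha : k = i <;> by_cases hb : l = i
      all_goals simp [hj, ha, hb, zz_zz i]
      all_goals simp_all
    · have h (v) : fCross j (cons (k, ε) (cons (l, η) v)) = 0 := by rw [fCross_cons_cons, if_neg hj]
      by_cases ha : k = i
      · subst ha
        simp only [Module.End.mul_apply, h, zz_cons, if_true, map_zero]
      · by_cases hb : l = i
        · subst hb
          simp only [Module.End.mul_apply, h, zz_cons, if_true, map_zero, ite_self]
        · simp only [Module.End.mul_apply, h, zz_cons, ha, hb, if_false, map_zero]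
  cl {i j} hi v := by
    change _ = cl i (bar true fCross j v)
    rw [bar_fCross]
    refine LinearMap.congr_fun (f := fCross j * cl i) (g := cl i * fCross j)
      (hom_cases₂ (by simp) (fun a => by by_cases ha : a.1 = i <;> simp [ha]) fun a b v => ?_) v
    obtain ⟨k, ε⟩ := a
    obtain ⟨l, η⟩ := b
    by_cases hj : k < j ∧ l < j ∧ k ≠ l
    · by_cases ha : k = i
      · have hb : l ≠ i := fun h => hj.2.2 (ha.trans h.symm)
        cases ε <;> cases η <;> simp [hj, ha, hb, hi, hb.symm]
      · by_cases hb : l = i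
        · cases ε <;> cases η <;> simp [hj, ha, hb, hi]
        · cases ε <;> cases η <;> simp [hj, ha, hb, zz_cl]
    · have h (ε η v) : fCross j (cons (k, ε) (cons (l, η) v)) = 0 := by
        rw [fCross_cons_cons, if_neg hj]
      by_cases ha : k = i
      · subst ha
        simp only [Module.End.mul_apply, h, cl_cons, if_true, map_zero, map_smul, smul_zero]
      · by_cases hb : l = i
        · subst hb
          simp only [Module.End.mul_apply, h, cl_cons, ha, if_true, if_false, map_zero, map_smul,
            smul_zero]
        · simp only [Module.End.mul_apply, h, cl_cons, ha, hb, if_false, map_zero, map_smul,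
            smul_zero]

theorem natural_fCupR : Natural fCupR where
  rel {j j' φ} hφ v := by simp [hφ.rel_sh, hφ.eq]
  zz {i j} hi v := by simp [hi.ne', zz_sh_of_lt hi]
  cl {i j} hi v := by
    change _ = cl i (bar true fCupR j v)
    rw [bar_fCupR]
    simp [hi.ne', cl_sh_of_lt hi]

theorem natural_fCapL : Natural fCapL where
  rel {j j' φ} hφ v := by
    refine LinearMap.congr_fun (f := fCapL j' * rel φ) (g := rel φ * fCapL j)
      (hom_cases (by simp) fun a v => ?_) v
    obtain ⟨k, ε⟩ := a
    have := hφ.inj.eq_iff (a := k) (b := j)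
    rw [hφ.eq] at this
    by_cases ha : k = j ∧ ε = false
    · obtain ⟨rfl, rfl⟩ := ha
      simp [hφ.eq, hφ.rel_del]
    · simp [this, ha]
  zz {i j} hi v := by
    refine LinearMap.congr_fun (f := fCapL j * zz i) (g := zz i * fCapL j)
      (hom_cases (by simp) fun a v => ?_) v
    obtain ⟨k, ε⟩ := a
    by_cases hk : k = j
    · cases ε <;> simp [hk, hi.ne', del_zz_of_lt hi]
    · by_cases ha : k = i <;> simp [hk, ha, hi.ne]
  cl {i j} hi v := by
    change _ = cl i (bar true fCapL j v)
    rw [bar_fCapL]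
    refine LinearMap.congr_fun (f := fCapL j * cl i) (g := cl i * fCapL j)
      (hom_cases (by simp) fun a v => ?_) v
    obtain ⟨k, ε⟩ := a
    by_cases hk : k = j
    · cases ε <;> simp [hk, hi.ne', del_cl_of_lt hi]
    · by_cases ha : k = i <;> simp [hk, ha, hi.ne]

theorem natural_fCapR : Natural fCapR where
  rel {j j' φ} hφ v := by
    refine LinearMap.congr_fun (f := fCapR j' * rel φ) (g := rel φ * fCapR j)
      (hom_cases (by simp) fun a v => ?_) v
    obtain ⟨k, ε⟩ := a
    by_cases hj : k < j
    · have h := hφ.rel_del (v := rel (Equiv.swap k j) (clp j ε (ee j v)))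
      rw [← swap_comp hφ.inj, hφ.eq] at h
      simp only [Module.End.mul_apply, rel_cons, fCapR_cons, hφ.lt_iff, if_pos hj, h]
      cases ε <;> simp [rel_ee hφ.inj, rel_cl hφ.inj, hφ.eq]
    · simp [hφ.lt_iff, hj]
  zz {i j} hi v := by
    refine LinearMap.congr_fun (f := fCapR j * zz i) (g := zz i * fCapR j)
      (hom_cases (by simp) fun a v => ?_) v
    obtain ⟨k, ε⟩ := a
    by_cases hj : k < j
    · by_cases ha : k = i
      · subst ha
        cases ε <;> simp [hj, ← del_zz_of_lt hj, rel_swap_ee, rel_swap_cl, zz_ee_self, zz_cl]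
      · have h : Equiv.swap k j i = i := Equiv.swap_apply_of_ne_of_ne (Ne.symm ha) hi.ne
        cases ε <;> simp [hj, ha, ← del_zz_of_lt hi, ← zz_ee, ← zz_cl, rel_swap_zz, h]
    · have ha : k ≠ i := fun h => hj (h ▸ hi)
      simp [ha, hj]
  cl {i j} hi v := by
    change _ = cl i (bar true fCapR j v)
    rw [bar_fCapR]
    refine LinearMap.congr_fun (f := fCapR j * cl i) (g := cl i * fCapR j)
      (hom_cases (by simp) fun a v => ?_) v
    obtain ⟨k, ε⟩ := a
    by_cases hj : k < j
    · by_cases ha : k = i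
      · subst ha
        cases ε <;> simp [hj, ← del_cl_of_lt hj, rel_swap_ee, rel_swap_cl, cl_cl_self,
          cl_ee_self]
      · have h : Equiv.swap k j i = i := Equiv.swap_apply_of_ne_of_ne (Ne.symm ha) hi.ne
        cases ε <;> simp [hj, ha, ← del_cl_of_lt hi, ee_cl, rel_swap_cl, h, cl_cl ha]
    · have ha : k ≠ i := fun h => hj (h ▸ hi)
      simp [ha, hj]

theorem natural_fCupL : Natural fCupL where
  rel {j j' φ} hφ v := by
    have h₁ : ∀ i ∈ Finset.range j, cupTerm j' (φ i) (rel φ v) = rel φ (cupTerm j i v) := by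
      intro i hi
      simp only [cupTerm_apply, map_sub, rel_cons]
      rw [← hφ.rel_sh, ← rel_ee hφ.inj, ← rel_cl hφ.inj, ← hφ.eq, swap_comp hφ.inj,
        swap_comp hφ.inj]
    -- A label outside the image of `φ` does not occur in `rel φ v`, so the larger sum has no
    -- further nonzero terms.
    have h₂ : ∀ i' ∈ Finset.range j', i' ∉ (Finset.range j).image φ →
        cupTerm j' i' (rel φ v) = 0 := by
      intro i' hi' hn
      have h : ∀ n, (φ ∘ shift j) n ≠ i' := by
        rintro n rfl
        refine hn (Finset.mem_image_of_mem φ (Finset.mem_range.2 ?_))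
        exact (hφ.lt_iff _).1 (Finset.mem_range.1 hi')
      have h' : ee i' (sh j' (rel φ v)) = 0 := by
        rw [← hφ.rel_sh, sh, rel_rel, ee_rel_of_forall_ne h]
      rw [cupTerm_apply, ← cl_ee_self, h']
      simp
    rw [fCupL_apply, fCupL_apply, map_sum, ← Finset.sum_congr rfl h₁,
      ← Finset.sum_image (f := fun i => cupTerm j' i (rel φ v)) hφ.inj.injOn]
    refine (Finset.sum_subset (fun i' hi' => ?_) h₂).symm
    obtain ⟨i, hi, rfl⟩ := Finset.mem_image.1 hi'
    exact Finset.mem_range.2 (hφ.lt _ (Finset.mem_range.1 hi))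
  zz {i j} hi v := by
    rw [fCupL_apply, fCupL_apply, map_sum]
    refine Finset.sum_congr rfl fun k hk => ?_
    have hk := Finset.mem_range.1 hk
    simp only [cupTerm_apply, map_sub, zz_cons]
    by_cases ha : k = i
    · subst ha
      simp [← zz_sh_of_lt hi, ee_zz_self, cl_zz_self]
    · have h : Equiv.swap k j i = i := Equiv.swap_apply_of_ne_of_ne (Ne.symm ha) hi.ne
      simp [ha, ← zz_sh_of_lt hi, ← zz_ee, ← zz_cl, rel_swap_zz, h]
  cl {i j} hi v := by
    change _ = cl i (bar true fCupL j v)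
    rw [bar_fCupL, fCupL_apply, fCupL_apply, map_sum]
    refine Finset.sum_congr rfl fun k hk => ?_
    have hk := Finset.mem_range.1 hk
    simp only [cupTerm_apply, map_sub, cl_cons]
    by_cases ha : k = i
    · subst ha
      simp only [← cl_sh_of_lt hi, ee_cl, cl_ee_self, cl_cl_self, sgn_true, sgn_false, map_smul,
        if_true, Bool.not_true, Bool.not_false]
      module
    · have h : Equiv.swap k j i = i := Equiv.swap_apply_of_ne_of_ne (Ne.symm ha) hi.ne
      simp only [ha, ← cl_sh_of_lt hi, ee_cl, rel_swap_cl, h, cl_cl ha, sgn_true, sgn_false,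
        map_smul, if_false]
      module

theorem natural_genFam {X Y : Word} (g : Gen X Y) : Natural (genFam g) := by
  cases g
  exacts [natural_fDotU, natural_fDotD, natural_fCross, natural_fCupR, natural_fCupL,
    natural_fCapR, natural_fCapL]

end Model

end

end TwistedHeis

namespace TwistedHeis

noncomputable section

namespace Model

/-! ### The operators of a diagram -/

/-- The operators of a diagram. -/
def interp : ∀ {X Y : Word}, Diag X Y → Fam
  | _, _, .id X => act X 1
  | _, _, .gen g => genFam g
  | _, _, .comp f g => interp g * interp f
  -- The right factor is lower, so its operators act first, under the strands of the source of `f`.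
  | _, _, .tensor (X := X) f g => interp f * act X (interp g)
  | _, _, .zero _ _ => 0
  | _, _, .add f g => interp f + interp g
  | _, _, .smul r f => r • interp f

theorem interp_cast {X Y X' Y' : Word} (hX : X = X') (hY : Y = Y') (f : Diag X Y) :
    interp (f.cast hX hY) = interp f := by
  subst hX hY; rfl

theorem natural_interp {X Y : Word} (f : Diag X Y) : Natural (interp f) := by
  induction f with
  | id X => exact Natural.one.act X
  | gen g => exact natural_genFam g
  | comp f g hf hg => exact hg.mul hf
  | tensor f g hf hg => exact hf.mul (hg.act _)
  | zero => exact Natural.zero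
  | add f g hf hg => exact hf.add hg
  | smul r f hf => exact hf.smul r

/-- The parity of a homogeneous morphism as a truth value. -/
def isOdd (p : ZMod 2) : Bool := decide (p ≠ 0)

theorem isOdd_add (p q : ZMod 2) : isOdd (p + q) = xor (isOdd p) (isOdd q) := by
  fin_cases p <;> fin_cases q <;> rfl

theorem bar_bar (b b' : Bool) (T : Fam) : bar b (bar b' T) = bar (xor b b') T := by
  cases b <;> cases b' <;> try rfl
  funext j
  exact tw_tw_self true (T j)

theorem tw_of_bar {T : Fam} (h : bar true T = T) (b : Bool) (j : ℕ) : tw b (T j) = T j := by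
  cases b
  · rfl
  · exact congrFun h j

/-! ### The interchange law for the generators -/

theorem mul_act_fCapL {T : Fam} (hT : Natural T) : T * fCapL = fCapL * actQ (actP T) := by
  funext j
  refine hom_cases (by simp) fun a v => ?_
  obtain ⟨k, ε⟩ := a
  by_cases hk : k = j
  · cases ε <;> simp [hk, hT.del, del_zz]
  · by_cases hj : k < j + 1 <;> simp [hk, hj]

theorem Natural.clp_tw {T : Fam} (h : Natural T) {i j : ℕ} (hi : i < j) (b : Bool) (v : V) :
    clp i b (tw b (T j) v) = T j (clp i b v) := by
  cases b
  · rfl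
  · exact (h.cl hi v).symm

theorem Natural.tw_clp {T : Fam} (h : Natural T) {i j : ℕ} (hi : i < j) (b : Bool) (v : V) :
    tw b (T j) (clp i b v) = clp i b (T j v) := by
  have := (h.bar b).clp_tw hi b v
  rw [tw_tw_self] at this
  exact this.symm

theorem tw_actQ_apply (b : Bool) (T : Fam) (j : ℕ) (v : V) :
    tw b (actQ T j) v = tw b (T (j + 1)) (ee j v) := by
  cases b
  · rfl
  · simp [par_ee]

theorem tw_actP (b : Bool) (T : Fam) (j : ℕ) : tw b (actP T j) = actP (bar b T) j :=
  (congrFun (actP_bar b T) j).symm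

theorem actP_actP_cons_cons (T : Fam) (j : ℕ) (a b : ℕ × Bool) (v : V) :
    actP (actP T) j (cons a (cons b v)) = if a.1 < j ∧ b.1 < j ∧ a.1 ≠ b.1 then
      cons a (cons b (tw b.2 (tw a.2 (T j)) (zz b.1 (zz a.1 v)))) else 0 := by
  by_cases ha : a.1 < j
  · by_cases hab : b.1 = a.1
    · simp [ha, hab]
    · by_cases hb : b.1 < j <;> simp [ha, hb, hab, Ne.symm hab, tw_actP, bar]
  · simp [ha]

theorem actP_actP_cons_nil (T : Fam) (j : ℕ) (a : ℕ × Bool) :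
    actP (actP T) j (cons a nil) = 0 := by
  by_cases ha : a.1 < j <;> simp [ha, tw_actP]

theorem ee_clp (i k : ℕ) (b : Bool) (v : V) : ee i (clp k b v) = clp k b (ee i v) := by
  cases b
  · rfl
  · exact ee_cl _ _ _

theorem zz_clp (i k : ℕ) (b : Bool) (v : V) : zz i (clp k b v) = clp k b (zz i v) := by
  cases b
  · rfl
  · exact zz_cl _

theorem mul_act_fCapR {T : Fam} (hT : Natural T) : T * fCapR = fCapR * actP (actQ T) := by
  funext j
  refine hom_cases (by simp) fun a v => ?_
  obtain ⟨k, ε⟩ := a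
  by_cases hj : k < j
  · have hj' := Nat.lt_succ_self j
    have hs := adm_swap (j := j + 1) (hj.trans hj') hj'
    simp only [Pi.mul_apply, Module.End.mul_apply, actP_cons, fCapR_cons, if_pos hj, tw_actQ_apply]
    rw [← (hT.bar ε).ee hj', ee_ee_self, hT.clp_tw hj', ← hT.rel hs, hT.del, ← zz_ee, ← zz_clp,
      rel_swap_zz, Equiv.swap_apply_left, del_zz]
  · simp [hj]

theorem act_mul_fCupR {T : Fam} (hT : Natural T) : actQ (actP T) * fCupR = fCupR * T := by
  funext j
  refine LinearMap.ext fun v => ?_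
  simp [hT.sh, zz_sh]

theorem act_mul_fCupL {T : Fam} (hT : Natural T) : actP (actQ T) * fCupL = fCupL * T := by
  funext j
  refine LinearMap.ext fun v => ?_
  simp only [Pi.mul_apply, Module.End.mul_apply, fCupL_apply, map_sum]
  refine Finset.sum_congr rfl fun i hi => ?_
  have hi := Finset.mem_range.1 hi
  have hj := Nat.lt_succ_self j
  have hs := adm_swap (j := j + 1) (hi.trans hj) hj
  have h (b : Bool) (u : V) : tw b (T (j + 1)) (ee j (zz i (rel (Equiv.swap i j)
      (clp i b (ee i (sh j u)))))) = rel (Equiv.swap i j) (clp i b (ee i (sh j (T j u)))) := by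
    have h₁ (x : V) : zz i (rel (Equiv.swap i j) x) = rel (Equiv.swap i j) (zz j x) := by
      rw [rel_swap_zz, Equiv.swap_apply_right]
    have h₂ (x : V) : ee j (rel (Equiv.swap i j) x) = rel (Equiv.swap i j) (ee i x) := by
      rw [rel_swap_ee, Equiv.swap_apply_left]
    rw [h₁, h₂, zz_clp, zz_ee, zz_sh, ee_clp, ee_ee_self, (hT.bar b).rel hs,
      hT.tw_clp (hi.trans hj), hT.ee (hi.trans hj), hT.sh]
  have h₀ := h false v
  have h₁ := h true v
  simp only [clp_true, clp_false, cl_ee_self, Module.End.one_apply] at h₀ h₁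
  simp only [cupTerm_apply, map_sub, actP_cons, if_pos hi, tw_actQ_apply, h₀, h₁]

theorem act_mul_fCross {T : Fam} (hT : Natural T) :
    actP (actP T) * fCross = fCross * actP (actP T) := by
  funext j
  refine hom_cases₂ (by simp) (fun a => ?_) fun a b v => ?_
  · simp only [Pi.mul_apply, Module.End.mul_apply, fCross_cons_nil, actP_actP_cons_nil, map_zero]
  simp only [Pi.mul_apply, Module.End.mul_apply, fCross_cons_cons, actP_actP_cons_cons]
  by_cases hj : a.1 < j ∧ b.1 < j ∧ a.1 ≠ b.1
  · rw [if_pos hj, if_pos hj, map_smul, actP_actP_cons_cons, if_pos ⟨hj.2.1, hj.1, hj.2.2.symm⟩,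
      fCross_cons_cons, if_pos hj, tw_comm]
    have h := (hT.bar a.2).bar b.2
    simp only [h.zz hj.1, h.zz hj.2.1, zz_zz b.1 a.1, zz_zz_self]
  · rw [if_neg hj, if_neg hj, map_zero, map_zero]

theorem act_mul_fDotU {T : Fam} (hT : Natural T) :
    actP T * fDotU = fDotU * actP (bar true T) := by
  funext j
  refine hom_cases (by simp) fun a v => ?_
  obtain ⟨k, ε⟩ := a
  by_cases hj : k < j
  · cases ε <;> simp [hj, bar, par_par, hT.zz hj, zz_zz_self, par_zz]
  · simp [hj]

theorem act_mul_fDotD {T : Fam} (hT : Natural T) :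
    actQ T * fDotD = fDotD * actQ (bar true T) := by
  funext j
  refine LinearMap.ext fun v => ?_
  simp [ee_cl, bar, hT.cl (Nat.lt_succ_self j)]

/-- The family `T` represents whatever stands to the right of the generator. An odd generator can be
passed only after conjugating `T` by the parity operator, which gives the super interchange law. -/
theorem act_mul_genFam {T : Fam} (hT : Natural T) {X Y : Word} (g : Gen X Y) :
    act Y T * genFam g = genFam g * act X (bar (isOdd g.parity) T) := by
  cases g
  · exact act_mul_fDotU hT
  · exact act_mul_fDotD hT
  · exact act_mul_fCross hT
  · exact act_mul_fCupR hT
  · exact act_mul_fCupL hT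
  · exact mul_act_fCapR hT
  · exact mul_act_fCapL hT

end Model

end

end TwistedHeis

namespace TwistedHeis

noncomputable section

namespace Model

/-! ### The sign rule for arbitrary diagrams -/

theorem bar_mul (b : Bool) (S T : Fam) : bar b (S * T) = bar b S * bar b T :=
  funext fun _ => tw_mul b _ _

theorem bar_add (b : Bool) (S T : Fam) : bar b (S + T) = bar b S + bar b T :=
  funext fun _ => tw_add b _ _

theorem bar_smul (b : Bool) (r : ℂ) (T : Fam) : bar b (r • T) = r • bar b T :=
  funext fun _ => tw_smul b _ r

theorem bar_one (b : Bool) : bar b 1 = 1 := funext fun _ => tw_one b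

theorem bar_zero (b : Bool) : bar b 0 = 0 := funext fun _ => tw_zero b

theorem Natural.bar' {T : Fam} (h : Natural T) (b : Bool) : Natural (Model.bar b T) := h.bar b

/-- The sign rule for operators of homogeneous diagrams. -/
theorem act_mul_interp {X Y : Word} {p : ZMod 2} {f : Diag X Y} (hf : f.HasParity p) {T : Fam}
    (hT : Natural T) : act Y T * interp f = interp f * act X (bar (isOdd p) T) := by
  induction hf generalizing T with
  | id X =>
    change act X T * act X 1 = act X 1 * act X T
    rw [← act_mul _ Natural.one, ← act_mul _ hT, one_mul, mul_one]
  | gen g => exact act_mul_genFam hT g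
  | comp _ _ hf hg =>
    rw [interp, ← mul_assoc, hg hT, mul_assoc, hf (hT.bar' _), bar_bar, ← isOdd_add, mul_assoc]
  | tensor _ _ hf hg =>
    rename_i X Y X' Y' p q f g _ _
    have hg' := natural_interp g
    rw [interp, act_add, ← mul_assoc, hf (hT.act _), mul_assoc, act_add, mul_assoc,
      ← act_mul _ ((hT.bar' _).act _), ← act_bar, ← act_mul _ hg', hg (hT.bar' _), bar_bar,
      isOdd_add, Bool.xor_comm]
  | zero X Y p => rw [interp, mul_zero, zero_mul]
  | add _ _ hf hg => rw [interp, mul_add, add_mul, hf hT, hg hT]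
  | smul r _ hf => rw [interp, mul_smul_comm, smul_mul_assoc, hf hT]

/-- Operators of even parity pass through all diagrams. -/
theorem act_mul_interp_of_bar {X Y : Word} (f : Diag X Y) {T : Fam} (hT : Natural T)
    (h : bar true T = T) : act Y T * interp f = interp f * act X T := by
  have h' (b : Bool) : bar b T = T := funext fun j => tw_of_bar h b j
  induction f generalizing T with
  | id X => simpa only [h'] using act_mul_interp (.id X) hT
  | gen g => simpa only [h'] using act_mul_interp (.gen g) hT
  | comp f g hf hg =>
    rw [interp, ← mul_assoc, hg hT h h', mul_assoc, hf hT h h', mul_assoc]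
  | tensor f g hf hg =>
    rename_i X Y X' Y'
    rw [interp, act_add, ← mul_assoc, hf (hT.act _) (by rw [← act_bar, h])
      (fun b => by rw [← act_bar, h']), mul_assoc, act_add, mul_assoc,
      ← act_mul _ (hT.act _), ← act_mul _ (natural_interp g), hg hT h h']
  | zero X Y => rw [interp, mul_zero, zero_mul]
  | add f g hf hg => rw [interp, mul_add, add_mul, hf hT h h', hg hT h h']
  | smul r f hf => rw [interp, mul_smul_comm, smul_mul_assoc, hf hT h h']

/-- Conjugation by the parity operator detects the degree; this turns the twist in `act_mul_interp`
into the numerical sign of the interchange law. -/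
theorem bar_interp {X Y : Word} {p : ZMod 2} {f : Diag X Y} (hf : f.HasParity p) (b : Bool) :
    bar b (interp f) = sgn (b && isOdd p) • interp f := by
  cases b
  · exact (one_smul ℂ _).symm
  induction hf with
  | id X => rw [interp, ← act_bar, bar_one]; simp [isOdd]
  | gen g =>
    cases g
    · exact bar_fDotU
    · exact bar_fDotD
    · exact bar_fCross.trans (one_smul _ _).symm
    · exact bar_fCupR.trans (one_smul _ _).symm
    · exact bar_fCupL.trans (one_smul _ _).symm
    · exact bar_fCapR.trans (one_smul _ _).symm
    · exact bar_fCapL.trans (one_smul _ _).symm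
  | comp _ _ hf hg =>
    rename_i p q _ _ _ _
    rw [interp, bar_mul, hf, hg, smul_mul_smul_comm, isOdd_add]
    cases isOdd p <;> cases isOdd q <;> simp
  | tensor _ _ hf hg =>
    rename_i p q _ _ _ _
    rw [interp, bar_mul, hf, ← act_bar, hg, act_smul_fam, smul_mul_smul_comm, isOdd_add]
    cases isOdd p <;> cases isOdd q <;> simp
  | zero X Y p => rw [interp, bar_zero, smul_zero]
  | add _ _ hf hg => rw [interp, bar_add, hf, hg, smul_add]
  | smul r _ hf => rw [interp, bar_smul, hf, smul_comm]

/-! ### The projections to the objects -/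

/-- Identity morphisms act as the projections `act X 1`, not as 1, so the unit laws say that each
generator factors through the projection of its source. -/
theorem genFam_mul_act_one {X Y : Word} (g : Gen X Y) : genFam g * act X 1 = genFam g := by
  cases g
  · funext j
    refine hom_cases (by simp [genFam]) fun a v => ?_
    by_cases hj : a.1 < j <;> simp [genFam, hj, zz_zz_self]
  · funext j
    refine LinearMap.ext fun v => ?_
    simp [genFam, cl_ee_self]
  · funext j
    refine hom_cases₂ (by simp [genFam]) (fun a => ?_) fun a b v => ?_
    · by_cases hj : a.1 < j <;> simp [genFam, hj, tw_actP]
    · by_cases hj : a.1 < j ∧ b.1 < j ∧ a.1 ≠ b.1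
      · simp [genFam, actP_actP_cons_cons, hj, zz_zz b.1 a.1, zz_zz_self, -actP_cons]
      · simp only [genFam, Pi.mul_apply, Module.End.mul_apply, act_add, act_of, actLetter_P,
          actP_actP_cons_cons, fCross_cons_cons, if_neg hj, map_zero]
  · exact mul_one _
  · exact mul_one _
  · exact (mul_act_fCapR Natural.one).symm.trans (one_mul _)
  · exact (mul_act_fCapL Natural.one).symm.trans (one_mul _)

theorem interp_mul_act_one {X Y : Word} (f : Diag X Y) : interp f * act X 1 = interp f := by
  induction f with
  | id X => rw [interp, ← act_mul _ Natural.one, one_mul]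
  | gen g => exact genFam_mul_act_one g
  | comp f g hf hg => rw [interp, mul_assoc, hf]
  | tensor f g hf hg =>
    rw [interp, act_add, mul_assoc, ← act_mul _ (Natural.one.act _), hg]
  | zero X Y => rw [interp, zero_mul]
  | add f g hf hg => rw [interp, add_mul, hf, hg]
  | smul r f hf => rw [interp, smul_mul_assoc, hf]

theorem act_one_mul_interp {X Y : Word} (f : Diag X Y) : act Y 1 * interp f = interp f :=
  (act_mul_interp_of_bar f Natural.one (bar_one true)).trans (interp_mul_act_one f)

theorem interp_id_tensor (X : Word) {Y Z : Word} (f : Diag Y Z) :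
    interp (Diag.id X ⊠ f) = act X (interp f) := by
  rw [interp, interp, ← act_mul _ (natural_interp f), one_mul]

theorem interp_comp_tensor_id {X Y Z W : Word} (g : Diag Z (X + W)) (f : Diag X Y) :
    interp (g ⟫ (f ⊠ .id W)) = interp f * interp g := by
  rw [interp, interp, interp, mul_assoc, ← act_add, act_one_mul_interp]

/-! ### The structural relations -/

theorem neg_one_pow_val (p q : ZMod 2) : (-1 : ℂ) ^ (p * q).val = sgn (isOdd p && isOdd q) := by
  fin_cases p <;> fin_cases q
  exacts [pow_zero _, pow_zero _, pow_zero _, pow_one _]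

/-- The operators of `g'` pass those of `f` by `act_mul_interp`; the resulting twist of `g'` is a
scalar by `bar_interp`. -/
theorem interp_interchange {X Y Z X' Y' Z' : Word} {p q : ZMod 2} (f : Diag X Y) (g : Diag Y Z)
    (f' : Diag X' Y') (g' : Diag Y' Z') (hf : f.HasParity p) (hg : g'.HasParity q) :
    interp ((f ⊠ f') ⟫ (g ⊠ g')) =
      interp (.smul ((-1) ^ ((p * q).val)) ((f ⟫ g) ⊠ (f' ⟫ g'))) := by
  simp only [interp]
  rw [neg_one_pow_val, act_mul _ (natural_interp f'), mul_assoc, ← mul_assoc (act Y _),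
    act_mul_interp hf (natural_interp g'), bar_interp hg, act_smul_fam, mul_smul_comm,
    smul_mul_assoc, mul_smul_comm]
  simp only [mul_assoc]

theorem interp_eq_of_rel (hlocal : ∀ {X Y : Word} {f g : Diag X Y}, Diag.LocalRel f g →
    interp f = interp g) {X Y : Word} {f g : Diag X Y} (h : Diag.Rel f g) :
    interp f = interp g := by
  induction h with
  | of_local h => exact hlocal h
  | refl f => rfl
  | symm _ h => exact h.symm
  | trans _ _ h h' => exact h.trans h'
  | comp_congr _ _ h h' => simp only [interp, h, h']
  | tensor_congr _ _ h h' => simp only [interp, h, h']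
  | add_congr _ _ h h' => simp only [interp, h, h']
  | smul_congr r _ h => simp only [interp, h]
  | add_assoc f g h => exact add_assoc _ _ _
  | add_comm f g => exact add_comm _ _
  | zero_add f => exact zero_add _
  | neg_add f =>
    refine (add_comm _ _).trans (funext fun j => LinearMap.ext fun v => ?_)
    change interp f j v + (-1 : ℂ) • interp f j v = 0
    rw [neg_smul, one_smul, add_neg_cancel]
  | one_smul f => exact one_smul _ _
  | mul_smul r s f => exact mul_smul _ _ _
  | smul_add r f g => exact smul_add _ _ _
  | add_smul r s f => exact add_smul _ _ _
  | id_comp f => exact interp_mul_act_one f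
  | comp_id f => exact act_one_mul_interp f
  | comp_assoc f g h => exact (mul_assoc _ _ _).symm
  | add_comp f f' g => exact mul_add _ _ _
  | comp_add f g g' => exact add_mul _ _ _
  | smul_comp r f g => exact mul_smul_comm _ _ _
  | comp_smul r f g => exact smul_mul_assoc _ _ _
  | add_tensor f f' g => exact add_mul _ _ _
  | tensor_add f g g' => simp only [interp, act_add_fam, mul_add]
  | smul_tensor r f g => exact smul_mul_assoc _ _ _
  | tensor_smul r f g => simp only [interp, act_smul_fam, mul_smul_comm]
  | id_tensor_id X Y => rw [interp_id_tensor, interp, interp, act_add]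
  | unit_tensor f => rw [interp_cast, interp_id_tensor, act_zero]
  | tensor_unit f => rw [interp_cast]; exact interp_mul_act_one f
  | tensor_assoc f g h =>
    rw [interp_cast]
    simp only [interp]
    rw [act_mul _ ((natural_interp h).act _), act_add, mul_assoc]
  | interchange f g f' g' hf hg => exact interp_interchange f g f' g' hf hg

end Model

end

end TwistedHeis

namespace TwistedHeis

noncomputable section

namespace Model

theorem hom_cases₃ {A B : Module.End ℂ V} (h₀ : A nil = B nil)
    (h₁ : ∀ a, A (cons a nil) = B (cons a nil))
    (h₂ : ∀ a b, A (cons a (cons b nil)) = B (cons a (cons b nil)))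
    (h₃ : ∀ a b c v, A (cons a (cons b (cons c v))) = B (cons a (cons b (cons c v)))) : A = B :=
  hom_cases h₀ fun a => LinearMap.congr_fun (f := A * cons a) (g := B * cons a)
    (hom_cases₂ (h₁ a) (h₂ a) fun b c v => h₃ a b c v)

@[simp] theorem tw_fCross (b : Bool) (j : ℕ) : tw b (fCross j) = fCross j := tw_of_bar bar_fCross b j
@[simp] theorem tw_fCupR (b : Bool) (j : ℕ) : tw b (fCupR j) = fCupR j := tw_of_bar bar_fCupR b j
@[simp] theorem tw_fCupL (b : Bool) (j : ℕ) : tw b (fCupL j) = fCupL j := tw_of_bar bar_fCupL b j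
@[simp] theorem tw_fCapR (b : Bool) (j : ℕ) : tw b (fCapR j) = fCapR j := tw_of_bar bar_fCapR b j
@[simp] theorem tw_fCapL (b : Bool) (j : ℕ) : tw b (fCapL j) = fCapL j := tw_of_bar bar_fCapL b j

theorem tw_fDotU (b : Bool) (j : ℕ) : tw b (fDotU j) = sgn b • fDotU j := by
  cases b
  · exact (one_smul ℂ _).symm
  · exact congrFun bar_fDotU j

theorem tw_fDotD (b : Bool) (j : ℕ) : tw b (fDotD j) = sgn b • cl j := by
  cases b
  · exact (one_smul ℂ _).symm
  · exact congrFun bar_fDotD j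

/-! ### Renamings that occur in the local relations -/

theorem swap_zz_zz (i j : ℕ) (v : V) :
    rel (Equiv.swap i j) (zz i (zz j v)) = zz i (zz j v) := by
  refine LinearMap.congr_fun (f := rel (Equiv.swap i j) * zz i * zz j) (g := zz i * zz j)
    (hom_induction (by simp) fun a v h => ?_) v
  simp only [Module.End.mul_apply] at h
  by_cases hi : a.1 = i
  · by_cases hij : i = j <;> simp [hi, hij]
  · by_cases hj : a.1 = j
    · simp [hj]
    · simp [hi, hj, h, Equiv.swap_apply_of_ne_of_ne hi hj]

/-- Exchanging a label with a new label. -/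
theorem swap_zz_sh {i j : ℕ} (h : i < j) (v : V) :
    rel (Equiv.swap i j) (sh j (zz i v)) = sh j (zz i v) := by
  rw [← zz_sh, ← zz_sh_of_lt h, ← zz_zz, swap_zz_zz]

theorem swap_succ_sh (j : ℕ) (v : V) :
    rel (Equiv.swap j (j + 1)) (sh j v) = sh (j + 1) v := by
  rw [sh, sh, rel_rel]
  refine congrArg (fun φ => rel φ v) (funext fun n => ?_)
  simp only [Function.comp_apply, shift, Equiv.swap_apply_def]
  split_ifs <;> omega

theorem swap_succ_sh_succ (j : ℕ) (v : V) :
    rel (Equiv.swap j (j + 1)) (sh (j + 1) v) = sh j v := by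
  rw [sh, sh, rel_rel]
  refine congrArg (fun φ => rel φ v) (funext fun n => ?_)
  simp only [Function.comp_apply, shift, Equiv.swap_apply_def]
  split_ifs <;> omega

theorem swap_two_sh (j : ℕ) (v : V) : rel (Equiv.swap j (j + 2)) (sh j v) =
    sh (j + 2) (rel (Equiv.swap j (j + 1)) v) := by
  rw [sh, sh, rel_rel, rel_rel]
  refine congrArg (fun φ => rel φ v) (funext fun n => ?_)
  simp only [Function.comp_apply, shift, Equiv.swap_apply_def]
  split_ifs <;> omega

theorem swap_two_sh_two (j : ℕ) (v : V) : rel (Equiv.swap j (j + 2)) (sh (j + 2) v) =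
    sh j (rel (Equiv.swap j (j + 1)) v) := by
  rw [sh, sh, rel_rel, rel_rel]
  refine congrArg (fun φ => rel φ v) (funext fun n => ?_)
  simp only [Function.comp_apply, shift, Equiv.swap_apply_def]
  split_ifs <;> omega

theorem ee_succ_sh {i j : ℕ} (h : j ≤ i) (v : V) : ee (i + 1) (sh j v) = sh j (ee i v) := by
  have : shift j i = i + 1 := if_neg (not_lt.2 h)
  rw [sh, rel_ee (shift_injective j), this]

/-! ### The local relations -/

theorem cross_cross : fCross * fCross = actP (actP 1) := by
  funext j
  refine hom_cases₂ (by simp) (fun a => ?_) fun a b v => ?_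
  · simp only [Pi.mul_apply, Module.End.mul_apply, fCross_cons_nil, actP_actP_cons_nil, map_zero]
  · simp only [Pi.mul_apply, Module.End.mul_apply, fCross_cons_cons, actP_actP_cons_cons]
    by_cases hj : a.1 < j ∧ b.1 < j ∧ a.1 ≠ b.1
    · rw [if_pos hj, if_pos hj, map_smul, fCross_cons_cons, if_pos ⟨hj.2.1, hj.1, hj.2.2.symm⟩,
        smul_smul, Bool.and_comm, sgn_mul_self]
      simp [zz_zz b.1 a.1, zz_zz_self]
    · rw [if_neg hj, if_neg hj, map_zero]

theorem actP_actP_actP_cons_cons_cons (j : ℕ) (a b c : ℕ × Bool) (v : V) :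
    actP (actP (actP 1)) j (cons a (cons b (cons c v))) =
      if (a.1 < j ∧ b.1 < j ∧ c.1 < j) ∧ a.1 ≠ b.1 ∧ a.1 ≠ c.1 ∧ b.1 ≠ c.1 then
      cons a (cons b (cons c (zz c.1 (zz b.1 (zz a.1 v))))) else 0 := by
  rw [actP_actP_cons_cons]
  simp only [tw_actP, bar_one, zz_cons]
  by_cases hab : a.1 < j ∧ b.1 < j ∧ a.1 ≠ b.1
  · by_cases hac : c.1 = a.1
    · simp [hac]
    · by_cases hbc : c.1 = b.1
      · simp [hbc, hab.2.2.symm]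
      · by_cases hc : c.1 < j
        · simp [hab, hac, Ne.symm hac, hbc, Ne.symm hbc, hc]
        · simp [hac, hbc, hc]
  · rw [if_neg hab, if_neg fun h => hab ⟨h.1.1, h.1.2.1, h.2.1⟩]

/-- The common right factor projects to the sequences of `PPP`. It allows the three labels to be
taken distinct and below `j`, after which only the signs remain to be compared. -/
theorem braid : fCross * (actP fCross * fCross) * actP (actP (actP 1)) =
    actP fCross * (fCross * actP fCross) * actP (actP (actP 1)) := by
  funext j
  refine hom_cases₃ (by simp) (fun a => ?_) (fun a b => ?_) fun a b c v => ?_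
  · simp only [Pi.mul_apply, Module.End.mul_apply, actP_actP_cons_nil, map_zero]
  · simp only [Pi.mul_apply, Module.End.mul_apply, actP_actP_cons_cons, tw_actP, bar_one, zz_nil,
      actP_nil, map_zero, ite_self]
  · simp only [Pi.mul_apply, Module.End.mul_apply, actP_actP_actP_cons_cons_cons]
    split_ifs with h
    · obtain ⟨⟨ha, hb, hc⟩, hab, hac, hbc⟩ := h
      simp [ha, hb, hc, hab, hac, hbc, hab.symm, hac.symm, hbc.symm, smul_smul]
      simp only [zz_zz c.1 a.1, zz_zz c.1 b.1, zz_zz b.1 a.1, zz_zz_self]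
      congr 1
      ring
    · simp only [map_zero]

theorem bubble : fCapL * fCupR = 1 := by
  funext j
  exact LinearMap.ext fun v => by simp [del_sh]

/-- After the crossing the first label is an old label `k < j`, whereas the cap accepts only the
fresh label `j` of the cup. -/
theorem left_curl :
    fCapL * actQ (actP (actP 1)) * (actQ fCross * (fCupR * actP 1)) = 0 := by
  funext j
  refine hom_cases (by simp) fun a v => ?_
  obtain ⟨k, ε⟩ := a
  by_cases hj : k < j
  · simp [hj, sh_cons, shift_of_lt hj, hj.ne', hj.ne, hj.le]
  · simp [hj]

theorem dot_cross_left :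
    fCross * fDotU * actP (actP 1) = actP fDotU * fCross * actP (actP 1) := by
  funext j
  refine hom_cases₂ (by simp) (fun a => ?_) fun a b v => ?_
  · simp only [Pi.mul_apply, Module.End.mul_apply, actP_actP_cons_nil, map_zero]
  · obtain ⟨k, ε⟩ := a
    obtain ⟨l, η⟩ := b
    simp only [Pi.mul_apply, Module.End.mul_apply, actP_actP_cons_cons]
    split_ifs with h
    · obtain ⟨hk, hl, hkl⟩ := h
      simp [hk, hl, hkl, hkl.symm, tw_fDotU]
      cases ε <;> cases η <;> simp <;> simp only [zz_zz l k, zz_zz_self]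
    · simp only [map_zero]

theorem dot_cross_right :
    fCross * actP fDotU * actP (actP 1) = fDotU * fCross * actP (actP 1) := by
  funext j
  refine hom_cases₂ (by simp) (fun a => ?_) fun a b v => ?_
  · simp only [Pi.mul_apply, Module.End.mul_apply, actP_actP_cons_nil, map_zero]
  · obtain ⟨k, ε⟩ := a
    obtain ⟨l, η⟩ := b
    simp only [Pi.mul_apply, Module.End.mul_apply, actP_actP_cons_cons]
    split_ifs with h
    · obtain ⟨hk, hl, hkl⟩ := h
      simp [hk, hl, hkl, hkl.symm, tw_fDotU]
      cases ε <;> cases η <;> simp <;> simp only [zz_zz l k, zz_zz_self]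
    · simp only [map_zero]

theorem dot_capL : fCapL * fDotD = (-1 : ℂ) • (fCapL * actQ fDotU) := by
  funext j
  refine hom_cases (by simp) fun a v => ?_
  obtain ⟨k, ε⟩ := a
  by_cases hk : k = j
  · cases ε <;> simp [hk, del_zz]
  · by_cases hj : k < j + 1 <;> simp [hk, hj]

theorem dot_capR : fCapR * fDotU = fCapR * actP fDotD := by
  funext j
  refine hom_cases (by simp) fun a v => ?_
  obtain ⟨k, ε⟩ := a
  by_cases hj : k < j
  · simp [hj, tw_fDotD, ee_cl]
    cases ε <;> simp [cl_cl_self, ee_ee_self]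
  · simp [hj]

theorem dot_cupR : fDotD * fCupR = actQ fDotU * fCupR := by
  funext j
  exact LinearMap.ext fun v => by simp [zz_sh]

theorem dot_cupL : fDotU * fCupL = (-1 : ℂ) • (actP fDotD * fCupL) := by
  funext j
  refine LinearMap.ext fun v => ?_
  simp only [Pi.mul_apply, Module.End.mul_apply, Pi.smul_apply, LinearMap.smul_apply, fCupL_apply,
    map_sum, Finset.smul_sum]
  refine Finset.sum_congr rfl fun i hi => ?_
  have hi := Finset.mem_range.1 hi
  have h₁ (x : V) : zz i (rel (Equiv.swap i j) x) = rel (Equiv.swap i j) (zz j x) := by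
    rw [rel_swap_zz, Equiv.swap_apply_right]
  have h₂ (x : V) : cl j (rel (Equiv.swap i j) x) = rel (Equiv.swap i j) (cl i x) := by
    rw [rel_swap_cl, Equiv.swap_apply_left]
  simp [cupTerm_apply, hi, tw_fDotD, h₁, h₂, zz_ee, zz_cl, zz_sh, cl_ee_self, cl_cl_self]

theorem dotUp_dotUp : fDotU * fDotU = actP 1 := by
  funext j
  refine hom_cases (by simp) fun a v => ?_
  by_cases hj : a.1 < j <;> simp [hj, zz_zz_self]

theorem dotDown_dotDown : fDotD * fDotD = (-1 : ℂ) • actQ 1 := by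
  funext j
  exact LinearMap.ext fun v => by simp [cl_cl_self]

theorem dot_bubble : fCapL * (actQ fDotU * fCupR) = 0 := by
  funext j
  exact LinearMap.ext fun v => by simp

theorem zigzag_up_right : fCapR * actP fCupR = actP 1 := by
  funext j
  refine hom_cases (by simp) fun a v => ?_
  obtain ⟨k, ε⟩ := a
  by_cases hj : k < j
  · have h (u : V) : clp j ε (cons (j, false) u) = cons (j, ε) u := by cases ε <;> simp
    simp [hj, h, ← zz_sh_of_lt hj]
    rw [zz_sh_of_lt hj, swap_zz_sh hj, del_cons, if_neg hj.ne, pred, if_pos hj.le, del_sh]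
  · simp [hj]

theorem zigzag_down_right : actQ fCapR * fCupR = actQ 1 := by
  funext j
  refine LinearMap.ext fun v => ?_
  simp [ee_succ_sh, swap_succ_sh, del_sh]

theorem zigzag_up_left : actP fCapL * fCupL * actP 1 = actP 1 := by
  funext j
  refine hom_cases (by simp) fun a v => ?_
  obtain ⟨k, ε⟩ := a
  by_cases hj : k < j
  · have h₁ (i : ℕ) (hi : i ∈ Finset.range j) (hik : i ≠ k) (u : V) :
        actP fCapL j (cupTerm j i (cons (k, ε) u)) = 0 := by
      have hk : Equiv.swap i j k = k := Equiv.swap_apply_of_ne_of_ne hik.symm hj.ne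
      simp [cupTerm_apply, sh_cons, shift_of_lt hj, hik.symm, hk, Finset.mem_range.1 hi, hj.ne]
    have h (x : V) : zz j (rel (Equiv.swap k j) x) = rel (Equiv.swap k j) (zz k x) := by
      rw [rel_swap_zz, Equiv.swap_apply_left]
    have h' (x : V) : zz k (rel (Equiv.swap k j) x) = rel (Equiv.swap k j) (zz j x) := by
      rw [rel_swap_zz, Equiv.swap_apply_right]
    have h₂ (u : V) : actP fCapL j (cupTerm j k (cons (k, ε) u)) = cons (k, ε) (zz k u) := by
      cases ε <;> simp [cupTerm_apply, sh_cons, shift_of_lt hj, hj, hj.ne']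
      all_goals
        rw [h', zz_sh, ← del_zz, h, zz_sh_of_lt hj, swap_zz_sh hj, del_sh]
    simp only [Pi.mul_apply, Module.End.mul_apply, actP_cons, if_pos hj, fCupL_apply, map_sum]
    rw [Finset.sum_eq_single k (fun i hi hik => h₁ i hi hik _)
      (fun h => absurd (Finset.mem_range.2 hj) h), h₂]
    simp only [Pi.one_apply, tw_one, Module.End.one_apply, zz_zz_self]
  · simp [hj]

theorem zigzag_down_left : fCapL * actQ fCupL = actQ 1 := by
  funext j
  refine LinearMap.ext fun v => ?_
  simp [fCupL_apply, Finset.sum_range_succ, cupTerm_apply,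
    ee_sh_of_lt (Nat.lt_succ_self j), swap_succ_sh_succ, del_sh, ee_ee_self]

end Model

end

end TwistedHeis

namespace TwistedHeis

noncomputable section

namespace Model

/-! ### The rotated crossings in the model -/

theorem tw_actQ (b : Bool) (T : Fam) (j : ℕ) : tw b (actQ T j) = actQ (bar b T) j :=
  (congrFun (actQ_bar b T) j).symm

/-- Both mixed crossings leave sequences unchanged: a sequence of `PQ` is a sequence of `QP` whose
first label is an old one, so `xRight` becomes the inclusion and `xLeft` the projection. -/
theorem crossRight_eq :
    actQ (actP fCapR) * (actQ fCross * (fCupR * actP (actQ 1))) = actP (actQ 1) := by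
  funext j
  refine hom_cases (by simp) fun a v => ?_
  obtain ⟨k, ε⟩ := a
  by_cases hj : k < j
  · simp [hj, tw_actQ, bar_one, sh_cons, shift_of_lt hj, hj.ne, hj.ne', hj.trans (Nat.lt_succ_self j)]
    simp only [zz_ee, zz_sh_of_lt hj, zz_zz_self, zz_sh, ee_succ_sh le_rfl, swap_succ_sh, del_sh,
      ee_ee_self]
  · simp [hj]

theorem crossLeft_eq : fCapL * (actQ fCross * actQ (actP fCupL)) = actP (actQ 1) := by
  funext j
  refine hom_cases (by simp) fun a v => ?_
  obtain ⟨k, ε⟩ := a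
  -- After the crossing the first label is `i`, and the cap accepts only `j`; so the cup contributes
  -- only its summand `j`.
  have h (i : ℕ) (hi : i < j) (u : V) :
      fCapL j (fCross (j + 1) (cons (k, ε) (cupTerm (j + 1) i u))) = 0 := by
    by_cases h : k < j + 1 ∧ i < j + 1 ∧ k ≠ i
    · simp [cupTerm_apply, h, hi.ne]
    · simp only [cupTerm_apply, map_sub, fCross_cons_cons, if_neg h, map_zero, sub_zero]
  have h' (u : V) : fCapL j (fCross (j + 1) (cons (k, ε) (fCupL (j + 1) u))) =
      fCapL j (fCross (j + 1) (cons (k, ε) (cupTerm (j + 1) j u))) := by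
    simp only [fCupL_apply, map_sum, Finset.sum_range_succ, map_add]
    rw [Finset.sum_eq_zero fun i hi => h i (Finset.mem_range.1 hi) u, zero_add]
  by_cases hk : k = j
  · subst hk
    simp [h', cupTerm_apply]
  by_cases hj : k < j
  · simp only [Pi.mul_apply, Module.End.mul_apply, actQ_apply, ee_cons, if_neg hk, actP_cons,
      if_pos (hj.trans (Nat.lt_succ_self j)), if_pos hj, tw_fCupL]
    rw [← natural_fCupL.ee (Nat.lt_succ_self j), h']
    simp [cupTerm_apply, hj.le, hk, tw_actQ, bar_one, del_cons, pred, zz_ee, ee_ee_self,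
      ee_sh_of_lt (Nat.lt_succ_self j), swap_succ_sh_succ, zz_sh, zz_sh_of_lt hj, zz_zz_self, del_sh]
  · have : ¬ k ≤ j := by omega
    simp [hj, hk, this]

/-- The operators of the crossing of two downward strands. -/
def fCrossDown : Fam := fun j => rel (Equiv.swap j (j + 1)) * ee j * ee (j + 1)

theorem crossDown_eq : actQ (actQ fCapR) * (actQ (actP (actQ 1)) * (fCupR * actQ (actQ 1))) =
    fCrossDown := by
  funext j
  refine LinearMap.ext fun v => ?_
  simp [fCrossDown, tw_actQ, bar_one]
  rw [zz_sh, ee_ee_self, ee_succ_sh le_rfl, ee_succ_sh (Nat.le_succ j), swap_two_sh, del_sh,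
    ee_ee j (j + 1) (ee j v), ee_ee_self, ee_ee_self, ee_ee]

theorem crossDown₂_eq : fCapL * (actQ (actP (actQ 1)) * actQ (actQ fCupL)) = fCrossDown := by
  funext j
  refine LinearMap.ext fun v => ?_
  have h (i : ℕ) (hi : i < j) (u : V) :
      fCapL j (actP (actQ 1) (j + 1) (cupTerm (j + 2) i u)) = 0 := by
    simp [cupTerm_apply, hi.ne, hi.trans (Nat.lt_succ_self j)]
  have h' (u : V) : fCapL j (actP (actQ 1) (j + 1) (cupTerm (j + 2) (j + 1) u)) = 0 := by
    simp [cupTerm_apply]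
  -- The cup has summands for the labels up to `j + 1`. Those with `i < j` fail at the cap, and the
  -- one with `i = j + 1` fails at the mixed crossing.
  have h'' (u : V) : fCapL j (actP (actQ 1) (j + 1) (fCupL (j + 2) u)) =
      fCapL j (actP (actQ 1) (j + 1) (cupTerm (j + 2) j u)) := by
    simp only [fCupL_apply, map_sum, Finset.sum_range_succ, map_add]
    rw [Finset.sum_eq_zero fun i hi => h i (Finset.mem_range.1 hi) u, zero_add, h', add_zero]
  have hj : j < j + 2 := by omega
  simp only [fCrossDown, Pi.mul_apply, Module.End.mul_apply, actQ_apply]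
  rw [← natural_fCupL.ee hj, h'']
  simp [cupTerm_apply, tw_actQ, bar_one]
  have h₁ (x : V) : ee j (rel (Equiv.swap j (j + 1)) x) =
      rel (Equiv.swap j (j + 1)) (ee (j + 1) x) := by
    rw [rel_swap_ee, Equiv.swap_apply_right]
  rw [ee_sh_of_lt hj, swap_two_sh_two, zz_sh, ee_succ_sh le_rfl, del_sh, h₁, ee_ee_self,
    ee_ee j (j + 1) (ee j v), ee_ee_self, ee_ee_self, ee_ee]

/-- This is the Leibniz rule. Sequences of `QP` split according to whether the first label is old,
which gives `PQ`, or is the fresh label `j`; in the latter case the even and the odd entry give the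
plain and the dotted term. -/
theorem left_right : actP (actQ 1) = actQ (actP 1) + ((-1 : ℂ) • (fCupR * fCapL) +
    (-1 : ℂ) • ((fDotD * fCupR) * (fCapL * actQ fDotU))) := by
  funext j
  refine hom_cases (by simp) fun a v => ?_
  obtain ⟨k, ε⟩ := a
  by_cases hj : k < j
  · simp [hj, hj.ne, tw_actQ, bar_one, hj.le, zz_ee]
  · by_cases hk : k = j
    · cases ε <;> simp [hk, sh_del, del_zz]
    · have : ¬ k < j + 1 := by omega
      simp [hj, hk, this]

end Model

end

end TwistedHeis

namespace TwistedHeis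

noncomputable section

namespace Model

/-! ### The defining relations for the operators of diagrams -/

section

variable {X Y Z W W' A : Word}

theorem interp_id_id_tensor (X Y : Word) (f : Diag Z W) :
    interp (Diag.id X ⊠ Diag.id Y ⊠ f) = act X (act Y (interp f)) := by
  rw [interp, interp_id_tensor, interp, act_add, ← act_mul _ ((natural_interp f).act _),
    ← act_mul _ (natural_interp f), one_mul]

theorem interp_tensor_id (f : Diag X Y) (W : Word) :
    interp (f ⊠ .id W) = interp f * act X (act W 1) := by
  rw [interp, interp]

theorem interp_tensor_id_id (f : Diag X Y) (W W' : Word) :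
    interp (f ⊠ .id W ⊠ .id W') = interp f * act X (act W (act W' 1)) := by
  rw [interp_tensor_id, interp_tensor_id, act_add, mul_assoc,
    ← act_mul _ ((Natural.one.act _).act _), ← act_mul _ (Natural.one.act _), one_mul]

/-- Identity strands on the right may be omitted if the operators on their right end in the
right object. -/
theorem interp_tensor_id_mul (f : Diag X Y) {F : Fam} (hF : act X (act W 1) * F = F) :
    interp (f ⊠ .id W) * F = interp f * F := by
  rw [interp_tensor_id, mul_assoc, hF]

theorem interp_tensor_id_id_mul (f : Diag X Y) {F : Fam}
    (hF : act X (act W (act W' 1)) * F = F) :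
    interp (f ⊠ .id W ⊠ .id W') * F = interp f * F := by
  rw [interp_tensor_id_id, mul_assoc, hF]

end

@[simp] theorem interp_cupL : interp Diag.cupL = fCupL := rfl

@[simp] theorem interp_cross : interp Diag.cross = fCross := rfl

@[simp] theorem interp_cupR : interp Diag.cupR = fCupR := rfl

theorem interp_crossRight : interp Diag.crossRight = actP (actQ 1) := by
  change (interp (.down ⊠ .up ⊠ .capR) * interp (.down ⊠ .cross ⊠ .down)) *
    interp (.cupR ⊠ .up ⊠ .down) = _
  have h := act_one_mul_interp (.cupR ⊠ .up ⊠ .down)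
  simp only [act_add] at h
  rw [mul_assoc, interp_tensor_id_mul _ (by simpa only [act_add] using h), interp_id_id_tensor,
    interp_id_tensor, interp_tensor_id_id]
  exact crossRight_eq

theorem interp_crossLeft : interp Diag.crossLeft = actP (actQ 1) := by
  change (interp (.capL ⊠ .up ⊠ .down) * interp (.down ⊠ .cross ⊠ .down)) *
    interp (.down ⊠ .up ⊠ .cupL) = _
  have h₁ : actQ (actP (actP (actQ 1))) * actQ (actP fCupL) = actQ (actP fCupL) := by
    simpa [interp_id_id_tensor] using act_one_mul_interp (.down ⊠ .up ⊠ .cupL)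
  have h₂ : actQ (actP (actP (actQ 1))) * (actQ fCross * actQ (actP fCupL)) =
      actQ fCross * actQ (actP fCupL) := by
    rw [← mul_assoc, ← actQ_mul _ natural_fCross, act_mul_fCross Natural.one.actQ,
      actQ_mul _ Natural.one.actQ.actP.actP, mul_assoc, h₁]
  rw [mul_assoc, interp_id_id_tensor,
    show act Q (act P (interp Diag.cupL)) = actQ (actP fCupL) from rfl,
    interp_tensor_id_mul (.down ⊠ .cross) (F := actQ (actP fCupL)) (W := Q) (by simpa using h₁),
    interp_id_tensor, show act Q (interp Diag.cross) = actQ fCross from rfl,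
    interp_tensor_id_id_mul .capL (F := actQ fCross * actQ (actP fCupL)) (W := P) (W' := Q)
      (by simpa using h₂)]
  exact crossLeft_eq

theorem interp_crossDown : interp Diag.crossDown = fCrossDown := by
  change (interp (.down ⊠ .down ⊠ .capR) * interp (.down ⊠ .crossRight ⊠ .down)) *
    interp (.cupR ⊠ .down ⊠ .down) = _
  have h := act_one_mul_interp (.cupR ⊠ .down ⊠ .down)
  simp only [act_add] at h
  rw [mul_assoc, interp_tensor_id_mul _ (by simpa only [act_add] using h), interp_id_id_tensor,
    interp_id_tensor, interp_tensor_id_id, interp_crossRight]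
  exact crossDown_eq

theorem interp_crossDown₂ : interp Diag.crossDown₂ = fCrossDown := by
  change (interp (.capL ⊠ .down ⊠ .down) * interp (.down ⊠ .crossLeft ⊠ .down)) *
    interp (.down ⊠ .down ⊠ .cupL) = _
  have h₁ : actQ (actQ (actP (actQ 1))) * actQ (actQ fCupL) = actQ (actQ fCupL) := by
    simpa [interp_id_id_tensor] using act_one_mul_interp (.down ⊠ .down ⊠ .cupL)
  have h : actP (actQ (actQ 1)) * actP (actQ 1) = actP (actQ 1) * actQ (actP (actQ 1)) := by
    have := act_mul_interp_of_bar Diag.crossLeft Natural.one.actQ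
      (by rw [← actQ_bar, bar_one])
    simpa [interp_crossLeft] using this
  have h₂ : actQ (actP (actQ (actQ 1))) * (actQ (actP (actQ 1)) * actQ (actQ fCupL)) =
      actQ (actP (actQ 1)) * actQ (actQ fCupL) := by
    rw [← mul_assoc, ← actQ_mul _ Natural.one.actQ.actP, h, actQ_mul _ Natural.one.actQ.actP.actQ,
      mul_assoc, h₁]
  rw [mul_assoc, interp_id_id_tensor,
    show act Q (act Q (interp Diag.cupL)) = actQ (actQ fCupL) from rfl,
    interp_tensor_id_mul (.down ⊠ .crossLeft) (F := actQ (actQ fCupL)) (W := Q)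
      (by simpa using h₁),
    interp_id_tensor, interp_crossLeft, show act Q (actP (actQ 1)) = actQ (actP (actQ 1)) from rfl,
    interp_tensor_id_id_mul .capL (F := actQ (actP (actQ 1)) * actQ (actQ fCupL)) (W := Q)
      (W' := Q) (by simpa using h₂)]
  exact crossDown₂_eq

theorem interp_dot_cross_left : interp ((.dotUp ⊠ .up) ⟫ .cross) =
    interp (.cross ⟫ (.up ⊠ .dotUp)) := by
  have h := interp_mul_act_one (.cross ⟫ (.up ⊠ .dotUp))
  have h' : interp (.cross ⟫ (.up ⊠ .dotUp)) = actP fDotU * fCross := by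
    rw [interp, interp_id_tensor]; rfl
  rw [h'] at h ⊢
  rw [interp, interp_tensor_id, ← h]
  simp only [act_add, act_of, actLetter_P] at h ⊢
  rw [← dot_cross_left, mul_assoc]
  rfl

theorem interp_dot_cross_right : interp ((.up ⊠ .dotUp) ⟫ .cross) =
    interp (.cross ⟫ (.dotUp ⊠ .up)) := by
  have h := interp_mul_act_one ((.up ⊠ .dotUp) ⟫ .cross)
  have h' : interp ((.up ⊠ .dotUp) ⟫ .cross) = fCross * actP fDotU := by
    rw [interp, interp_id_tensor]; rfl
  have h₁ := interp_mul_act_one (.cross ⟫ (.dotUp ⊠ .up))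
  have h₂ : interp (.cross ⟫ (.dotUp ⊠ .up)) = fDotU * fCross := by
    rw [interp_comp_tensor_id]; rfl
  rw [h'] at h
  rw [h₂] at h₁
  rw [h', h₂, ← h, ← h₁]
  exact dot_cross_right

theorem interp_dot_capL : interp ((.dotDown ⊠ .up) ⟫ .capL) =
    interp (.smul (-1) ((.down ⊠ .dotUp) ⟫ .capL)) := by
  have h := interp_mul_act_one (.smul (-1) ((.down ⊠ .dotUp) ⟫ .capL))
  have h' : interp (.smul (-1) ((.down ⊠ .dotUp) ⟫ .capL)) =
      (-1 : ℂ) • (fCapL * actQ fDotU) := by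
    rw [interp, interp, interp_id_tensor]; rfl
  rw [h', ← dot_capL] at h ⊢
  rw [interp, interp_tensor_id, ← h, mul_assoc]
  rfl

theorem interp_dot_capR : interp ((.dotUp ⊠ .down) ⟫ .capR) =
    interp ((.up ⊠ .dotDown) ⟫ .capR) := by
  have h := interp_mul_act_one ((.up ⊠ .dotDown) ⟫ .capR)
  have h' : interp ((.up ⊠ .dotDown) ⟫ .capR) = fCapR * actP fDotD := by
    rw [interp, interp_id_tensor]; rfl
  rw [h', ← dot_capR] at h ⊢
  rw [interp, interp_tensor_id, ← h, mul_assoc]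
  rfl

theorem interp_dot_cupR : interp (.cupR ⟫ (.dotDown ⊠ .up)) =
    interp (.cupR ⟫ (.down ⊠ .dotUp)) := by
  refine (interp_comp_tensor_id _ _).trans (dot_cupR.trans ?_)
  rw [interp, interp_id_tensor]
  rfl

theorem interp_dot_cupL : interp (.cupL ⟫ (.dotUp ⊠ .down)) =
    interp (.smul (-1) (.cupL ⟫ (.up ⊠ .dotDown))) := by
  refine (interp_comp_tensor_id _ _).trans (dot_cupL.trans ?_)
  rw [interp, interp, interp_id_tensor]
  rfl

theorem interp_braid :
    interp ((.cross ⊠ .up :) ⟫ (.up ⊠ .cross :) ⟫ (.cross ⊠ .up :)) =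
    interp ((.up ⊠ .cross :) ⟫ (.cross ⊠ .up :) ⟫ (.up ⊠ .cross :)) := by
  have h₀ : actP (actP (actP 1)) * actP fCross = actP fCross := by
    simpa [interp_id_tensor] using act_one_mul_interp (.up ⊠ .cross)
  have h₂ : actP fCross * actP (actP (actP 1)) = actP fCross := by
    simpa [interp_id_tensor] using interp_mul_act_one (.up ⊠ .cross)
  have h₃ : interp (.up ⊠ .cross) = actP fCross := interp_id_tensor P _
  have h₄ : interp (.cross ⊠ .up) = fCross * actP (actP (actP 1)) :=
    interp_tensor_id Diag.cross P
  change (interp (.cross ⊠ .up) * interp (.up ⊠ .cross)) * interp (.cross ⊠ .up) =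
    (interp (.up ⊠ .cross) * interp (.cross ⊠ .up)) * interp (.up ⊠ .cross)
  rw [h₃, h₄]
  have h := braid
  simp only [mul_assoc, h₀, h₂] at h ⊢
  exact h

theorem interp_bubble : interp (.cupR ⟫ .capL) = interp (.id 0) := bubble

theorem interp_dot_bubble :
    interp (.cupR ⟫ (.down ⊠ .dotUp) ⟫ .capL) = interp (.zero 0 0) := by
  change (fCapL * interp (.down ⊠ .dotUp)) * fCupR = 0
  rw [interp_id_tensor, mul_assoc]
  exact dot_bubble

theorem interp_left_curl :
    interp ((.cupR ⊠ .up :) ⟫ (.down ⊠ .cross :) ⟫ (.capL ⊠ .up :)) = interp (.zero P P) := by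
  refine Eq.trans ?_ left_curl
  change (interp (.capL ⊠ .up) * interp (.down ⊠ .cross)) * interp (.cupR ⊠ .up) = _
  rw [interp_id_tensor, interp_tensor_id, interp_tensor_id, mul_assoc, act_add]
  rfl

theorem interp_eq_of_localRel {X Y : Word} {f g : Diag X Y} (h : Diag.LocalRel f g) :
    interp f = interp g := by
  cases h with
  | zigzag_up_right =>
    change interp (.capR ⊠ .up) * interp (.up ⊠ .cupR) = _
    have h := act_one_mul_interp (.up ⊠ .cupR)
    rw [interp_tensor_id_mul _ (by simpa only [act_add] using h), interp_id_tensor]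
    exact zigzag_up_right
  | zigzag_down_right =>
    change interp (.down ⊠ .capR) * interp (.cupR ⊠ .down) = _
    rw [interp_id_tensor, interp_tensor_id, ← mul_assoc]
    exact (congrArg (· * _) zigzag_down_right).trans (act_mul 1 Natural.one Q).symm
  | zigzag_up_left =>
    change interp (.up ⊠ .capL) * interp (.cupL ⊠ .up) = _
    rw [interp_id_tensor, interp_tensor_id, ← mul_assoc]
    exact zigzag_up_left
  | zigzag_down_left =>
    change interp (.capL ⊠ .down) * interp (.down ⊠ .cupL) = _
    have h := act_one_mul_interp (.down ⊠ .cupL)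
    rw [interp_tensor_id_mul _ (by simpa only [act_add] using h), interp_id_tensor]
    exact zigzag_down_left
  | rotate_cross => rw [interp_crossDown, interp_crossDown₂]
  | cross_cross => exact cross_cross
  | braid =>
    exact interp_braid
  | right_left =>
    change interp Diag.crossLeft * interp Diag.crossRight = _
    rw [interp_crossRight, interp_crossLeft]
    exact (act_mul 1 Natural.one (P + Q)).symm
  | left_right =>
    change interp Diag.crossRight * interp Diag.crossLeft = _
    rw [interp_crossRight, interp_crossLeft]
    refine (act_mul 1 Natural.one (P + Q)).symm.trans (left_right.trans ?_)
    change _ = actQ (actP 1) + ((-1 : ℂ) • (fCupR * fCapL) + (-1 : ℂ) •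
      ((interp (.dotDown ⊠ .up) * fCupR) * (fCapL * interp (.down ⊠ .dotUp))))
    rw [interp_id_tensor, interp_tensor_id_mul .dotDown (W := P) (F := fCupR)
      (by simpa using act_one_mul_interp Diag.cupR)]
    rfl
  | bubble => exact interp_bubble
  | left_curl =>
    exact interp_left_curl
  | dot_cross_left => exact interp_dot_cross_left
  | dot_cross_right => exact interp_dot_cross_right
  | dot_capL => exact interp_dot_capL
  | dot_capR => exact interp_dot_capR
  | dot_cupR => exact interp_dot_cupR
  | dot_cupL => exact interp_dot_cupL
  | dotUp_dotUp => exact dotUp_dotUp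
  | dotDown_dotDown => exact dotDown_dotDown
  | dot_bubble =>
    exact interp_dot_bubble

end Model

end

end TwistedHeis

namespace TwistedHeis

noncomputable section

namespace Model

/-! ### Operators of finite rank -/

/-- Operators of finite rank. -/
def FiniteRank (A : Module.End ℂ V) : Prop := FiniteDimensional ℂ (LinearMap.range A)

theorem FiniteRank.mul_left {A : Module.End ℂ V} (h : FiniteRank A) (B : Module.End ℂ V) :
    FiniteRank (B * A) := by
  have : FiniteDimensional ℂ (LinearMap.range A) := h
  unfold FiniteRank
  rw [Module.End.mul_eq_comp, LinearMap.range_comp]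
  infer_instance

theorem FiniteRank.mul_right {A : Module.End ℂ V} (h : FiniteRank A) (B : Module.End ℂ V) :
    FiniteRank (A * B) := by
  have : FiniteDimensional ℂ (LinearMap.range A) := h
  exact Submodule.finiteDimensional_of_le (LinearMap.range_comp_le_range B A)

theorem FiniteRank.zero : FiniteRank 0 := by
  unfold FiniteRank
  rw [LinearMap.range_zero]
  infer_instance

theorem FiniteRank.add {A B : Module.End ℂ V} (hA : FiniteRank A) (hB : FiniteRank B) :
    FiniteRank (A + B) := by
  have : FiniteDimensional ℂ (LinearMap.range A) := hA
  have : FiniteDimensional ℂ (LinearMap.range B) := hB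
  refine Submodule.finiteDimensional_of_le (S₂ := LinearMap.range A ⊔ LinearMap.range B) ?_
  rintro _ ⟨v, rfl⟩
  exact Submodule.add_mem_sup ⟨v, rfl⟩ ⟨v, rfl⟩

theorem FiniteRank.sum {ι : Type} (s : Finset ι) {A : ι → Module.End ℂ V}
    (h : ∀ i ∈ s, FiniteRank (A i)) : FiniteRank (∑ i ∈ s, A i) :=
  Finset.sum_induction A FiniteRank (fun _ _ => FiniteRank.add) FiniteRank.zero h

theorem FiniteRank.tw {A : Module.End ℂ V} (h : FiniteRank A) (b : Bool) : FiniteRank (tw b A) := by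
  cases b
  · exact h
  · exact (h.mul_left _).mul_right _

/-- At a fixed level there are finitely many labels and two parities, so adding an upward strand
preserves finite rank. -/
theorem actP_eq_sum (T : Fam) (j : ℕ) : actP T j = ∑ i ∈ Finset.range j ×ˢ Finset.univ,
    cons i * tw i.2 (T j) * zz i.1 * byHead (fun a => if a = i then 1 else 0) := by
  refine hom_cases ?_ fun a v => ?_
  · simp [LinearMap.sum_apply]
  · rw [LinearMap.sum_apply, actP_cons]
    split_ifs with ha
    · rw [Finset.sum_eq_single a]
      · simp
      · intro i _ hi; simp [hi.symm]
      · intro h; simp [ha] at h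
    · refine (Finset.sum_eq_zero fun i hi => ?_).symm
      have : a ≠ i := by rintro rfl; simp at hi; omega
      simp [this]

theorem FiniteRank.act {T : Fam} (h : ∀ j, FiniteRank (T j)) (X : Word) (j : ℕ) :
    FiniteRank (act X T j) := by
  revert j
  refine act_induction (p := fun F => ∀ j, FiniteRank (F T j)) h (fun F h j => ?_)
    (fun F h j => (h (j + 1)).mul_right _) X
  rw [Function.comp_apply, actP_eq_sum]
  exact FiniteRank.sum _ fun i _ => ((((h j).tw _).mul_left _).mul_right _).mul_right _

/-! ### The finite dimensional representations -/

/-- The projection to the empty sequence, at all levels. -/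
def vac : Fam := fun _ => pnil

theorem range_pnil : LinearMap.range pnil = ℂ ∙ nil := by
  refine le_antisymm ?_ ?_
  · rintro _ ⟨v, rfl⟩
    have h : ∀ v, pnil v ∈ ℂ ∙ nil := by
      intro v
      induction v using Finsupp.induction_linear with
      | zero => simp
      | add v w hv hw => rw [map_add]; exact add_mem hv hw
      | single w r =>
        rw [← mul_one r, ← smul_eq_mul, ← Finsupp.smul_single, map_smul, pnil, lin_single]
        refine Submodule.smul_mem _ _ ?_
        split_ifs
        · exact Submodule.mem_span_singleton_self _
        · exact zero_mem _
    exact h v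
  · rw [Submodule.span_singleton_le_iff_mem]
    exact ⟨nil, pnil_nil⟩

theorem nil_ne_zero : nil ≠ 0 := by simp [nil]

theorem natural_vac : Natural vac where
  rel {j j' φ} _ v := by
    refine LinearMap.congr_fun (f := pnil * rel φ) (g := rel φ * pnil)
      (hom_cases (by simp) fun a v => by simp) v
  zz {i j} _ v := by
    refine LinearMap.congr_fun (f := pnil * zz i) (g := zz i * pnil)
      (hom_cases (by simp) fun a v => by by_cases h : a.1 = i <;> simp [h]) v
  cl {i j} _ v := by
    refine LinearMap.congr_fun (f := pnil * cl i) (g := cl i * tw true pnil)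
      (hom_cases (by simp) fun a v => by by_cases h : a.1 = i <;> simp [h]) v

theorem bar_vac : bar true vac = vac :=
  funext fun _ => hom_cases (by simp [bar, vac]) fun a v => by simp [bar, vac]

/-- The space attached to an object. -/
def space (X : Word) : Submodule ℂ V := LinearMap.range (act X vac 0)

instance (X : Word) : FiniteDimensional ℂ (space X) := by
  refine FiniteRank.act (fun j => ?_) X 0
  unfold FiniteRank vac
  rw [range_pnil]
  infer_instance

/-- The operators of a morphism. -/
def interpHom {X Y : Word} : Hom X Y → Fam :=
  Quot.lift interp fun _ _ h => interp_eq_of_rel interp_eq_of_localRel h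

/-- The family `vac` is natural and even, so it passes through every diagram without sign and images
of `vac` go to images of `vac`. -/
theorem interpHom_mem {X Y : Word} (f : Hom X Y) (v : V) (hv : v ∈ space X) :
    interpHom f 0 v ∈ space Y := by
  obtain ⟨f⟩ := f
  obtain ⟨v, rfl⟩ := hv
  refine ⟨interp f 0 v, ?_⟩
  exact LinearMap.congr_fun (congrFun (act_mul_interp_of_bar f natural_vac bar_vac) 0) v

/-- The linear map between finite dimensional spaces attached to a morphism. -/
def repr {X Y : Word} (f : Hom X Y) : space X →ₗ[ℂ] space Y :=
  (interpHom f 0).restrict (interpHom_mem f)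

theorem repr_comp {X Y Z : Word} (f : Hom X Y) (g : Hom Y Z) :
    repr (f.comp g) = repr g ∘ₗ repr f := by
  obtain ⟨f⟩ := f
  obtain ⟨g⟩ := g
  rfl

theorem repr_add {X Y : Word} (f g : Hom X Y) : repr (f + g) = repr f + repr g := by
  obtain ⟨f⟩ := f
  obtain ⟨g⟩ := g
  rfl

theorem repr_smul {X Y : Word} (r : ℂ) (f : Hom X Y) : repr (r • f) = r • repr f := by
  obtain ⟨f⟩ := f
  rfl

theorem repr_id (X : Word) : repr (Hom.id X) = LinearMap.id := by
  refine LinearMap.ext fun v => Subtype.ext ?_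
  obtain ⟨_, v, rfl⟩ := v
  have h := act_mul 1 natural_vac X
  rw [one_mul] at h
  exact (LinearMap.congr_fun (congrFun h 0) v).symm

theorem linearMap_trace_comp_comm {E : Type*} [AddCommGroup E] [Module ℂ E] (p q : Submodule ℂ E)
    [FiniteDimensional ℂ p] [FiniteDimensional ℂ q] (f : p →ₗ[ℂ] q) (g : q →ₗ[ℂ] p) :
    LinearMap.trace ℂ p (g ∘ₗ f) = LinearMap.trace ℂ q (f ∘ₗ g) :=
  LinearMap.trace_comp_comm' f g

theorem linearMap_trace_id {E : Type*} [AddCommGroup E] [Module ℂ E] (p : Submodule ℂ E)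
    [FiniteDimensional ℂ p] :
    LinearMap.trace ℂ p LinearMap.id = Module.finrank ℂ p := LinearMap.trace_id ℂ p

/-- The trace of an endomorphism. -/
def trace (X : Word) : Hom X X →ₗ[ℂ] ℂ where
  toFun f := LinearMap.trace ℂ (space X) (repr f)
  map_add' f g := by rw [repr_add, map_add]
  map_smul' r f := by rw [repr_smul, map_smul]; rfl

/-- The ordinary trace is used, not the supertrace: the trace relation identifies `fg` and `gf`
without a sign also when both factors are odd. -/
theorem trace_comp_comm {X Y : Word} (f : Hom X Y) (g : Hom Y X) :
    trace X (f.comp g) = trace Y (g.comp f) := by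
  change LinearMap.trace ℂ _ (repr (f.comp g)) = LinearMap.trace ℂ _ (repr (g.comp f))
  rw [repr_comp, repr_comp]
  exact linearMap_trace_comp_comm (space X) (space Y) (repr f) (repr g)

theorem trace_id_zero : trace 0 (Hom.id 0) = 1 := by
  change LinearMap.trace ℂ (space 0) (repr (Hom.id 0)) = 1
  have h : Module.finrank ℂ (space 0) = 1 := by
    change Module.finrank ℂ (LinearMap.range pnil) = 1
    rw [range_pnil]
    exact finrank_span_singleton nil_ne_zero
  rw [repr_id]
  exact (linearMap_trace_id (space 0)).trans (by rw [h, Nat.cast_one])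

/-- The trace of an element of the direct sum. -/
def totalTrace : DirectSum Word EvenEnd →ₗ[ℂ] ℂ :=
  DirectSum.toModule ℂ Word ℂ fun X => trace X ∘ₗ (homPiece 0 X X).subtype

theorem totalTrace_of {X : Word} (f : EvenEnd X) :
    totalTrace (DirectSum.of EvenEnd X f) = trace X f.1 := by
  refine (DirectSum.toModule_lof ℂ X f)

/-- The ideal is reached by tensoring on both sides. Since `u` and `w` are even, `u ⊗ fg ⊗ w`
factors without signs as `u ⊗ f ⊗ w` followed by `1 ⊗ g ⊗ 1`, and exchanging the two factors gives
`u ⊗ gf ⊗ w`. -/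
theorem totalTrace_mul_mul {X Y : Word} (f : Hom X Y) (g : Hom Y X)
    (hfg : f.comp g ∈ homPiece 0 X X) (hgf : g.comp f ∈ homPiece 0 Y Y)
    (a b : DirectSum Word EvenEnd) :
    totalTrace (a * DirectSum.of EvenEnd X ⟨f.comp g, hfg⟩ * b) =
      totalTrace (a * DirectSum.of EvenEnd Y ⟨g.comp f, hgf⟩ * b) := by
  induction a using DirectSum.induction_on with
  | zero => simp only [zero_mul]
  | add a a' h h' => simp only [add_mul, map_add, h, h']
  | of U u =>
  induction b using DirectSum.induction_on with
  | zero => simp only [mul_zero]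
  | add b b' h h' => simp only [mul_add, map_add, h, h']
  | of W w =>
  rw [DirectSum.of_mul_of, DirectSum.of_mul_of, DirectSum.of_mul_of, DirectSum.of_mul_of,
    totalTrace_of, totalTrace_of]
  change trace _ ((u.1.tensor (f.comp g)).tensor w.1) = trace _ ((u.1.tensor (g.comp f)).tensor w.1)
  have h₁ : (u.1.tensor (f.comp g)).tensor w.1 = ((u.1.tensor f).tensor w.1).comp
      (((Hom.id U).tensor g).tensor (Hom.id W)) := by
    rw [Hom.interchange_right _ _ _ (id_mem W), Hom.interchange_left u.2, Hom.comp_id, Hom.comp_id]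
  have h₂ : (u.1.tensor (g.comp f)).tensor w.1 = (((Hom.id U).tensor g).tensor (Hom.id W)).comp
      ((u.1.tensor f).tensor w.1) := by
    rw [Hom.interchange_right _ _ _ w.2, Hom.interchange_left (id_mem U), Hom.id_comp, Hom.id_comp]
  rw [h₁, h₂, trace_comp_comm]

/-- The congruence defined by the trace. -/
def traceCon : RingCon (DirectSum Word EvenEnd) where
  r x y := ∀ a b, totalTrace (a * x * b) = totalTrace (a * y * b)
  iseqv := ⟨fun _ _ _ => rfl, fun h a b => (h a b).symm, fun h h' a b => (h a b).trans (h' a b)⟩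
  add' h h' a b := by simp only [mul_add, add_mul, map_add, h a b, h' a b]
  mul' {x y x' y'} h h' a b := by
    have h₁ := h a (x' * b)
    have h₂ := h' (a * y) b
    simp only [mul_assoc] at h₁ h₂ ⊢
    exact h₁.trans h₂

theorem not_traceCon_one_zero : ¬ traceCon 1 0 := by
  intro h
  have h₁ := h 1 1
  rw [mul_one, mul_one, mul_one, mul_zero, map_zero] at h₁
  have h₂ : totalTrace 1 = 1 := (totalTrace_of (X := 0) ⟨Hom.id 0, id_mem 0⟩).trans trace_id_zero
  rw [h₂] at h₁
  exact one_ne_zero h₁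

end Model

/-- The even trace maps to the quotient by the congruence of the trace functional, where 1 and 0
differ because the functional is 1 at the unit. -/
instance : Nontrivial EvenTrace := by
  refine ⟨1, 0, fun h => Model.not_traceCon_one_zero ?_⟩
  have hrel : ∀ ⦃x y⦄, TraceRel x y → Model.traceCon.mk' x = Model.traceCon.mk' y := by
    rintro _ _ ⟨f, g, hf, hg⟩
    exact (RingCon.eq _).2 (Model.totalTrace_mul_mul f g _ _)
  have h₁ := congrArg (RingQuot.lift ⟨Model.traceCon.mk', hrel⟩) h
  rw [map_one, map_zero] at h₁
  exact (RingCon.eq _).1 h₁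

end

end TwistedHeis

namespace TwistedHeis

noncomputable section

/-! ## The two isomorphisms -/

theorem smul_mul_smul_sub {R : Type*} [Ring R] [Algebra ℂ R] (r s : ℂ) (a b : R) :
    (r • a) * (s • b) - (s • b) * (r • a) = (r * s) • (a * b - b * a) := by
  rw [smul_mul_smul_comm, smul_mul_smul_comm, mul_comm s r, smul_sub]

/-- The homomorphism given by elements that satisfy the relations. -/
def HeisTw.lift {R : Type*} [Ring R] [Algebra ℂ R] (x : ℤ → R)
    (hx : ∀ k l, x k * x l - x l * x k =
      algebraMap ℂ R (if k + l + 1 = 0 then (k : ℂ) + 1 / 2 else 0)) : HeisTw →ₐ[ℂ] R :=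
  RingQuot.liftAlgHom ℂ ⟨FreeAlgebra.lift ℂ x, by
    rintro _ _ ⟨k, l⟩
    rw [map_sub, map_mul, map_mul, FreeAlgebra.lift_ι_apply, FreeAlgebra.lift_ι_apply, hx,
      AlgHom.commutes]⟩

theorem HeisTw.lift_heisGen {R : Type*} [Ring R] [Algebra ℂ R] (x : ℤ → R)
    (hx : ∀ k l, x k * x l - x l * x k =
      algebraMap ℂ R (if k + l + 1 = 0 then (k : ℂ) + 1 / 2 else 0)) (k : ℤ) :
    HeisTw.lift x hx (heisGen k) = x k := by
  rw [HeisTw.lift, heisGen, RingQuot.liftAlgHom_mkAlgHom_apply, FreeAlgebra.lift_ι_apply]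

theorem adjoin_range_heisGen : Algebra.adjoin ℂ (Set.range heisGen) = ⊤ := by
  have h : Set.range heisGen =
      (Set.range (FreeAlgebra.ι ℂ)).image (RingQuot.mkAlgHom ℂ HeisRel) := by
    rw [← Set.range_comp]; rfl
  rw [h, ← AlgHom.map_adjoin, FreeAlgebra.adjoin_range_ι, Algebra.map_top,
    AlgHom.range_eq_top]
  exact RingQuot.mkAlgHom_surjective ℂ HeisRel

theorem HeisTw.range_lift {R : Type*} [Ring R] [Algebra ℂ R] (x : ℤ → R)
    (hx : ∀ k l, x k * x l - x l * x k =
      algebraMap ℂ R (if k + l + 1 = 0 then (k : ℂ) + 1 / 2 else 0)) :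
    (HeisTw.lift x hx).range = Algebra.adjoin ℂ (Set.range x) := by
  rw [← Algebra.map_top, ← adjoin_range_heisGen, AlgHom.map_adjoin, ← Set.range_comp]
  congr 2
  exact funext (HeisTw.lift_heisGen x hx)

/-- The isomorphism onto the subalgebra generated by elements that satisfy the relations. -/
def HeisTw.equiv {R : Type*} [Ring R] [Algebra ℂ R] [Nontrivial R] (x : ℤ → R)
    (hx : ∀ k l, x k * x l - x l * x k =
      algebraMap ℂ R (if k + l + 1 = 0 then (k : ℂ) + 1 / 2 else 0)) (S : Subalgebra ℂ R)
    (hS : Algebra.adjoin ℂ (Set.range x) = S) : HeisTw ≃ₐ[ℂ] S :=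
  (AlgEquiv.ofInjective (HeisTw.lift x hx) (HeisTw.injective_of_nontrivial _)).trans
    (Subalgebra.equivOfEq _ _ ((HeisTw.range_lift x hx).trans hS))

theorem HeisTw.equiv_heisGen {R : Type*} [Ring R] [Algebra ℂ R] [Nontrivial R] (x : ℤ → R)
    (hx : ∀ k l, x k * x l - x l * x k =
      algebraMap ℂ R (if k + l + 1 = 0 then (k : ℂ) + 1 / 2 else 0)) (S : Subalgebra ℂ R)
    (hS : Algebra.adjoin ℂ (Set.range x) = S) (k : ℤ) :
    (HeisTw.equiv x hx S hS (heisGen k) : R) = x k :=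
  HeisTw.lift_heisGen x hx k

theorem adjoin_range_smul {R : Type*} [Ring R] [Algebra ℂ R] {r : ℂ} (hr : r ≠ 0) (x : ℤ → R) :
    Algebra.adjoin ℂ (Set.range fun k => r • x k) = Algebra.adjoin ℂ (Set.range x) := by
  refine le_antisymm (Algebra.adjoin_le ?_) (Algebra.adjoin_le ?_)
  · rintro _ ⟨k, rfl⟩
    exact Subalgebra.smul_mem _ (Algebra.subset_adjoin (Set.mem_range_self k)) r
  · rintro _ ⟨k, rfl⟩
    have h := Subalgebra.smul_mem _ (Algebra.subset_adjoin (R := ℂ)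
      (Set.mem_range_self (f := fun k => r • x k) k)) r⁻¹
    rwa [smul_smul, inv_mul_cancel₀ hr, one_smul] at h

theorem smul_mul_smul_sub_eq {R : Type*} [Ring R] [Algebra ℂ R] {r s c : ℂ} {a b : R}
    (h : a * b - b * a = algebraMap ℂ R c) :
    (r • a) * (s • b) - (s • b) * (r • a) = algebraMap ℂ R (r * s * c) := by
  rw [smul_mul_smul_sub, h, Algebra.smul_def, ← map_mul]

/-- The reversal of the index compensates the sign of the commutator of cycles: `1 / 4 * (-2) * (2 *
(-k - 1) + 1) = k + 1 / 2`. -/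
theorem half_h_comm (k l : ℤ) :
    ((1 / 2 : ℂ) • h (-(2 * k + 1))) * ((1 / 2 : ℂ) • h (-(2 * l + 1))) -
      ((1 / 2 : ℂ) • h (-(2 * l + 1))) * ((1 / 2 : ℂ) • h (-(2 * k + 1))) =
      algebraMap ℂ EvenTrace (if k + l + 1 = 0 then (k : ℂ) + 1 / 2 else 0) := by
  have hk (k : ℤ) : -(2 * k + 1) = 2 * (-k - 1) + 1 := by ring
  rw [hk, hk]
  have hc := smul_mul_smul_sub_eq (R := EvenTrace) (r := 1 / 2) (s := 1 / 2)
    (h_odd_comm (-k - 1) (-l - 1))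
  refine Eq.trans hc (congrArg _ ?_)
  by_cases hkl : k + l + 1 = 0
  · rw [if_pos hkl, if_pos (by omega)]
    push_cast
    ring
  · rw [if_neg hkl, if_neg (by omega), mul_zero]

theorem range_h_neg : (Set.range fun k : ℤ => h (-(2 * k + 1))) =
    Set.range fun n : ℤ => h (2 * n + 1) := by
  have hk (k : ℤ) : -(2 * (-k - 1) + 1) = 2 * k + 1 := by ring
  refine (Function.Surjective.range_comp (f := fun k : ℤ => -k - 1) (fun k => ⟨-k - 1, by ring⟩)
    (fun k : ℤ => h (-(2 * k + 1)))).symm.trans ?_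
  simp only [Function.comp_def, hk]

theorem mkAlgHom_wC : RingQuot.mkAlgHom ℂ LevelOneRel wC = 1 :=
  (RingQuot.mkAlgHom_rel ℂ LevelOneRel.level).trans (map_one _)

theorem wOddBar_comm (n m : ℤ) : wOddBar n * wOddBar m - wOddBar m * wOddBar n =
    algebraMap ℂ WMinusOne (if n + m + 1 = 0 then 2 * (n : ℂ) + 1 else 0) := by
  have h := congrArg (RingQuot.mkAlgHom ℂ LevelOneRel) (wOdd_comm n m)
  rw [map_sub, map_mul, map_mul, map_smul, mkAlgHom_wC] at h
  exact h.trans (Algebra.algebraMap_eq_smul_one _).symm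

theorem inv_sqrt_two_ne_zero : ((1 / Real.sqrt 2 : ℝ) : ℂ) ≠ 0 :=
  Complex.ofReal_ne_zero.2 (by positivity)

theorem inv_sqrt_two_mul_self :
    ((1 / Real.sqrt 2 : ℝ) : ℂ) * ((1 / Real.sqrt 2 : ℝ) : ℂ) = 1 / 2 := by
  rw [← Complex.ofReal_mul, div_mul_div_comm, Real.mul_self_sqrt zero_le_two]
  norm_num

theorem inv_sqrt_two_smul_wOddBar_comm (k l : ℤ) :
    (((1 / Real.sqrt 2 : ℝ) : ℂ) • wOddBar k) * (((1 / Real.sqrt 2 : ℝ) : ℂ) • wOddBar l) -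
      (((1 / Real.sqrt 2 : ℝ) : ℂ) • wOddBar l) * (((1 / Real.sqrt 2 : ℝ) : ℂ) • wOddBar k) =
      algebraMap ℂ WMinusOne (if k + l + 1 = 0 then (k : ℂ) + 1 / 2 else 0) := by
  refine (smul_mul_smul_sub_eq (wOddBar_comm k l)).trans (congrArg _ ?_)
  rw [inv_sqrt_two_mul_self]
  split_ifs <;> ring

/-- The isomorphism of the twisted Heisenberg algebra with the algebra of the odd cycles. -/
def heisEquivOddCycles : HeisTw ≃ₐ[ℂ] oddCycles :=
  HeisTw.equiv (fun k => (1 / 2 : ℂ) • h (-(2 * k + 1))) half_h_comm oddCycles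
    ((adjoin_range_smul (by norm_num) fun k => h (-(2 * k + 1))).trans
      (congrArg (Algebra.adjoin ℂ) range_h_neg))

/-- The isomorphism of the twisted Heisenberg algebra with the algebra of the odd modes. -/
def heisEquivOddModes : HeisTw ≃ₐ[ℂ] oddModes :=
  HeisTw.equiv (fun k => ((1 / Real.sqrt 2 : ℝ) : ℂ) • wOddBar k) inv_sqrt_two_smul_wOddBar_comm
    oddModes (adjoin_range_smul inv_sqrt_two_ne_zero wOddBar)

theorem heisEquivOddCycles_heisGen (n : ℤ) :
    (heisEquivOddCycles (heisGen n) : EvenTrace) = (1 / 2 : ℂ) • h (-(2 * n + 1)) :=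
  HeisTw.equiv_heisGen _ half_h_comm _ _ n

theorem heisEquivOddModes_heisGen (n : ℤ) :
    (heisEquivOddModes (heisGen n) : WMinusOne) = ((1 / Real.sqrt 2 : ℝ) : ℂ) • wOddBar n :=
  HeisTw.equiv_heisGen _ inv_sqrt_two_smul_wOddBar_comm _ _ n

theorem heisEquivOddCycles_symm_apply {n : ℤ} {a : oddCycles}
    (ha : (a : EvenTrace) = h (-(2 * n + 1))) :
    heisEquivOddCycles.symm a = (2 : ℂ) • heisGen n := by
  rw [AlgEquiv.symm_apply_eq, map_smul]
  refine Subtype.ext (ha.trans ?_)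
  refine Eq.trans ?_ (congrArg ((2 : ℂ) • ·) (heisEquivOddCycles_heisGen n)).symm
  rw [smul_smul, mul_one_div_cancel two_ne_zero, one_smul]

end

end TwistedHeis

open TwistedHeis
theorem mainTheorem7 :
    (∀ n m : ℕ, h (2 * n + 1) * h (-(2 * m + 1)) - h (-(2 * m + 1)) * h (2 * n + 1) =
      algebraMap ℂ EvenTrace (if n = m then -2 * (2 * (n : ℂ) + 1) else 0)) ∧
    (∀ n m : ℤ, wOdd n * wOdd m - wOdd m * wOdd n =
      (if n + m + 1 = 0 then 2 * (n : ℂ) + 1 else 0) • wC) ∧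
    ∃ (φ : HeisTw ≃ₐ[ℂ] oddCycles) (ψ : HeisTw ≃ₐ[ℂ] oddModes),
      (∀ n : ℤ, (φ (heisGen n) : EvenTrace) = (1 / 2 : ℂ) • h (-(2 * n + 1))) ∧
      (∀ n : ℤ, (ψ (heisGen n) : WMinusOne) = ((1 / Real.sqrt 2 : ℝ) : ℂ) • wOddBar n) ∧
      (∀ (n : ℤ) (a : oddCycles), (a : EvenTrace) = h (-(2 * n + 1)) →
        ((φ.symm.trans ψ) a : WMinusOne) = ((Real.sqrt 2 : ℝ) : ℂ) • wOddBar n) := by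
  refine ⟨h_odd_comm_aux, wOdd_comm, heisEquivOddCycles, heisEquivOddModes,
    heisEquivOddCycles_heisGen, heisEquivOddModes_heisGen, fun n a ha => ?_⟩
  rw [AlgEquiv.trans_apply, heisEquivOddCycles_symm_apply ha, map_smul]
  refine (congrArg ((2 : ℂ) • ·) (heisEquivOddModes_heisGen n)).trans ?_
  -- The factor is `2 * (1 / √2) = √2`, where 2 inverts the normalization of `φ`.
  rw [smul_smul, ← Complex.ofReal_ofNat, ← Complex.ofReal_mul, mul_one_div, Real.div_sqrt]
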